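/- **Theorem (Hille–Yosida, dense case).** Let $(\Omega,\mathcal F,P)$ be a probability space, $\mathbb K\in\{\mathbb R,\mathbb C\}$, and let $L^0(\mathcal F,\mathbb K)$ be the algebra of $\mathbb K$-valued random variables modulo almost sure equality. Let $(S,\|\cdot\|)$ be a random normed module over $\mathbb K$ with base $(\Omega,\mathcal F,P)$, i.e. an $L^0(\mathcal F,\mathbb K)$-module with a map $\|\cdot\|:S\to L^0_+(\mathcal F)=\{\eta\in L^0(\mathcal F,\mathbb R):\eta\ge 0\}$ such that $\|x\|=0\Rightarrow x=0$, $\|\zeta x\|=|\zeta|\,\|x\|$ and $\|x+y\|\le\|x\|+\|y\|$. The $(\varepsilon,\lambda)$-topology $\mathcal T_{\varepsilon,\lambda}$ on $S$ is the linear topology with local base at $0$ given by the sets $\{z: P(\|z\|<\varepsilon)>1-\lambda\}$, $\varepsilon>0$, $0<\lambda<1$; assume that $S$ is $\mathcal T_{\varepsilon,\lambda}$-complete. Let $B(S)$ be the set of module homomorphisms $T:S\to S$ for which some $\eta\in L^0_+(\mathcal F)$ satisfies $\|Tz\|\le\eta\|z\|$ for all $z\in S$, and let $\|T\|$ be the infimum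 in $L^0(\mathcal F,\mathbb R)$ of all such $\eta$. Let $C\in B(S)$ be injective with range $R(C)$ dense in $(S,\mathcal T_{\varepsilon,\lambda})$, let $A:D(A)\to S$ be a module homomorphism on a submodule $D(A)\subseteq S$, and let $M\in L^0_+(\mathcal F)$, $\xi\in L^0(\mathcal F,\mathbb R)$. Then the following are equivalent. (a) There is a family $\{W(s):s\ge 0\}\subset B(S)$ such that $W(0)=C$, $C\,W(s+t)=W(t)W(s)$ for all $s,t\ge0$, $s\mapsto W(s)x$ is $\mathcal T_{\varepsilon,\lambda}$-continuous on $[0,\infty)$ for every $x\in S$, $\|W(s)\|\le Me^{\xi s}$ for all $s\ge 0$, and $A$ is its infinitesimal generator: $D(A)$ is the set of $x\in S$ for which the $\mathcal T_{\varepsilon,\lambda}$-limit $\lim_{s\downarrow0}\frac{W(s)x-Cx}{s}$ exists and lies in $R(C)$, and $Ax=C^{-1}\lim_{s\downarrow0}\frac{W(s)x-Cx}{s}$ for $x\in D(A)$. (b) The following five conditions hold, where $\eta$ ranges over all elements of $L^0(\mathcal F,\mathbb R)$ with $\eta>\xi$ almost surely, and $n$ over all positive integers: 1. $A$ is closed (its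 graph is closed in the product topology of $\mathcal T_{\varepsilon,\lambda}$ on $S\times S$) and $D(A)$ is dense in $(S,\mathcal T_{\varepsilon,\lambda})$; 2. every such $\eta$ belongs to the $C$-resolvent set of $A$, i.e. $\eta-A:D(A)\to S$ is injective and $R(C)\subseteq R(\eta-A)$; 3. $R(C)\subseteq D((\eta-A)^{-n})$ for all such $\eta$ and $n$, where $(\eta-A)^{-n}$ is the $n$-fold composition of $(\eta-A)^{-1}:R(\eta-A)\to D(A)$ with its natural domain; 4. for all such $\eta$ and $n$, $(\eta-A)^{-n}C\in B(S)$ and $\|(\eta-A)^{-n}C\|\le M(\eta-\xi)^{-n}$; 5. $A=C^{-1}AC$, where $D(C^{-1}AC)=\{x\in S: Cx\in D(A),\ ACx\in R(C)\}$. -/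

import Mathlib

open MeasureTheory Filter Topology
open scoped NNReal

/-! ### The algebra of random variables modulo almost sure equality -/

/-- `Ω →ₘ[P] 𝕜` is the algebra of (classes of) `𝕜`-valued random variables, with Mathlib's pointwise
addition and multiplication; Mathlib lacks only the distributive laws. -/
noncomputable instance aeEqFunCommRing {Ω : Type*} [MeasurableSpace Ω] {P : Measure Ω}
    {R : Type*} [TopologicalSpace R] [CommRing R] [IsTopologicalRing R] :
    CommRing (Ω →ₘ[P] R) :=
  { AEEqFun.instAddCommGroup, AEEqFun.instCommMonoid with
    left_distrib := fun a b c => by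
      apply AEEqFun.ext
      filter_upwards [AEEqFun.coeFn_mul a (b + c), AEEqFun.coeFn_add b c,
        AEEqFun.coeFn_add (a * b) (a * c), AEEqFun.coeFn_mul a b, AEEqFun.coeFn_mul a c]
        with x h1 h2 h3 h4 h5
      rw [h1, h3]
      simp only [Pi.mul_apply, Pi.add_apply, h2, h4, h5, mul_add]
    right_distrib := fun a b c => by
      apply AEEqFun.ext
      filter_upwards [AEEqFun.coeFn_mul (a + b) c, AEEqFun.coeFn_add a b,
        AEEqFun.coeFn_add (a * c) (b * c), AEEqFun.coeFn_mul a c, AEEqFun.coeFn_mul b c]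
        with x h1 h2 h3 h4 h5
      rw [h1, h3]
      simp only [Pi.mul_apply, Pi.add_apply, h2, h4, h5, add_mul]
    zero_mul := fun a => by
      apply AEEqFun.ext
      filter_upwards [AEEqFun.coeFn_mul (0 : Ω →ₘ[P] R) a,
        AEEqFun.coeFn_zero (α := Ω) (β := R) (μ := P)] with x h1 h2
      rw [h1, h2]
      simp only [Pi.mul_apply, Pi.zero_apply, h2, zero_mul]
    mul_zero := fun a => by
      apply AEEqFun.ext
      filter_upwards [AEEqFun.coeFn_mul a (0 : Ω →ₘ[P] R),
        AEEqFun.coeFn_zero (α := Ω) (β := R) (μ := P)] with x h1 h2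
      rw [h1, h2]
      simp only [Pi.mul_apply, Pi.zero_apply, h2, mul_zero] }

namespace L0

variable {Ω : Type*} [MeasurableSpace Ω] {P : Measure Ω}

/-- The modulus `|ζ|` of a scalar random variable. -/
noncomputable def modulus {𝕜 : Type*} [RCLike 𝕜] (ζ : Ω →ₘ[P] 𝕜) : Ω →ₘ[P] ℝ :=
  AEEqFun.comp (fun z : 𝕜 => ‖z‖) continuous_norm ζ

/-- A real random variable regarded as a `𝕜`-valued one. -/
noncomputable def toScalar (𝕜 : Type*) [RCLike 𝕜] (η : Ω →ₘ[P] ℝ) : Ω →ₘ[P] 𝕜 :=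
  AEEqFun.comp (fun r : ℝ => (r : 𝕜)) RCLike.continuous_ofReal η

/-- `e ^ η` for a real random variable `η`. -/
noncomputable def exp (η : Ω →ₘ[P] ℝ) : Ω →ₘ[P] ℝ :=
  AEEqFun.comp Real.exp Real.continuous_exp η

/-- The pointwise inverse `1 / η` of a real random variable (used only when `η > 0` a.s.). -/
noncomputable def inv (η : Ω →ₘ[P] ℝ) : Ω →ₘ[P] ℝ :=
  AEEqFun.compMeasurable (fun r : ℝ => r⁻¹) measurable_inv η

/-- `ξ < η` on all of `Ω`, that is, almost surely. -/
def StrictLT (ξ η : Ω →ₘ[P] ℝ) : Prop := ∀ᵐ ω ∂P, ξ ω < η ω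

end L0

/-! ### Random normed modules -/

/-- An `L⁰`-norm on a module `S` over the algebra of `𝕜`-valued random variables; the pair of `S`
and such a norm is a random normed module over `𝕜` with base `(Ω, P)`. -/
structure RandomNorm {Ω : Type*} [MeasurableSpace Ω] (P : Measure Ω) (𝕜 : Type*) [RCLike 𝕜]
    (S : Type*) [AddCommGroup S] [Module (Ω →ₘ[P] 𝕜) S] where
  toFun : S → (Ω →ₘ[P] ℝ)
  nonneg : ∀ x, 0 ≤ toFun x
  eq_zero : ∀ x, toFun x = 0 → x = 0
  smul : ∀ (ζ : Ω →ₘ[P] 𝕜) (x : S), toFun (ζ • x) = L0.modulus ζ * toFun x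
  add_le : ∀ x y, toFun (x + y) ≤ toFun x + toFun y

namespace RandomNorm

variable {Ω : Type*} [MeasurableSpace Ω] {P : Measure Ω} {𝕜 : Type*} [RCLike 𝕜]
  {S : Type*} [AddCommGroup S] [Module (Ω →ₘ[P] 𝕜) S]

instance : CoeFun (RandomNorm P 𝕜 S) (fun _ => S → (Ω →ₘ[P] ℝ)) := ⟨RandomNorm.toFun⟩

theorem map_zero (N : RandomNorm P 𝕜 S) : N 0 = 0 := by
  have h := N.smul 0 0
  rw [zero_smul (Ω →ₘ[P] 𝕜) (0 : S)] at h
  rw [h]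
  apply AEEqFun.ext
  filter_upwards [AEEqFun.coeFn_mul (L0.modulus (0 : Ω →ₘ[P] 𝕜)) (N 0),
    AEEqFun.coeFn_comp (fun z : 𝕜 => ‖z‖) continuous_norm (0 : Ω →ₘ[P] 𝕜),
    AEEqFun.coeFn_zero (α := Ω) (β := 𝕜) (μ := P),
    AEEqFun.coeFn_zero (α := Ω) (β := ℝ) (μ := P)] with ω h1 h2 h3 h4
  rw [h1, h4]
  simp only [Pi.mul_apply, L0.modulus, h2, Function.comp_apply, h3, Pi.zero_apply, norm_zero,
    zero_mul]

theorem map_neg (N : RandomNorm P 𝕜 S) (x : S) : N (-x) = N x := by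
  have h := N.smul (-1) x
  rw [neg_smul, one_smul] at h
  rw [h]
  apply AEEqFun.ext
  filter_upwards [AEEqFun.coeFn_mul (L0.modulus (-1 : Ω →ₘ[P] 𝕜)) (N x),
    AEEqFun.coeFn_comp (fun z : 𝕜 => ‖z‖) continuous_norm (-1 : Ω →ₘ[P] 𝕜),
    AEEqFun.coeFn_neg (1 : Ω →ₘ[P] 𝕜),
    AEEqFun.coeFn_one (α := Ω) (β := 𝕜) (μ := P)] with ω h1 h2 h3 h4
  rw [h1]
  simp only [Pi.mul_apply, L0.modulus, h2, Function.comp_apply, h3, Pi.neg_apply, h4,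
    Pi.one_apply, norm_neg, norm_one, one_mul]

/-- The basic entourage `{(x, y) | P(‖x - y‖ < ε) > 1 - lam}` of the `(ε, lam)`-topology. -/
def entourage (N : RandomNorm P 𝕜 S) (ε lam : ℝ) : Set (S × S) :=
  {q | 1 - lam < P.real {ω | N (q.1 - q.2) ω < ε}}

theorem entourage_mono [IsProbabilityMeasure P] (N : RandomNorm P 𝕜 S) {ε ε' lam lam' : ℝ}
    (h : ε ≤ ε') (h' : lam ≤ lam') : N.entourage ε lam ⊆ N.entourage ε' lam' := by
  intro q hq
  have h1 : P.real {ω | N (q.1 - q.2) ω < ε} ≤ P.real {ω | N (q.1 - q.2) ω < ε'} :=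
    measureReal_mono (fun ω hω => lt_of_lt_of_le hω h)
  simp only [entourage, Set.mem_ofPred_eq] at hq ⊢
  linarith

/-- The sets `N.entourage ε lam`, for `ε > 0` and `0 < lam < 1`. -/
def entourageBasis [IsProbabilityMeasure P] (N : RandomNorm P 𝕜 S) : FilterBasis (S × S) where
  sets := {V | ∃ ε lam : ℝ, 0 < ε ∧ 0 < lam ∧ lam < 1 ∧ V = N.entourage ε lam}
  nonempty := ⟨_, 1, 1 / 2, by norm_num, by norm_num, by norm_num, rfl⟩
  inter_sets := by
    rintro _ _ ⟨ε, lam, hε, hl, hl1, rfl⟩ ⟨ε', lam', hε', hl', hl1', rfl⟩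
    exact ⟨_, ⟨min ε ε', min lam lam', lt_min hε hε', lt_min hl hl',
      lt_of_le_of_lt (min_le_left _ _) hl1, rfl⟩,
      Set.subset_inter (N.entourage_mono (min_le_left _ _) (min_le_left _ _))
        (N.entourage_mono (min_le_right _ _) (min_le_right _ _))⟩

/-- The uniform structure of the `(ε, lam)`-topology (uniform convergence in probability). -/
@[reducible]
def uniformSpace [IsProbabilityMeasure P] (N : RandomNorm P 𝕜 S) : UniformSpace S :=
  UniformSpace.ofCore (UniformSpace.Core.mkOfBasis N.entourageBasis
    (by
      rintro _ ⟨ε, lam, hε, hl, hl1, rfl⟩ x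
      have h : P.real {ω | N (x - x) ω < ε} = 1 := by
        rw [sub_self, N.map_zero, ← probReal_univ (μ := P)]
        apply measureReal_congr
        filter_upwards [AEEqFun.coeFn_zero (α := Ω) (β := ℝ) (μ := P)] with ω hω
        refine propext ⟨fun _ => trivial, fun _ => ?_⟩
        change (0 : Ω →ₘ[P] ℝ) ω < ε
        rw [hω]
        exact hε
      simp only [entourage, Set.mem_ofPred_eq, h]
      linarith)
    (by
      rintro _ ⟨ε, lam, hε, hl, hl1, rfl⟩
      refine ⟨_, ⟨ε, lam, hε, hl, hl1, rfl⟩, ?_⟩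
      intro q hq
      simp only [entourage, Set.mem_ofPred_eq, Set.mem_preimage, Prod.fst_swap,
        Prod.snd_swap] at hq ⊢
      rwa [← neg_sub q.1 q.2, N.map_neg])
    (by
      rintro _ ⟨ε, lam, hε, hl, hl1, rfl⟩
      refine ⟨_, ⟨ε / 2, lam / 2, by linarith, by linarith, by linarith, rfl⟩, ?_⟩
      rintro ⟨x, z⟩ ⟨y, h1, h2⟩
      simp only [entourage, Set.mem_ofPred_eq] at h1 h2 ⊢
      have hm : MeasurableSet {ω | N (y - z) ω < ε / 2} :=
        measurableSet_lt (N (y - z)).measurable measurable_const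
      have h3 := measureReal_union_add_inter (μ := P) (s := {ω | N (x - y) ω < ε / 2}) hm
      have h4 : P.real ({ω | N (x - y) ω < ε / 2} ∪ {ω | N (y - z) ω < ε / 2}) ≤ 1 :=
        measureReal_le_one
      have h5 : P.real ({ω | N (x - y) ω < ε / 2} ∩ {ω | N (y - z) ω < ε / 2}) ≤
          P.real {ω | N (x - z) ω < ε} := by
        refine ENNReal.toReal_mono (measure_ne_top _ _) (measure_mono_ae ?_)
        have h6 := N.add_le (x - y) (y - z)
        rw [sub_add_sub_cancel] at h6
        filter_upwards [AEEqFun.coeFn_le.2 h6, AEEqFun.coeFn_add (N (x - y)) (N (y - z))]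
          with ω h7 h8
        rintro ⟨h9, h10⟩
        change N (x - y) ω < ε / 2 at h9
        change N (y - z) ω < ε / 2 at h10
        change N (x - z) ω < ε
        rw [h8, Pi.add_apply] at h7
        linarith
      linarith))

/-- The `(ε, lam)`-topology. -/
@[reducible]
def topology [IsProbabilityMeasure P] (N : RandomNorm P 𝕜 S) : TopologicalSpace S :=
  N.uniformSpace.toTopologicalSpace

/-- Completeness for the `(ε, lam)`-topology. -/
def IsComplete [IsProbabilityMeasure P] (N : RandomNorm P 𝕜 S) : Prop :=
  @CompleteSpace S N.uniformSpace

/-- Density for the `(ε, lam)`-topology. -/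
def IsDense [IsProbabilityMeasure P] (N : RandomNorm P 𝕜 S) (s : Set S) : Prop :=
  @Dense S N.topology s

/-- A partially defined operator is closed if its graph is closed in the product of the
`(ε, lam)`-topologies. -/
def IsClosedOperator [IsProbabilityMeasure P] (N : RandomNorm P 𝕜 S)
    (A : S →ₗ.[Ω →ₘ[P] 𝕜] S) : Prop :=
  @IsClosed (S × S) (@instTopologicalSpaceProd S S N.topology N.topology) (A.graph : Set (S × S))

/-- `f` converges to `x` along `l` in the `(ε, lam)`-topology. -/
def TendsTo [IsProbabilityMeasure P] (N : RandomNorm P 𝕜 S) {ι : Type*} (f : ι → S)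
    (l : Filter ι) (x : S) : Prop :=
  Tendsto f l (@nhds S N.topology x)

/-! ### Almost surely bounded module homomorphisms and their `L⁰`-norm -/

/-- The set of `η ≥ 0` with `‖T z‖ ≤ η ‖z‖` for all `z`. -/
def bounds (N : RandomNorm P 𝕜 S) (T : S →ₗ[Ω →ₘ[P] 𝕜] S) : Set (Ω →ₘ[P] ℝ) :=
  {η | 0 ≤ η ∧ ∀ z, N (T z) ≤ η * N z}

/-- `T` is almost surely bounded, that is, belongs to `B(S)`. -/
def IsBoundedHom (N : RandomNorm P 𝕜 S) (T : S →ₗ[Ω →ₘ[P] 𝕜] S) : Prop :=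
  (N.bounds T).Nonempty

/-- `T` belongs to `B(S)`, and its `L⁰`-norm `ν = ⋀ {η ≥ 0 | ‖T z‖ ≤ η ‖z‖ for all z}` is at
most `ζ`. -/
def OpNormLE (N : RandomNorm P 𝕜 S) (T : S →ₗ[Ω →ₘ[P] 𝕜] S) (ζ : Ω →ₘ[P] ℝ) : Prop :=
  N.IsBoundedHom T ∧ ∃ ν, IsGLB (N.bounds T) ν ∧ ν ≤ ζ

/-! ### `C`-semigroups and their generators -/

/-- `W` is a `C`-semigroup on `S`. -/
structure IsCSemigroup [IsProbabilityMeasure P] (N : RandomNorm P 𝕜 S)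
    (C : S →ₗ[Ω →ₘ[P] 𝕜] S) (W : ℝ≥0 → (S →ₗ[Ω →ₘ[P] 𝕜] S)) : Prop where
  bounded : ∀ s, N.IsBoundedHom (W s)
  map_add : ∀ s t, C ∘ₗ W (s + t) = W t ∘ₗ W s
  map_zero : W 0 = C
  continuous : ∀ x, @Continuous ℝ≥0 S _ N.topology (fun s => W s x)

/-- `W` belongs to `H(M, ξ)`: it is a `C`-semigroup with `‖W s‖ ≤ M e ^ (ξ s)` for all `s ≥ 0`. -/
def MemH [IsProbabilityMeasure P] (N : RandomNorm P 𝕜 S) (C : S →ₗ[Ω →ₘ[P] 𝕜] S)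
    (M ξ : Ω →ₘ[P] ℝ) (W : ℝ≥0 → (S →ₗ[Ω →ₘ[P] 𝕜] S)) : Prop :=
  N.IsCSemigroup C W ∧
    ∀ s : ℝ≥0, N.OpNormLE (W s) (M * L0.exp (ξ * AEEqFun.const Ω (s : ℝ)))

/-- The difference quotient `(W s x - C x) / s`. -/
noncomputable def diffQuot (C : S →ₗ[Ω →ₘ[P] 𝕜] S) (W : ℝ≥0 → (S →ₗ[Ω →ₘ[P] 𝕜] S)) (x : S)
    (s : ℝ≥0) : S :=
  (AEEqFun.const Ω (((s : ℝ) : 𝕜)⁻¹) : Ω →ₘ[P] 𝕜) • (W s x - C x)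

/-- `A` is the infinitesimal generator of `W` (with `C` injective): `D(A)` consists of the `x` for
which `lim (W s x - C x) / s`, as `s ↓ 0`, exists and lies in the range of `C`, and `A x` is the
preimage of this limit under `C`. -/
structure IsGenerator [IsProbabilityMeasure P] (N : RandomNorm P 𝕜 S)
    (C : S →ₗ[Ω →ₘ[P] 𝕜] S) (W : ℝ≥0 → (S →ₗ[Ω →ₘ[P] 𝕜] S))
    (A : S →ₗ.[Ω →ₘ[P] 𝕜] S) : Prop where
  mem_domain : ∀ x, x ∈ A.domain ↔ ∃ y, N.TendsTo (diffQuot C W x) (𝓝[>] 0) (C y)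
  apply : ∀ x : A.domain, N.TendsTo (diffQuot C W (x : S)) (𝓝[>] 0) (C (A x))

end RandomNorm

/-! ### Partially defined module homomorphisms -/

namespace PartialOp

variable {R S : Type*} [CommRing R] [AddCommGroup S] [Module R S]

/-- `η - A`, with domain `D(A)`. -/
def shift (η : R) (A : S →ₗ.[R] S) : S →ₗ.[R] S :=
  ⟨A.domain, η • A.domain.subtype - A.toFun⟩

/-- The composition `g ∘ f` with its natural domain `{x ∈ D(f) | f x ∈ D(g)}`. -/
def pcomp (g f : S →ₗ.[R] S) : S →ₗ.[R] S :=
  g.comp (f.domRestrict ((g.domain.comap f.toFun).map f.domain.subtype)) (by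
    rintro ⟨x, hx, hx'⟩
    obtain ⟨y, hy, rfl⟩ := hx
    exact hy)

/-- The powers `B⁻ⁿ` (for `B` injective), with their natural domains: `B⁻⁰` is the identity of `S`
and `B⁻⁽ⁿ⁺¹⁾ = B⁻¹ ∘ B⁻ⁿ`. -/
noncomputable def invPow (B : S →ₗ.[R] S) : ℕ → (S →ₗ.[R] S)
  | 0 => LinearMap.id.toPMap ⊤
  | n + 1 => pcomp B.inverse (invPow B n)

/-- The everywhere defined operator `T C`, when the range of `C` lies in the domain of `T`. -/
def compOfRangeLE (T : S →ₗ.[R] S) (C : S →ₗ[R] S) (h : LinearMap.range C ≤ T.domain) :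
    S →ₗ[R] S :=
  T.toFun ∘ₗ C.codRestrict T.domain (fun x => h (LinearMap.mem_range_self C x))

/-- The `C`-resolvent set `ρ_C(A)`. -/
def cResolventSet (C : S →ₗ[R] S) (A : S →ₗ.[R] S) : Set R :=
  {η | Function.Injective (shift η A) ∧
    LinearMap.range C ≤ LinearMap.range (shift η A).toFun}

/-- The graph of `C⁻¹ A C` (for `C` injective): the pairs `(x, y)` with `C x ∈ D(A)` and
`A (C x) = C y`. -/
def conjGraph (C : S →ₗ[R] S) (A : S →ₗ.[R] S) : Submodule R (S × S) :=
  A.graph.comap (C.prodMap C)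

end PartialOp

/-! ### Ordered-ring structure and scalars of `L⁰` -/

namespace L0

variable {Ω : Type*} [MeasurableSpace Ω] {P : Measure Ω} {𝕜 : Type*} [RCLike 𝕜]

/-! The generator is handled as its graph, and multiplying `W s` by `e ^ (θ s)` adds `θ` to it
(`Generates.rescale`). Each implication thus reduces to a convenient exponential type: type `0` for
building the semigroup, negative type for the resolvents. The topology is metrised by `E[min(‖x -
y‖, 1)]`, while the estimates remain almost sure inequalities with random constants. Limits can be
taken in them because multiplication by a fixed random variable is continuous in probability
(`tendsto_probNorm_mul`).

From (b) to (a), put `a = A - ξ` and `h = 2⁻ᵏ`. Condition 4 at `η = ξ + 2ᵏ` bounds the Euler powers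
`(1 - h a)⁻ⁿ C` by `M`, uniformly in `k` and `n ≥ 1`. One step of width `h` is compared with two of
width `h / 2` through `(1 - (h/2) a)² = (1 - h a) + (h/2)² a²`. Over a bounded time the errors add
up to `O(h)` on `D(a²)` (`IsEulerScheme.halving`), so the scheme is Cauchy on the dense set `C
D(a²)`, and by the uniform bound on all of `S`. The limit is a `C`-semigroup whose generator
contains `a`. Conversely, if its generator sends `x` to `y`, let `u = (1 - a)⁻¹ C (x - y)`. The
generator fixes `C x - u`, while the semigroup damped by `e ^ (-s)` has an injective generator
(`IsCSemigroup.eq_zero_of_generates_zero`). Hence `C x = u` lies in `D(a)`, and condition 5 cancels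
`C`.

From (a) to (b), `V s = e ^ (-η s) W s` decays at the rate `δ = η - ξ`, its generator is `A - η`,
and `(η - A)⁻¹ C z` is the integral of `V s z` over `[0, ∞)`. To integrate in `S`, the path is
multiplied by a strictly positive random variable that moves it into the Banach space `l1` of
elements with integrable norm, where Bochner's integral is available. Almost sure bounds for the
integral are recovered by testing on measurable subsets of `Ω` (`ofReal_integral_le`). The tail
integrals `F t` of a decaying orbit again form a decaying orbit, with bound divided by `δ`
(`IsDecayingOrbit.exists_integral`), and iteration gives `M δ⁻ⁿ`. The right derivative of `F` at `0`
yields the density of the domain. It also allows `C` to be cancelled from the generator relation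
(`generates_of_generates_map`), on which closedness and condition 5 rest. -/

theorem le_iff {X Y : Ω →ₘ[P] ℝ} : X ≤ Y ↔ ∀ᵐ ω ∂P, X ω ≤ Y ω := AEEqFun.coeFn_le.symm

theorem nonneg_iff {X : Ω →ₘ[P] ℝ} : 0 ≤ X ↔ ∀ᵐ ω ∂P, 0 ≤ X ω := by
  rw [le_iff]
  constructor <;> intro h <;>
    filter_upwards [h, AEEqFun.coeFn_zero (α := Ω) (β := ℝ) (μ := P)] with ω h1 h2
  · rwa [h2] at h1
  · rwa [h2]

instance isOrderedRing : IsOrderedRing (Ω →ₘ[P] ℝ) where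
  add_le_add_left a b h c := by
    rw [le_iff] at *
    filter_upwards [h, AEEqFun.coeFn_add a c, AEEqFun.coeFn_add b c] with ω h1 h2 h3
    rw [h2, h3]
    simpa using h1
  zero_le_one := by
    rw [nonneg_iff]
    filter_upwards [AEEqFun.coeFn_one (α := Ω) (β := ℝ) (μ := P)] with ω h
    rw [h]
    simp
  mul_le_mul_of_nonneg_left := by
    intro a ha b c hbc
    rw [nonneg_iff] at ha
    rw [le_iff] at *
    filter_upwards [ha, hbc, AEEqFun.coeFn_mul a b, AEEqFun.coeFn_mul a c] with ω h1 h2 h3 h4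
    rw [h3, h4]
    exact mul_le_mul_of_nonneg_left h2 h1
  mul_le_mul_of_nonneg_right := by
    intro a ha b c hbc
    rw [nonneg_iff] at ha
    rw [le_iff] at *
    filter_upwards [ha, hbc, AEEqFun.coeFn_mul b a, AEEqFun.coeFn_mul c a] with ω h1 h2 h3 h4
    rw [h3, h4]
    exact mul_le_mul_of_nonneg_right h2 h1

theorem coeFn_modulus (ζ : Ω →ₘ[P] 𝕜) : ∀ᵐ ω ∂P, modulus ζ ω = ‖ζ ω‖ :=
  AEEqFun.coeFn_comp _ continuous_norm ζ

theorem coeFn_toScalar (η : Ω →ₘ[P] ℝ) : ∀ᵐ ω ∂P, toScalar 𝕜 η ω = (η ω : 𝕜) :=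
  AEEqFun.coeFn_comp _ RCLike.continuous_ofReal η

theorem coeFn_exp (η : Ω →ₘ[P] ℝ) : ∀ᵐ ω ∂P, exp η ω = Real.exp (η ω) :=
  AEEqFun.coeFn_comp _ Real.continuous_exp η

theorem coeFn_inv (η : Ω →ₘ[P] ℝ) : ∀ᵐ ω ∂P, inv η ω = (η ω)⁻¹ :=
  AEEqFun.coeFn_compMeasurable _ measurable_inv η

theorem ext_iff' {β : Type*} [TopologicalSpace β] {X Y : Ω →ₘ[P] β} :
    X = Y ↔ ∀ᵐ ω ∂P, X ω = Y ω := AEEqFun.ext_iff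

theorem coeFn_add' {R : Type*} [TopologicalSpace R] [CommRing R] [IsTopologicalRing R]
    (X Y : Ω →ₘ[P] R) : ∀ᵐ ω ∂P, (X + Y) ω = X ω + Y ω := AEEqFun.coeFn_add X Y

theorem coeFn_sub' {R : Type*} [TopologicalSpace R] [CommRing R] [IsTopologicalRing R]
    (X Y : Ω →ₘ[P] R) : ∀ᵐ ω ∂P, (X - Y) ω = X ω - Y ω := AEEqFun.coeFn_sub X Y

theorem coeFn_neg' {R : Type*} [TopologicalSpace R] [CommRing R] [IsTopologicalRing R]
    (X : Ω →ₘ[P] R) : ∀ᵐ ω ∂P, (-X) ω = -X ω := AEEqFun.coeFn_neg X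

theorem coeFn_mul' {R : Type*} [TopologicalSpace R] [CommRing R] [IsTopologicalRing R]
    (X Y : Ω →ₘ[P] R) : ∀ᵐ ω ∂P, (X * Y) ω = X ω * Y ω := AEEqFun.coeFn_mul X Y

theorem coeFn_zero' {R : Type*} [TopologicalSpace R] [CommRing R] [IsTopologicalRing R] :
    ∀ᵐ ω ∂P, (0 : Ω →ₘ[P] R) ω = 0 := AEEqFun.coeFn_zero

theorem coeFn_one' {R : Type*} [TopologicalSpace R] [CommRing R] [IsTopologicalRing R] :
    ∀ᵐ ω ∂P, (1 : Ω →ₘ[P] R) ω = 1 := AEEqFun.coeFn_one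

theorem coeFn_const' {R : Type*} [TopologicalSpace R] (c : R) :
    ∀ᵐ ω ∂P, (AEEqFun.const Ω c : Ω →ₘ[P] R) ω = c := AEEqFun.coeFn_const Ω c

variable (P 𝕜) in
/-- The embedding of the real random variables into the scalars as a ring homomorphism. -/
noncomputable def toScalarHom : (Ω →ₘ[P] ℝ) →+* (Ω →ₘ[P] 𝕜) where
  toFun := toScalar 𝕜
  map_one' := by
    rw [ext_iff']
    filter_upwards [coeFn_toScalar (𝕜 := 𝕜) (1 : Ω →ₘ[P] ℝ), coeFn_one' (P := P) (R := ℝ),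
      coeFn_one' (P := P) (R := 𝕜)] with ω h1 h2 h3
    rw [h1, h2, h3, RCLike.ofReal_one]
  map_zero' := by
    rw [ext_iff']
    filter_upwards [coeFn_toScalar (𝕜 := 𝕜) (0 : Ω →ₘ[P] ℝ), coeFn_zero' (P := P) (R := ℝ),
      coeFn_zero' (P := P) (R := 𝕜)] with ω h1 h2 h3
    rw [h1, h2, h3, RCLike.ofReal_zero]
  map_add' X Y := by
    rw [ext_iff']
    filter_upwards [coeFn_toScalar (𝕜 := 𝕜) (X + Y), coeFn_toScalar (𝕜 := 𝕜) X,
      coeFn_toScalar (𝕜 := 𝕜) Y, coeFn_add' X Y, coeFn_add' (toScalar 𝕜 X) (toScalar 𝕜 Y)]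
      with ω h1 h2 h3 h4 h5
    rw [h1, h5, h2, h3, h4, RCLike.ofReal_add]
  map_mul' X Y := by
    rw [ext_iff']
    filter_upwards [coeFn_toScalar (𝕜 := 𝕜) (X * Y), coeFn_toScalar (𝕜 := 𝕜) X,
      coeFn_toScalar (𝕜 := 𝕜) Y, coeFn_mul' X Y, coeFn_mul' (toScalar 𝕜 X) (toScalar 𝕜 Y)]
      with ω h1 h2 h3 h4 h5
    rw [h1, h5, h2, h3, h4, RCLike.ofReal_mul]

theorem toScalar_add (X Y : Ω →ₘ[P] ℝ) : toScalar 𝕜 (X + Y) = toScalar 𝕜 X + toScalar 𝕜 Y :=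
  (toScalarHom P 𝕜).map_add X Y

theorem toScalar_sub (X Y : Ω →ₘ[P] ℝ) : toScalar 𝕜 (X - Y) = toScalar 𝕜 X - toScalar 𝕜 Y :=
  (toScalarHom P 𝕜).map_sub X Y

theorem toScalar_neg (X : Ω →ₘ[P] ℝ) : toScalar 𝕜 (-X) = -toScalar 𝕜 X :=
  (toScalarHom P 𝕜).map_neg X

theorem toScalar_mul (X Y : Ω →ₘ[P] ℝ) : toScalar 𝕜 (X * Y) = toScalar 𝕜 X * toScalar 𝕜 Y :=
  (toScalarHom P 𝕜).map_mul X Y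

theorem toScalar_one : toScalar 𝕜 (1 : Ω →ₘ[P] ℝ) = 1 := (toScalarHom P 𝕜).map_one

theorem toScalar_zero : toScalar 𝕜 (0 : Ω →ₘ[P] ℝ) = 0 := (toScalarHom P 𝕜).map_zero

theorem toScalar_const (c : ℝ) :
    toScalar 𝕜 (AEEqFun.const Ω c : Ω →ₘ[P] ℝ) = AEEqFun.const Ω (c : 𝕜) := by
  rw [ext_iff']
  filter_upwards [coeFn_toScalar (𝕜 := 𝕜) (AEEqFun.const Ω c : Ω →ₘ[P] ℝ),
    coeFn_const' (P := P) c, coeFn_const' (P := P) (c : 𝕜)] with ω h1 h2 h3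
  rw [h1, h2, h3]

theorem const_nonneg {c : ℝ} (hc : 0 ≤ c) : (0 : Ω →ₘ[P] ℝ) ≤ AEEqFun.const Ω c := by
  rw [nonneg_iff]
  filter_upwards [coeFn_const' (P := P) c] with ω h
  rwa [h]

theorem const_mono {c d : ℝ} (h : c ≤ d) :
    (AEEqFun.const Ω c : Ω →ₘ[P] ℝ) ≤ AEEqFun.const Ω d := by
  rw [le_iff]
  filter_upwards [coeFn_const' (P := P) c, coeFn_const' (P := P) d] with ω h1 h2
  rwa [h1, h2]

theorem modulus_toScalar (X : Ω →ₘ[P] ℝ) : modulus (toScalar 𝕜 X) = |X| := by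
  rw [ext_iff']
  filter_upwards [coeFn_modulus (toScalar 𝕜 X), coeFn_toScalar (𝕜 := 𝕜) X,
    AEEqFun.coeFn_abs X] with ω h1 h2 h3
  rw [h1, h2, h3, RCLike.norm_ofReal]

theorem exp_nonneg (X : Ω →ₘ[P] ℝ) : 0 ≤ exp X := by
  rw [nonneg_iff]
  filter_upwards [coeFn_exp X] with ω h
  rw [h]
  exact (Real.exp_pos _).le

theorem exp_add (X Y : Ω →ₘ[P] ℝ) : exp (X + Y) = exp X * exp Y := by
  rw [ext_iff']
  filter_upwards [coeFn_exp (X + Y), coeFn_exp X, coeFn_exp Y, coeFn_add' X Y,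
    coeFn_mul' (exp X) (exp Y)] with ω h1 h2 h3 h4 h5
  rw [h1, h5, h2, h3, h4, Real.exp_add]

theorem exp_zero : exp (0 : Ω →ₘ[P] ℝ) = 1 := by
  rw [ext_iff']
  filter_upwards [coeFn_exp (0 : Ω →ₘ[P] ℝ), coeFn_zero' (P := P) (R := ℝ),
    coeFn_one' (P := P) (R := ℝ)] with ω h1 h2 h3
  rw [h1, h2, h3, Real.exp_zero]

theorem inv_mul_cancel {X : Ω →ₘ[P] ℝ} (h : ∀ᵐ ω ∂P, 0 < X ω) : inv X * X = 1 := by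
  rw [ext_iff']
  filter_upwards [h, coeFn_inv X, coeFn_mul' (inv X) X, coeFn_one' (P := P) (R := ℝ)]
    with ω h1 h2 h3 h4
  rw [h3, h2, h4, inv_mul_cancel₀ h1.ne']

theorem inv_nonneg {X : Ω →ₘ[P] ℝ} (h : ∀ᵐ ω ∂P, 0 < X ω) : 0 ≤ inv X := by
  rw [nonneg_iff]
  filter_upwards [h, coeFn_inv X] with ω h1 h2
  rw [h2]
  exact (inv_pos.2 h1).le

theorem strictLT_iff_sub {X Y : Ω →ₘ[P] ℝ} : StrictLT X Y ↔ ∀ᵐ ω ∂P, 0 < (Y - X) ω := by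
  constructor <;> intro h <;> filter_upwards [h, coeFn_sub' Y X] with ω h1 h2
  · rw [h2]; linarith
  · rw [h2] at h1; linarith

theorem pos_of_nonneg_add_one {X : Ω →ₘ[P] ℝ} (h : 0 ≤ X) : ∀ᵐ ω ∂P, 0 < (1 + X) ω := by
  filter_upwards [nonneg_iff.1 h, coeFn_add' 1 X, coeFn_one' (P := P) (R := ℝ)] with ω h1 h2 h3
  rw [h2, h3]
  linarith

/-! ### The metric of convergence in probability -/

/-- `E[min(|X|, 1)]`. -/
noncomputable def probNorm (X : Ω →ₘ[P] ℝ) : ℝ := ∫ ω, min |X ω| 1 ∂P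

theorem aestronglyMeasurable_min_abs (X : Ω →ₘ[P] ℝ) :
    AEStronglyMeasurable (fun ω => min |X ω| 1) P :=
  (X.aestronglyMeasurable.norm).inf aestronglyMeasurable_const

theorem probNorm_nonneg (X : Ω →ₘ[P] ℝ) : 0 ≤ probNorm X :=
  integral_nonneg fun _ => le_min (abs_nonneg _) zero_le_one

theorem probNorm_zero : probNorm (0 : Ω →ₘ[P] ℝ) = 0 := by
  have : probNorm (0 : Ω →ₘ[P] ℝ) = ∫ _, (0 : ℝ) ∂P := by
    apply integral_congr_ae
    filter_upwards [coeFn_zero' (P := P) (R := ℝ)] with ω h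
    simp [h]
  rw [this, integral_zero]

variable [IsProbabilityMeasure P]

theorem integrable_min_abs (X : Ω →ₘ[P] ℝ) : Integrable (fun ω => min |X ω| 1) P := by
  refine Integrable.of_bound (aestronglyMeasurable_min_abs X) 1 (ae_of_all _ fun ω => ?_)
  rw [Real.norm_eq_abs, abs_of_nonneg (le_min (abs_nonneg _) zero_le_one)]
  exact min_le_right _ _

theorem probNorm_mono {X Y : Ω →ₘ[P] ℝ} (h0 : 0 ≤ X) (h : X ≤ Y) : probNorm X ≤ probNorm Y := by
  apply integral_mono_ae (integrable_min_abs X) (integrable_min_abs Y)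
  filter_upwards [nonneg_iff.1 h0, le_iff.1 h] with ω h1 h2
  exact min_le_min_right _ (abs_le_abs_of_nonneg h1 h2)

theorem probNorm_add_le (X Y : Ω →ₘ[P] ℝ) : probNorm (X + Y) ≤ probNorm X + probNorm Y := by
  rw [probNorm, probNorm, probNorm, ← integral_add (integrable_min_abs X) (integrable_min_abs Y)]
  apply integral_mono_ae (integrable_min_abs _)
    ((integrable_min_abs X).add (integrable_min_abs Y))
  filter_upwards [coeFn_add' X Y] with ω h
  rw [h]
  have h1 := abs_add_le (X ω) (Y ω)
  have h2 := abs_nonneg (X ω)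
  have h3 := abs_nonneg (Y ω)
  change min |X ω + Y ω| 1 ≤ min |X ω| 1 + min |Y ω| 1
  rcases le_total |X ω| 1 with h4 | h4
  · rcases le_total |Y ω| 1 with h5 | h5
    · rw [min_eq_left h4, min_eq_left h5]
      exact (min_le_left _ _).trans h1
    · rw [min_eq_left h4, min_eq_right h5]
      exact (min_le_right _ _).trans (by linarith)
  · rw [min_eq_right h4]
    exact (min_le_right _ _).trans
      (by linarith [le_min h3 (zero_le_one (α := ℝ))])

theorem probNorm_eq_zero {X : Ω →ₘ[P] ℝ} (h : probNorm X = 0) : X = 0 := by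
  have h1 := (integral_eq_zero_iff_of_nonneg
    (fun ω => le_min (abs_nonneg (X ω)) zero_le_one) (integrable_min_abs X)).1 h
  rw [ext_iff']
  filter_upwards [h1, coeFn_zero' (P := P) (R := ℝ)] with ω h2 h3
  rw [h3]
  simp only [Pi.zero_apply] at h2
  rcases min_choice |X ω| 1 with h4 | h4 <;> rw [h4] at h2
  · exact abs_eq_zero.1 h2
  · norm_num at h2

/-- Where `|Z| ≤ K`, the truncation costs only the factor `K` because `K ≥ 1`; elsewhere the
integrand is at most `1`. This replaces the homogeneity that `probNorm` does not have. -/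
theorem probNorm_mul_le (Z X : Ω →ₘ[P] ℝ) {K : ℝ} (hK : 1 ≤ K) :
    probNorm (Z * X) ≤ K * probNorm X + P.real {ω | K < |Z ω|} := by
  have hm : MeasurableSet {ω | K < |Z ω|} :=
    measurableSet_lt measurable_const Z.measurable.abs
  have e : K * probNorm X + P.real {ω | K < |Z ω|} =
      ∫ ω, (K * min |X ω| 1 + Set.indicator {ω | K < |Z ω|} (fun _ => (1 : ℝ)) ω) ∂P := by
    rw [integral_add ((integrable_min_abs X).const_mul K)
      ((integrable_const _).indicator hm), integral_const_mul, integral_indicator_const _ hm]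
    simp [probNorm]
  rw [e]
  apply integral_mono_ae (integrable_min_abs _)
    (((integrable_min_abs X).const_mul K).add ((integrable_const _).indicator hm))
  filter_upwards [coeFn_mul' Z X] with ω h
  rw [h]
  change min |Z ω * X ω| 1 ≤
    K * min |X ω| 1 + Set.indicator {ω | K < |Z ω|} (fun _ => (1 : ℝ)) ω
  have h0 : 0 ≤ min |X ω| 1 := le_min (abs_nonneg _) zero_le_one
  by_cases hω : K < |Z ω|
  · have : ω ∈ {ω | K < |Z ω|} := hω
    rw [Set.indicator_of_mem this]
    have := mul_nonneg (zero_le_one.trans hK) h0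
    linarith [min_le_right |Z ω * X ω| 1]
  · have : ω ∉ {ω | K < |Z ω|} := hω
    rw [Set.indicator_of_notMem this, add_zero]
    rw [not_lt] at hω
    rcases le_total |X ω| 1 with h4 | h4
    · rw [min_eq_left h4, abs_mul]
      exact (min_le_left _ _).trans (mul_le_mul_of_nonneg_right hω (abs_nonneg _))
    · rw [min_eq_right h4, mul_one]
      exact (min_le_right _ _).trans hK

/-- Together with Markov's inequality in `mul_measureReal_le_probNorm`, this compares `probNorm`
with the probabilities that define the entourages. -/
theorem probNorm_le_add (X : Ω →ₘ[P] ℝ) {ε : ℝ} (hε : 0 ≤ ε) :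
    probNorm X ≤ ε + P.real {ω | ε ≤ |X ω|} := by
  have hm : MeasurableSet {ω | ε ≤ |X ω|} :=
    measurableSet_le measurable_const X.measurable.abs
  have e : ε + P.real {ω | ε ≤ |X ω|} =
      ∫ ω, (ε + Set.indicator {ω | ε ≤ |X ω|} (fun _ => (1 : ℝ)) ω) ∂P := by
    rw [integral_add (integrable_const _) ((integrable_const _).indicator hm),
      integral_indicator_const _ hm]
    simp
  rw [e]
  apply integral_mono_ae (integrable_min_abs _)
    ((integrable_const _).add ((integrable_const _).indicator hm))
  refine ae_of_all _ fun ω => ?_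
  change min |X ω| 1 ≤ ε + Set.indicator {ω | ε ≤ |X ω|} (fun _ => (1 : ℝ)) ω
  by_cases hω : ε ≤ |X ω|
  · have : ω ∈ {ω | ε ≤ |X ω|} := hω
    rw [Set.indicator_of_mem this]
    linarith [min_le_right |X ω| 1]
  · have : ω ∉ {ω | ε ≤ |X ω|} := hω
    rw [Set.indicator_of_notMem this, add_zero]
    exact (min_le_left _ _).trans (not_le.1 hω).le

theorem mul_measureReal_le_probNorm (X : Ω →ₘ[P] ℝ) {ε : ℝ} (hε1 : ε ≤ 1) :
    ε * P.real {ω | ε ≤ |X ω|} ≤ probNorm X := by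
  have h := mul_meas_ge_le_integral_of_nonneg
    (ae_of_all P fun ω => le_min (abs_nonneg (X ω)) zero_le_one) (integrable_min_abs X) ε
  simpa only [le_min_iff, hε1, and_true, probNorm] using h

/-- Dominated convergence with majorant `1`. The representatives `F i` are chosen by hand, so that
the almost sure limit can be taken along an uncountable index set such as `ℝ≥0`. -/
theorem tendsto_probNorm_of_ae_eq {ι : Type*} {l : Filter ι}
    [l.IsCountablyGenerated] {X : ι → Ω →ₘ[P] ℝ} {F : ι → Ω → ℝ}
    (hF : ∀ i, ∀ᵐ ω ∂P, X i ω = F i ω)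
    (h : ∀ᵐ ω ∂P, Tendsto (fun i => F i ω) l (𝓝 0)) :
    Tendsto (fun i => probNorm (X i)) l (𝓝 0) := by
  have hm : ∀ i, AEStronglyMeasurable (F i) P := fun i =>
    (X i).aestronglyMeasurable.congr (hF i)
  have e : ∀ i, X i = AEEqFun.mk (F i) (hm i) := fun i => by
    rw [ext_iff']
    filter_upwards [hF i, AEEqFun.coeFn_mk (F i) (hm i)] with ω h1 h2
    rw [h1, h2]
  have e' : ∀ i, probNorm (X i) = ∫ ω, min |F i ω| 1 ∂P := fun i => by
    apply integral_congr_ae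
    filter_upwards [hF i] with ω h1
    rw [h1]
  simp only [e']
  have h1 := tendsto_integral_filter_of_dominated_convergence (μ := P) (l := l)
    (F := fun i ω => min |F i ω| 1) (f := fun _ => 0) (fun _ => (1 : ℝ))
    (Eventually.of_forall fun i => ((hm i).norm).inf aestronglyMeasurable_const)
    (Eventually.of_forall fun i => ae_of_all _ fun ω => by
      rw [Real.norm_eq_abs, abs_of_nonneg (le_min (abs_nonneg _) zero_le_one)]
      exact min_le_right _ _)
    (integrable_const _) (by
      filter_upwards [h] with ω hω
      have : Tendsto (fun i => min |F i ω| 1) l (𝓝 (min |0| 1)) :=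
        (hω.abs).min tendsto_const_nhds
      simpa using this)
  simpa only [integral_zero] using h1

theorem tendsto_measureReal_lt_abs (Z : Ω →ₘ[P] ℝ) :
    Tendsto (fun n : ℕ => P.real {ω | (n : ℝ) < |Z ω|}) atTop (𝓝 0) := by
  have h : Tendsto (fun n : ℕ => P {ω | (n : ℝ) < |Z ω|}) atTop
      (𝓝 (P (⋂ n : ℕ, {ω | (n : ℝ) < |Z ω|}))) := by
    apply tendsto_measure_iInter_atTop
    · intro n
      exact (measurableSet_lt measurable_const Z.measurable.abs).nullMeasurableSet
    · intro m n hmn ω hω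
      exact lt_of_le_of_lt (Nat.cast_le.2 hmn) (show (n : ℝ) < |Z ω| from hω)
    · exact ⟨0, measure_ne_top _ _⟩
  have h0 : (⋂ n : ℕ, {ω | (n : ℝ) < |Z ω|}) = ∅ := by
    ext ω
    simp only [Set.mem_iInter, Set.mem_empty_iff_false, iff_false, not_forall]
    obtain ⟨n, hn⟩ := exists_nat_ge |Z ω|
    exact ⟨n, not_lt.2 hn⟩
  rw [h0, measure_empty] at h
  have := (ENNReal.tendsto_toReal ENNReal.zero_ne_top).comp h
  exact this

/-- The level `n` is chosen first, so that `|Z| > n` is improbable; only then is `X i` made small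
relative to `n`. No integrability of `Z` is needed. -/
theorem tendsto_probNorm_mul {ι : Type*} {l : Filter ι} (Z : Ω →ₘ[P] ℝ) {X : ι → Ω →ₘ[P] ℝ}
    (h : Tendsto (fun i => probNorm (X i)) l (𝓝 0)) :
    Tendsto (fun i => probNorm (Z * X i)) l (𝓝 0) := by
  rw [Metric.tendsto_nhds] at h ⊢
  intro ε hε
  obtain ⟨n, hn, hn1⟩ := (((tendsto_measureReal_lt_abs Z).eventually
    (gt_mem_nhds (half_pos hε))).and (eventually_ge_atTop 1)).exists
  have hn1' : (1 : ℝ) ≤ n := by exact_mod_cast hn1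
  have hn0 : (0 : ℝ) < n := by linarith
  filter_upwards [h (ε / 2 / n) (by positivity)] with i hi
  rw [Real.dist_eq, sub_zero, abs_of_nonneg (probNorm_nonneg _)] at hi ⊢
  have h1 := probNorm_mul_le Z (X i) hn1'
  have h2 : n * probNorm (X i) < ε / 2 := by
    rw [lt_div_iff₀ hn0] at hi
    linarith
  linarith

theorem tendsto_probNorm_const_mul {ι : Type*} {l : Filter ι} {c : ι → ℝ} (X : Ω →ₘ[P] ℝ)
    (h : Tendsto c l (𝓝 0)) :
    Tendsto (fun i => probNorm (AEEqFun.const Ω (c i) * X)) l (𝓝 0) := by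
  have h1 : Tendsto (fun i => probNorm (AEEqFun.const Ω (c i) : Ω →ₘ[P] ℝ)) l (𝓝 0) := by
    refine squeeze_zero (fun i => probNorm_nonneg _) (g := fun i => |c i|) (fun i => ?_)
      (by simpa using h.abs)
    have : probNorm (AEEqFun.const Ω (c i) : Ω →ₘ[P] ℝ) = ∫ _ : Ω, min |c i| 1 ∂P := by
      apply integral_congr_ae
      filter_upwards [coeFn_const' (P := P) (c i)] with ω hω
      rw [hω]
    rw [this]
    simp
  simpa only [mul_comm X] using tendsto_probNorm_mul X h1

/-- An inequality that holds up to errors converging to `0` in probability is exact. -/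
theorem le_of_le_add_tendsto {ι : Type*} {l : Filter ι} [l.NeBot] {X Y : Ω →ₘ[P] ℝ}
    {E : ι → Ω →ₘ[P] ℝ} (hE : Tendsto (fun i => probNorm (E i)) l (𝓝 0))
    (h : ∀ᶠ i in l, X ≤ Y + E i) : X ≤ Y := by
  -- The excess `(X - Y)⁺` does not depend on `i` and is dominated by every `|E i|`.
  have h1 : ∀ᶠ i in l, probNorm ((X - Y) ⊔ 0) ≤ probNorm (E i) := by
    filter_upwards [h] with i hi
    apply integral_mono_ae (integrable_min_abs _) (integrable_min_abs _)
    filter_upwards [le_iff.1 hi, coeFn_add' Y (E i), AEEqFun.coeFn_sup (X - Y) 0,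
      coeFn_sub' X Y, coeFn_zero' (P := P) (R := ℝ)] with ω h1 h2 h3 h4 h5
    rw [h2] at h1
    simp only [h3, h4, h5]
    apply min_le_min_right
    rw [abs_of_nonneg (le_max_right _ _)]
    exact max_le (by linarith [le_abs_self (E i ω)]) (abs_nonneg _)
  have h2 : probNorm ((X - Y) ⊔ 0) ≤ 0 := ge_of_tendsto hE h1
  have h3 := probNorm_eq_zero (le_antisymm h2 (probNorm_nonneg _))
  have h4 : X - Y ≤ 0 := h3 ▸ le_sup_left
  exact sub_nonpos.1 h4

end L0

namespace L0

variable {Ω : Type*} [MeasurableSpace Ω] {P : Measure Ω}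

theorem probNorm_abs_mul (X Y : Ω →ₘ[P] ℝ) : probNorm (|X| * Y) = probNorm (X * Y) := by
  apply integral_congr_ae
  filter_upwards [coeFn_mul' |X| Y, coeFn_mul' X Y, AEEqFun.coeFn_abs X] with ω h1 h2 h3
  rw [h1, h2, h3, abs_mul, abs_mul, abs_abs]

theorem probNorm_abs (X : Ω →ₘ[P] ℝ) : probNorm |X| = probNorm X := by
  have := probNorm_abs_mul X 1
  rwa [mul_one, mul_one] at this

/-- Holds pointwise, according to whether `|X ω|` is below or above `1`. It handles the product of
two vanishing errors in `TendsTo.smul_smul`. -/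
theorem probNorm_mul_le_add [IsProbabilityMeasure P] (X Y : Ω →ₘ[P] ℝ) :
    probNorm (X * Y) ≤ probNorm X + probNorm Y := by
  rw [probNorm, probNorm, probNorm, ← integral_add (integrable_min_abs X) (integrable_min_abs Y)]
  apply integral_mono_ae (integrable_min_abs _)
    ((integrable_min_abs X).add (integrable_min_abs Y))
  filter_upwards [coeFn_mul' X Y] with ω h
  rw [h]
  change min |X ω * Y ω| 1 ≤ min |X ω| 1 + min |Y ω| 1
  rcases le_total |X ω| 1 with h4 | h4
  · have h1 : |X ω * Y ω| ≤ |Y ω| := by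
      rw [abs_mul]
      exact mul_le_of_le_one_left (abs_nonneg _) h4
    have h2 : 0 ≤ min |X ω| 1 := le_min (abs_nonneg _) zero_le_one
    linarith [min_le_min_right 1 h1]
  · rw [min_eq_right h4]
    have h2 : 0 ≤ min |Y ω| 1 := le_min (abs_nonneg _) zero_le_one
    linarith [min_le_right |X ω * Y ω| 1]

end L0

/-! ### The topology of a random normed module -/

namespace RandomNorm

open L0

variable {Ω : Type*} [MeasurableSpace Ω] {P : Measure Ω} {𝕜 : Type*} [RCLike 𝕜]
  {S : Type*} [AddCommGroup S] [Module (Ω →ₘ[P] 𝕜) S]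

theorem sub_comm (N : RandomNorm P 𝕜 S) (x y : S) : N (x - y) = N (y - x) := by
  rw [← neg_sub, N.map_neg]

theorem sub_le (N : RandomNorm P 𝕜 S) (x y z : S) : N (x - z) ≤ N (x - y) + N (y - z) := by
  have := N.add_le (x - y) (y - z)
  rwa [sub_add_sub_cancel] at this

theorem sub_le_add (N : RandomNorm P 𝕜 S) (x y : S) : N (x - y) ≤ N x + N y := by
  have := N.add_le x (-y)
  rwa [N.map_neg, ← sub_eq_add_neg] at this

theorem le_add_sub (N : RandomNorm P 𝕜 S) (x y : S) : N x ≤ N y + N (x - y) := by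
  have := N.add_le y (x - y)
  rwa [add_sub_cancel] at this

theorem abs_sub_le (N : RandomNorm P 𝕜 S) (x y : S) : |N x - N y| ≤ N (x - y) := by
  rw [abs_le', neg_sub, sub_le_iff_le_add', sub_le_iff_le_add']
  have := N.le_add_sub y x
  rw [N.sub_comm y x] at this
  exact ⟨N.le_add_sub x y, this⟩

theorem real_smul (N : RandomNorm P 𝕜 S) (η : Ω →ₘ[P] ℝ) (x : S) :
    N (toScalar 𝕜 η • x) = |η| * N x := by
  rw [N.smul, modulus_toScalar]

theorem real_smul_of_nonneg (N : RandomNorm P 𝕜 S) {η : Ω →ₘ[P] ℝ} (h : 0 ≤ η) (x : S) :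
    N (toScalar 𝕜 η • x) = η * N x := by
  rw [N.real_smul, abs_of_nonneg h]

variable [IsProbabilityMeasure P]

theorem probNorm_sub_le (N : RandomNorm P 𝕜 S) (x y z : S) :
    probNorm (N (x - z)) ≤ probNorm (N (x - y)) + probNorm (N (y - z)) :=
  (probNorm_mono (N.nonneg _) (N.sub_le x y z)).trans (probNorm_add_le _ _)

/-- Convergence in probability is metrised by `E[min(·, 1)]`: one inclusion splits the expectation
at a threshold, the other is Markov's inequality. -/
theorem uniformity_eq (N : RandomNorm P 𝕜 S) :
    @uniformity S N.uniformSpace =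
      ⨅ ε > 0, 𝓟 {p : S × S | probNorm (N (p.1 - p.2)) < ε} := by
  apply le_antisymm
  · refine le_iInf₂ fun ε hε => le_principal_iff.2 ?_
    refine (FilterBasis.mem_filter_iff _).2 ⟨_,
      ⟨ε / 2, min (ε / 2) (1 / 2), half_pos hε, lt_min (half_pos hε) (by norm_num),
        lt_of_le_of_lt (min_le_right _ _) (by norm_num), rfl⟩, ?_⟩
    intro q hq
    simp only [entourage, Set.mem_ofPred_eq] at hq ⊢
    have h1 := probNorm_le_add (N (q.1 - q.2)) (half_pos hε).le
    have h2 : P.real {ω | ε / 2 ≤ |N (q.1 - q.2) ω|} =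
        1 - P.real {ω | N (q.1 - q.2) ω < ε / 2} := by
      rw [← probReal_compl_eq_one_sub
        (measurableSet_lt (N (q.1 - q.2)).measurable measurable_const)]
      apply measureReal_congr
      filter_upwards [nonneg_iff.1 (N.nonneg (q.1 - q.2))] with ω hω
      apply propext
      change ε / 2 ≤ |N (q.1 - q.2) ω| ↔ ¬ N (q.1 - q.2) ω < ε / 2
      rw [abs_of_nonneg hω, not_lt]
    have h3 := min_le_left (ε / 2) (1 / 2)
    linarith
  · intro V hV
    obtain ⟨_, ⟨ε, lam, hε, hl, hl1, rfl⟩, hV⟩ := (FilterBasis.mem_filter_iff _).1 hV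
    -- The threshold must not exceed `1`, because `probNorm` truncates there.
    have hm : 0 < min ε 1 := lt_min hε one_pos
    refine mem_of_superset (mem_iInf_of_mem (min ε 1 * lam)
      (mem_iInf_of_mem (mul_pos hm hl) (mem_principal_self _))) (Set.Subset.trans ?_ hV)
    intro q hq
    simp only [entourage, Set.mem_ofPred_eq] at hq ⊢
    have h1 := mul_measureReal_le_probNorm (N (q.1 - q.2)) (min_le_right ε 1)
    have h2 : P.real {ω | min ε 1 ≤ |N (q.1 - q.2) ω|} < lam :=
      lt_of_mul_lt_mul_left (h1.trans_lt hq) hm.le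
    have h3 : 1 - P.real {ω | N (q.1 - q.2) ω < ε} ≤
        P.real {ω | min ε 1 ≤ |N (q.1 - q.2) ω|} := by
      rw [← probReal_compl_eq_one_sub
        (measurableSet_lt (N (q.1 - q.2)).measurable measurable_const)]
      refine measureReal_mono ?_ (measure_ne_top _ _)
      intro ω hω
      have h4 : ε ≤ N (q.1 - q.2) ω := not_lt.1 hω
      exact (min_le_left _ _).trans (h4.trans (le_abs_self _))
    linarith

/-- The metric `E[min(‖x - y‖, 1)]` turns a random normed module into a normed group whose
uniform structure is that of the `(ε, lam)`-topology. -/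
@[reducible]
noncomputable def normedGroup (N : RandomNorm P 𝕜 S) : NormedAddCommGroup S where
  norm x := probNorm (N x)
  dist x y := probNorm (N (x - y))
  dist_self x := by rw [sub_self, N.map_zero, probNorm_zero]
  dist_comm x y := by rw [N.sub_comm]
  dist_triangle x y z := N.probNorm_sub_le x y z
  toUniformSpace := N.uniformSpace
  uniformity_dist := N.uniformity_eq
  eq_of_dist_eq_zero h := sub_eq_zero.1 (N.eq_zero _ (probNorm_eq_zero h))
  dist_eq x y := by rw [N.sub_comm, sub_eq_neg_add]

theorem tendsTo_iff {N : RandomNorm P 𝕜 S} {ι : Type*} {f : ι → S} {l : Filter ι} {x : S} :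
    N.TendsTo f l x ↔ Tendsto (fun i => probNorm (N (f i - x))) l (𝓝 0) := by
  let := N.normedGroup
  exact tendsto_iff_dist_tendsto_zero

theorem continuous_iff (N : RandomNorm P 𝕜 S) {ι : Type*} [TopologicalSpace ι] {f : ι → S} :
    @Continuous ι S _ N.topology f ↔ ∀ s, N.TendsTo f (𝓝 s) (f s) :=
  @continuous_iff_continuousAt ι S _ N.topology f

theorem isDense_iff {N : RandomNorm P 𝕜 S} {s : Set S} :
    N.IsDense s ↔ ∀ x, ∀ r > 0, ∃ y ∈ s, probNorm (N (x - y)) < r := by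
  let := N.normedGroup
  refine Metric.dense_iff.trans (forall₂_congr fun x r => forall_congr' fun _ => ?_)
  constructor
  · rintro ⟨y, h1, h2⟩
    exact ⟨y, h2, by rw [N.sub_comm]; exact h1⟩
  · rintro ⟨y, h1, h2⟩
    exact ⟨y, by rw [N.sub_comm] at h2; exact h2, h1⟩

theorem exists_tendsTo_of_cauchy (N : RandomNorm P 𝕜 S) (hS : N.IsComplete) {f : ℕ → S}
    (h : ∀ r > 0, ∃ K, ∀ m ≥ K, ∀ n ≥ K, probNorm (N (f m - f n)) < r) :
    ∃ x, N.TendsTo f atTop x := by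
  let := N.normedGroup
  have : CompleteSpace S := hS
  exact cauchySeq_tendsto_of_complete (Metric.cauchySeq_iff.2 h)

section TendsTo

variable {N : RandomNorm P 𝕜 S} {ι : Type*} {f g : ι → S} {l : Filter ι} {x y : S}

theorem TendsTo.unique [l.NeBot] (hx : N.TendsTo f l x) (hy : N.TendsTo f l y) : x = y := by
  let := N.normedGroup
  exact tendsto_nhds_unique hx hy

theorem tendsTo_const (N : RandomNorm P 𝕜 S) (x : S) : N.TendsTo (fun _ : ι => x) l x := by
  let := N.normedGroup
  exact tendsto_const_nhds

theorem TendsTo.add (hx : N.TendsTo f l x) (hy : N.TendsTo g l y) :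
    N.TendsTo (fun i => f i + g i) l (x + y) := by
  let := N.normedGroup
  exact Tendsto.add hx hy

theorem TendsTo.sub (hx : N.TendsTo f l x) (hy : N.TendsTo g l y) :
    N.TendsTo (fun i => f i - g i) l (x - y) := by
  let := N.normedGroup
  exact Tendsto.sub hx hy

theorem TendsTo.neg (hx : N.TendsTo f l x) : N.TendsTo (fun i => -f i) l (-x) := by
  let := N.normedGroup
  exact Tendsto.neg hx

theorem TendsTo.congr (hx : N.TendsTo f l x) (h : ∀ i, f i = g i) : N.TendsTo g l x :=
  Tendsto.congr h hx

theorem TendsTo.comp {κ : Type*} {l' : Filter κ} {u : κ → ι} (hx : N.TendsTo f l x)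
    (hu : Tendsto u l' l) : N.TendsTo (fun k => f (u k)) l' x :=
  Tendsto.comp hx hu

theorem tendsTo_of_le {E : ι → Ω →ₘ[P] ℝ} (hE : Tendsto (fun i => probNorm (E i)) l (𝓝 0))
    (h : ∀ᶠ i in l, N (f i - x) ≤ E i) : N.TendsTo f l x := by
  rw [tendsTo_iff]
  refine squeeze_zero' (Eventually.of_forall fun i => probNorm_nonneg _) ?_ hE
  filter_upwards [h] with i hi
  exact probNorm_mono (N.nonneg _) hi

/-- The usual `ε / 3` argument, with `g` and `y` allowed to depend on `r`; it carries limits from a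
dense set to all of `S`. -/
theorem tendsTo_of_approx
    (h : ∀ r > 0, ∃ g : ι → S, ∃ y, N.TendsTo g l y ∧
      (∀ᶠ i in l, probNorm (N (f i - g i)) ≤ r) ∧ probNorm (N (x - y)) ≤ r) : N.TendsTo f l x := by
  rw [tendsTo_iff, Metric.tendsto_nhds]
  intro ε hε
  obtain ⟨g, y, hg, h1, h2⟩ := h (ε / 4) (by positivity)
  rw [tendsTo_iff, Metric.tendsto_nhds] at hg
  filter_upwards [hg (ε / 4) (by positivity), h1] with i h3 h4
  rw [Real.dist_eq, sub_zero, abs_of_nonneg (probNorm_nonneg _)] at h3 ⊢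
  have h5 := N.probNorm_sub_le (f i) (g i) x
  have h6 := N.probNorm_sub_le (g i) y x
  rw [N.sub_comm y x] at h6
  linarith

theorem TendsTo.map {T : S →ₗ[Ω →ₘ[P] 𝕜] S} {η : Ω →ₘ[P] ℝ} (hT : ∀ z, N (T z) ≤ η * N z)
    (hx : N.TendsTo f l x) : N.TendsTo (fun i => T (f i)) l (T x) := by
  refine tendsTo_of_le (tendsto_probNorm_mul η (tendsTo_iff.1 hx))
    (Eventually.of_forall fun i => ?_)
  rw [← map_sub]
  exact hT _

theorem TendsTo.smul_smul {ζ : ι → Ω →ₘ[P] ℝ} {ζ₀ : Ω →ₘ[P] ℝ}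
    (hζ : Tendsto (fun i => probNorm (ζ i - ζ₀)) l (𝓝 0)) (hx : N.TendsTo f l x) :
    N.TendsTo (fun i => toScalar 𝕜 (ζ i) • f i) l (toScalar 𝕜 ζ₀ • x) := by
  have h1 := tendsTo_iff.1 hx
  have h2 := (tendsto_probNorm_mul |ζ₀| h1).add
    ((tendsto_probNorm_mul (N x) hζ).add (hζ.add h1))
  simp only [add_zero] at h2
  rw [tendsTo_iff]
  refine squeeze_zero (fun i => probNorm_nonneg _) (fun i => ?_) h2
  -- Three error terms, linear in the error of `f`, linear in the error of `ζ`, and a product of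
  -- both errors.
  have e : toScalar 𝕜 (ζ i) • f i - toScalar 𝕜 ζ₀ • x =
      toScalar 𝕜 ζ₀ • (f i - x) + (toScalar 𝕜 (ζ i - ζ₀) • x +
        toScalar 𝕜 (ζ i - ζ₀) • (f i - x)) := by
    rw [toScalar_sub]
    module
  rw [e]
  refine (probNorm_mono (N.nonneg _) (N.add_le _ _)).trans ((probNorm_add_le _ _).trans ?_)
  refine add_le_add (by rw [N.real_smul]) ?_
  refine (probNorm_mono (N.nonneg _) (N.add_le _ _)).trans ((probNorm_add_le _ _).trans ?_)
  refine add_le_add (by rw [N.real_smul, probNorm_abs_mul, mul_comm]) ?_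
  rw [N.real_smul, probNorm_abs_mul]
  exact probNorm_mul_le_add _ _

theorem TendsTo.const_smul (ζ : Ω →ₘ[P] ℝ) (hx : N.TendsTo f l x) :
    N.TendsTo (fun i => toScalar 𝕜 ζ • f i) l (toScalar 𝕜 ζ • x) :=
  TendsTo.smul_smul (by simpa [probNorm_zero] using tendsto_const_nhds) hx

theorem TendsTo.scalar_smul (ζ : Ω →ₘ[P] 𝕜) (hx : N.TendsTo f l x) :
    N.TendsTo (fun i => ζ • f i) l (ζ • x) := by
  refine tendsTo_of_le (tendsto_probNorm_mul (modulus ζ) (tendsTo_iff.1 hx))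
    (Eventually.of_forall fun i => ?_)
  rw [← _root_.smul_sub, N.smul]

/-- Passing to the limit in an upper bound for the norm. -/
theorem TendsTo.le_of_le [l.NeBot] {B : Ω →ₘ[P] ℝ} (hx : N.TendsTo f l x)
    (h : ∀ᶠ i in l, N (f i) ≤ B) : N x ≤ B := by
  refine le_of_le_add_tendsto (tendsTo_iff.1 hx) ?_
  filter_upwards [h] with i hi
  rw [N.sub_comm]
  exact (N.le_add_sub x (f i)).trans (add_le_add_left hi _)

/-- Passing to the limit in an upper bound that itself converges. -/
theorem TendsTo.le_of_le_add [l.NeBot] {B : Ω →ₘ[P] ℝ} {E : ι → Ω →ₘ[P] ℝ}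
    (hx : N.TendsTo f l x) (hE : Tendsto (fun i => probNorm (E i)) l (𝓝 0))
    (h : ∀ᶠ i in l, N (f i) ≤ B + E i) : N x ≤ B := by
  have h1 : Tendsto (fun i => probNorm (E i + N (f i - x))) l (𝓝 0) :=
    squeeze_zero (fun i => probNorm_nonneg _) (fun i => probNorm_add_le _ _)
      (by simpa using hE.add (tendsTo_iff.1 hx))
  refine le_of_le_add_tendsto h1 ?_
  filter_upwards [h] with i hi
  rw [N.sub_comm, ← add_assoc]
  exact (N.le_add_sub x (f i)).trans (add_le_add_left hi _)

theorem IsDense.exists_seq {s : Set S} (hs : N.IsDense s) (x : S) :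
    ∃ u : ℕ → S, (∀ n, u n ∈ s) ∧ N.TendsTo u atTop x := by
  choose u hu using fun n : ℕ => isDense_iff.1 hs x (1 / ((n : ℝ) + 1)) (by positivity)
  refine ⟨u, fun n => (hu n).1, ?_⟩
  rw [tendsTo_iff]
  refine squeeze_zero (fun _ => probNorm_nonneg _) (fun n => ?_)
    tendsto_one_div_add_atTop_nhds_zero_nat
  rw [N.sub_comm]
  exact (hu n).2.le

theorem IsDense.of_closure {s t : Set S} (hs : N.IsDense s)
    (h : ∀ x ∈ s, ∃ u : ℕ → S, (∀ n, u n ∈ t) ∧ N.TendsTo u atTop x) : N.IsDense t := by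
  rw [isDense_iff] at hs ⊢
  intro x r hr
  obtain ⟨y, hy, h1⟩ := hs x (r / 2) (half_pos hr)
  obtain ⟨u, hu, hx⟩ := h y hy
  obtain ⟨n, hn⟩ := ((tendsTo_iff.1 hx).eventually (gt_mem_nhds (half_pos hr))).exists
  refine ⟨u n, hu n, ?_⟩
  have := N.probNorm_sub_le x y (u n)
  rw [N.sub_comm y] at this
  linarith

/-- A family of module homomorphisms with a common bound, which converges on a dense set. -/
theorem IsDense.tendsTo_of_bound {s : Set S} (hs : N.IsDense s)
    {T : ι → S →ₗ[Ω →ₘ[P] 𝕜] S} {T' : S →ₗ[Ω →ₘ[P] 𝕜] S} {B : Ω →ₘ[P] ℝ}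
    (hT : ∀ᶠ i in l, ∀ z, N (T i z) ≤ B * N z) (hT' : ∀ z, N (T' z) ≤ B * N z)
    (h : ∀ x ∈ s, N.TendsTo (fun i => T i x) l (T' x)) (x : S) :
    N.TendsTo (fun i => T i x) l (T' x) := by
  obtain ⟨u, hu, hx⟩ := hs.exists_seq x
  apply tendsTo_of_approx
  intro r hr
  obtain ⟨n, hn⟩ := ((tendsto_probNorm_mul B (tendsTo_iff.1 hx)).eventually
    (gt_mem_nhds hr)).exists
  rw [N.sub_comm] at hn
  refine ⟨fun i => T i (u n), T' (u n), h _ (hu n), ?_, ?_⟩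
  · filter_upwards [hT] with i hi
    rw [← map_sub]
    exact (probNorm_mono (N.nonneg _) (hi _)).trans hn.le
  · rw [← map_sub]
    exact (probNorm_mono (N.nonneg _) (hT' _)).trans hn.le

end TendsTo

end RandomNorm

/-! ### Infima in `L⁰` and the `L⁰`-norm of a homomorphism -/

namespace L0

variable {Ω : Type*} [MeasurableSpace Ω] {P : Measure Ω}

theorem le_of_withDensity_le [IsFiniteMeasure P] {f g : Ω → ENNReal} (hf : AEMeasurable f P)
    (h : P.withDensity f ≤ P.withDensity g) : f ≤ᵐ[P] g := by
  refine ae_le_of_forall_setLIntegral_le_of_sigmaFinite₀ hf fun s hs _ => ?_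
  rw [← withDensity_apply _ hs, ← withDensity_apply _ hs]
  exact h s

/-- A non-empty set of non-negative random variables has an infimum. -/
theorem exists_isGLB [IsFiniteMeasure P] {s : Set (Ω →ₘ[P] ℝ)} (hne : s.Nonempty)
    (h0 : ∀ X ∈ s, 0 ≤ X) : ∃ ν, IsGLB s ν := by
  -- Measures form a complete lattice, so the infimum of the `X P` exists as a measure. It lies
  -- below a σ-finite measure absolutely continuous with respect to `P`, hence has a density, which
  -- is the required infimum.
  let D : (Ω →ₘ[P] ℝ) → Measure Ω := fun X => P.withDensity fun ω => ENNReal.ofReal (X ω)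
  have hD : ∀ X : Ω →ₘ[P] ℝ, AEMeasurable (fun ω => ENNReal.ofReal (X ω)) P := fun X =>
    X.measurable.ennreal_ofReal.aemeasurable
  let m : Measure Ω := sInf (D '' s)
  have hm : ∀ X ∈ s, m ≤ D X := fun X hX => sInf_le ⟨X, hX, rfl⟩
  obtain ⟨X₀, hX₀⟩ := hne
  have hac : m ≪ P := (Measure.absolutelyContinuous_of_le (hm X₀ hX₀)).trans
    (withDensity_absolutelyContinuous _ _)
  have : SigmaFinite (D X₀) := SigmaFinite.withDensity_of_ne_top
    (ae_of_all _ fun _ => ENNReal.ofReal_ne_top)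
  have : SigmaFinite m := Measure.sigmaFinite_of_le _ (hm X₀ hX₀)
  have hg : P.withDensity (m.rnDeriv P) = m := Measure.withDensity_rnDeriv_eq _ _ hac
  have hgm : Measurable (m.rnDeriv P) := Measure.measurable_rnDeriv _ _
  have hfin : ∀ᵐ ω ∂P, m.rnDeriv P ω ≠ ⊤ := Measure.rnDeriv_ne_top _ _
  refine ⟨AEEqFun.mk (fun ω => (m.rnDeriv P ω).toReal)
    hgm.ennreal_toReal.aestronglyMeasurable, ?_, ?_⟩
  · intro X hX
    have h1 := le_of_withDensity_le hgm.aemeasurable (hg.trans_le (hm X hX))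
    rw [le_iff]
    filter_upwards [h1, nonneg_iff.1 (h0 X hX), AEEqFun.coeFn_mk
      (fun ω => (m.rnDeriv P ω).toReal) hgm.ennreal_toReal.aestronglyMeasurable]
      with ω h2 h3 h4
    rw [h4]
    exact ENNReal.toReal_le_of_le_ofReal h3 h2
  · intro b hb
    have h1 : D b ≤ m := by
      refine le_sInf ?_
      rintro _ ⟨X, hX, rfl⟩
      refine withDensity_mono ?_
      filter_upwards [le_iff.1 (hb hX)] with ω h2
      exact ENNReal.ofReal_le_ofReal h2
    have h2 := le_of_withDensity_le (hD b) (h1.trans_eq hg.symm)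
    rw [le_iff]
    filter_upwards [h2, hfin, AEEqFun.coeFn_mk
      (fun ω => (m.rnDeriv P ω).toReal) hgm.ennreal_toReal.aestronglyMeasurable]
      with ω h3 h4 h5
    rw [h5]
    exact (ENNReal.ofReal_le_iff_le_toReal h4).1 h3

end L0

namespace RandomNorm

open L0

variable {Ω : Type*} [MeasurableSpace Ω] {P : Measure Ω} {𝕜 : Type*} [RCLike 𝕜]
  {S : Type*} [AddCommGroup S] [Module (Ω →ₘ[P] 𝕜) S]

/-- The infimum of the bounds is itself a bound: each of them dominates the ratio `‖T z‖ / ‖z‖`, so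
the infimum does too. -/
theorem OpNormLE.le {N : RandomNorm P 𝕜 S} {T : S →ₗ[Ω →ₘ[P] 𝕜] S} {ζ : Ω →ₘ[P] ℝ}
    (h : N.OpNormLE T ζ) (z : S) : N (T z) ≤ ζ * N z := by
  obtain ⟨⟨η, hη⟩, ν, hν, hle⟩ := h
  refine le_trans ?_ (mul_le_mul_of_nonneg_right hle (N.nonneg z))
  have hr : N (T z) * inv (N z) ≤ ν := by
    apply hν.2
    intro θ hθ
    rw [le_iff]
    filter_upwards [nonneg_iff.1 hθ.1, le_iff.1 (hθ.2 z), coeFn_mul' θ (N z),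
      coeFn_mul' (N (T z)) (inv (N z)), coeFn_inv (N z), nonneg_iff.1 (N.nonneg z)]
      with ω h1 h2 h3 h4 h5 h6
    rw [h4, h5]
    rw [h3] at h2
    exact mul_inv_le_of_le_mul₀ h6 h1 h2
  rw [le_iff] at hr ⊢
  filter_upwards [hr, le_iff.1 (hη.2 z), coeFn_mul' η (N z), coeFn_mul' ν (N z),
    coeFn_mul' (N (T z)) (inv (N z)), coeFn_inv (N z), nonneg_iff.1 (N.nonneg z)]
    with ω h1 h2 h3 h4 h5 h6 h7
  rw [h4]
  rw [h5, h6] at h1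
  rw [h3] at h2
  -- Where `‖z‖ = 0`, the ratio has the default value `0` and carries no information; the actual
  -- bound `η` gives `‖T z‖ = 0` there.
  rcases h7.eq_or_lt with h8 | h8
  · rw [← h8, mul_zero] at h2 ⊢
    exact h2
  · rw [← div_eq_mul_inv, div_le_iff₀ h8] at h1
    exact h1

theorem opNormLE_of_le [IsProbabilityMeasure P] {N : RandomNorm P 𝕜 S}
    {T : S →ₗ[Ω →ₘ[P] 𝕜] S} {ζ : Ω →ₘ[P] ℝ} (hζ : 0 ≤ ζ) (h : ∀ z, N (T z) ≤ ζ * N z) :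
    N.OpNormLE T ζ := by
  have hb : ζ ∈ N.bounds T := ⟨hζ, h⟩
  obtain ⟨ν, hν⟩ := exists_isGLB (s := N.bounds T) ⟨ζ, hb⟩ fun X hX => hX.1
  exact ⟨⟨ζ, hb⟩, ν, hν, hν.1 hb⟩

end RandomNorm

/-! ### Graphs of partially defined operators -/

namespace PartialOp

variable {R S : Type*} [CommRing R] [AddCommGroup S] [Module R S]

theorem mem_graph_shift {η : R} {A : S →ₗ.[R] S} {x y : S} :
    (x, y) ∈ (shift η A).graph ↔ (x, η • x - y) ∈ A.graph := by
  rw [LinearPMap.mem_graph_iff, LinearPMap.mem_graph_iff]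
  constructor
  · rintro ⟨u, hu, h⟩
    refine ⟨u, hu, ?_⟩
    change η • (u : S) - A u = y at h
    obtain rfl : (u : S) = x := hu
    exact (sub_eq_iff_eq_add.2 (by rw [← h]; abel)).symm
  · rintro ⟨u, hu, h⟩
    refine ⟨u, hu, ?_⟩
    change A u = η • x - y at h
    change η • (u : S) - A u = y
    obtain rfl : (u : S) = x := hu
    rw [h, sub_sub_cancel]

theorem injective_iff {B : S →ₗ.[R] S} :
    Function.Injective B ↔ ∀ x, (x, (0 : S)) ∈ B.graph → x = 0 := by
  constructor
  · intro h x hx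
    obtain ⟨u, hu, h0⟩ := (LinearPMap.mem_graph_iff _).1 hx
    have : u = 0 := h (h0.trans B.map_zero.symm)
    obtain rfl : (u : S) = x := hu
    rw [this]
    rfl
  · intro h u v huv
    have h1 : ((u - v : B.domain) : S) = 0 := by
      apply h
      rw [LinearPMap.mem_graph_iff]
      exact ⟨u - v, rfl, by rw [LinearPMap.map_sub, huv, sub_self]⟩
    exact sub_eq_zero.1 (Subtype.ext h1)

theorem mem_graph_inverse {B : S →ₗ.[R] S} (hB : Function.Injective B) {x y : S} :
    (x, y) ∈ B.inverse.graph ↔ (y, x) ∈ B.graph := by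
  have hk : LinearMap.ker B.toFun = ⊥ := LinearMap.ker_eq_bot.2 hB
  rw [LinearPMap.inverse_graph hk]
  constructor
  · rintro ⟨⟨a, b⟩, h, e⟩
    obtain ⟨rfl, rfl⟩ := Prod.mk.inj e
    exact h
  · intro h
    exact ⟨(y, x), h, rfl⟩

theorem mem_graph_pcomp {g f : S →ₗ.[R] S} {x z : S} :
    (x, z) ∈ (pcomp g f).graph ↔ ∃ y, (x, y) ∈ f.graph ∧ (y, z) ∈ g.graph := by
  simp only [LinearPMap.mem_graph_iff]
  constructor
  · rintro ⟨⟨u, hu, hu'⟩, rfl, h⟩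
    obtain ⟨v, hv, rfl⟩ := hu
    refine ⟨f v, ⟨v, rfl, rfl⟩, ⟨f v, hv⟩, rfl, ?_⟩
    exact h
  · rintro ⟨y, ⟨u, rfl, rfl⟩, ⟨v, hv, rfl⟩⟩
    have hd : f u ∈ g.domain := hv ▸ v.2
    refine ⟨⟨u, ⟨u, hd, rfl⟩, u.2⟩, rfl, ?_⟩
    change g ⟨f u, _⟩ = g v
    congr 1
    exact Subtype.ext hv.symm

theorem mem_graph_invPow_zero {B : S →ₗ.[R] S} {x y : S} :
    (x, y) ∈ (invPow B 0).graph ↔ x = y := by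
  rw [LinearPMap.mem_graph_iff]
  constructor
  · rintro ⟨u, rfl, rfl⟩
    rfl
  · rintro rfl
    exact ⟨⟨x, trivial⟩, rfl, rfl⟩

theorem mem_graph_invPow_succ {B : S →ₗ.[R] S} (hB : Function.Injective B) {n : ℕ} {x z : S} :
    (x, z) ∈ (invPow B (n + 1)).graph ↔
      ∃ y, (x, y) ∈ (invPow B n).graph ∧ (z, y) ∈ B.graph := by
  rw [invPow, mem_graph_pcomp]
  simp only [mem_graph_inverse hB]

theorem mem_graph_compOfRangeLE {T : S →ₗ.[R] S} {C : S →ₗ[R] S}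
    (h : LinearMap.range C ≤ T.domain) (x : S) : (C x, compOfRangeLE T C h x) ∈ T.graph :=
  (LinearPMap.mem_graph_iff _).2 ⟨⟨C x, h ⟨x, rfl⟩⟩, rfl, rfl⟩

theorem mem_conjGraph {C : S →ₗ[R] S} {A : S →ₗ.[R] S} {x y : S} :
    (x, y) ∈ conjGraph C A ↔ (C x, C y) ∈ A.graph := Iff.rfl

end PartialOp

/-! ### Exponentials of random variables and their limits in probability -/

namespace L0

variable {Ω : Type*} [MeasurableSpace Ω] {P : Measure Ω}

theorem coeFn_exp_mul_const (θ : Ω →ₘ[P] ℝ) (c : ℝ) :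
    ∀ᵐ ω ∂P, exp (θ * AEEqFun.const Ω c) ω = Real.exp (θ ω * c) := by
  filter_upwards [coeFn_exp (θ * AEEqFun.const Ω c), coeFn_mul' θ (AEEqFun.const Ω c),
    coeFn_const' (P := P) c] with ω h1 h2 h3
  rw [h1, h2, h3]

theorem exp_neg_mul_const_le_one {δ : Ω →ₘ[P] ℝ} (hδ : ∀ᵐ ω ∂P, 0 < δ ω) {c : ℝ} (hc : 0 ≤ c) :
    exp (-δ * AEEqFun.const Ω c) ≤ 1 := by
  rw [le_iff]
  filter_upwards [hδ, coeFn_exp_mul_const (-δ) c, coeFn_neg' δ, coeFn_one' (P := P) (R := ℝ)]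
    with ω h1 h2 h3 h4
  rw [h2, h3, h4, Real.exp_le_one_iff]
  nlinarith

theorem const_mul_const (a b : ℝ) :
    (AEEqFun.const Ω (a * b) : Ω →ₘ[P] ℝ) = AEEqFun.const Ω a * AEEqFun.const Ω b := rfl

theorem const_one : (AEEqFun.const Ω (1 : ℝ) : Ω →ₘ[P] ℝ) = 1 := rfl

variable [IsProbabilityMeasure P]

theorem tendsto_probNorm_exp_sub (θ : Ω →ₘ[P] ℝ) (s₀ : ℝ≥0) :
    Tendsto (fun s : ℝ≥0 => probNorm (exp (θ * AEEqFun.const Ω (s : ℝ)) -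
      exp (θ * AEEqFun.const Ω (s₀ : ℝ)))) (𝓝 s₀) (𝓝 0) := by
  refine tendsto_probNorm_of_ae_eq
    (F := fun s ω => Real.exp (θ ω * s) - Real.exp (θ ω * s₀)) (fun s => ?_) ?_
  · filter_upwards [coeFn_sub' (exp (θ * AEEqFun.const Ω (s : ℝ)))
      (exp (θ * AEEqFun.const Ω (s₀ : ℝ))), coeFn_exp_mul_const θ s, coeFn_exp_mul_const θ s₀]
      with ω h1 h2 h3
    rw [h1, h2, h3]
  · refine ae_of_all _ fun ω => ?_
    have : Continuous fun s : ℝ≥0 => Real.exp (θ ω * s) - Real.exp (θ ω * s₀) := by fun_prop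
    simpa using this.tendsto s₀

theorem tendsto_coe_nnreal_nhdsGT :
    Tendsto (fun s : ℝ≥0 => (s : ℝ)) (𝓝[>] 0) (𝓝[>] 0) :=
  tendsto_nhdsWithin_of_tendsto_nhds_of_eventually_within _
    ((NNReal.continuous_coe.tendsto 0).mono_left nhdsWithin_le_nhds)
    (eventually_nhdsWithin_of_forall fun _ hs => NNReal.coe_pos.2 hs)

theorem tendsto_probNorm_expQuot (θ : Ω →ₘ[P] ℝ) :
    Tendsto (fun s : ℝ≥0 => probNorm (AEEqFun.const Ω (s : ℝ)⁻¹ *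
      (exp (θ * AEEqFun.const Ω (s : ℝ)) - 1) - θ)) (𝓝[>] 0) (𝓝 0) := by
  refine tendsto_probNorm_of_ae_eq
    (F := fun s ω => (s : ℝ)⁻¹ * (Real.exp (θ ω * s) - 1) - θ ω) (fun s => ?_) ?_
  · filter_upwards [coeFn_sub' (AEEqFun.const Ω (s : ℝ)⁻¹ *
      (exp (θ * AEEqFun.const Ω (s : ℝ)) - 1)) θ,
      coeFn_mul' (AEEqFun.const Ω (s : ℝ)⁻¹) (exp (θ * AEEqFun.const Ω (s : ℝ)) - 1),
      coeFn_sub' (exp (θ * AEEqFun.const Ω (s : ℝ))) 1,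
      coeFn_exp_mul_const θ s, coeFn_one' (P := P) (R := ℝ),
      coeFn_const' (P := P) (s : ℝ)⁻¹] with ω h1 h2 h3 h4 h5 h6
    rw [h1, h2, h3, h4, h5, h6]
  · refine ae_of_all _ fun ω => ?_
    have h1 : HasDerivAt (fun s : ℝ => Real.exp (θ ω * s)) (θ ω) 0 := by
      have := ((hasDerivAt_id (0 : ℝ)).const_mul (θ ω)).exp
      simpa using this
    have h2 := h1.tendsto_slope_zero_right
    simp only [zero_add, mul_zero, Real.exp_zero, smul_eq_mul] at h2
    have h3 := (h2.sub_const (θ ω)).comp tendsto_coe_nnreal_nhdsGT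
    rw [sub_self] at h3
    exact h3

theorem tendsto_probNorm_exp_neg {δ : Ω →ₘ[P] ℝ} (hδ : ∀ᵐ ω ∂P, 0 < δ ω) (Y : Ω →ₘ[P] ℝ) :
    Tendsto (fun n : ℕ => probNorm (Y * exp (-δ * AEEqFun.const Ω (n : ℝ)))) atTop (𝓝 0) := by
  apply tendsto_probNorm_mul
  refine tendsto_probNorm_of_ae_eq
    (F := fun n ω => Real.exp ((-δ) ω * n)) (fun n => coeFn_exp_mul_const _ _) ?_
  filter_upwards [hδ, coeFn_neg' δ] with ω h1 h2
  rw [h2]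
  apply Real.tendsto_exp_atBot.comp
  exact Tendsto.const_mul_atTop_of_neg (neg_neg_of_pos h1) tendsto_natCast_atTop_atTop

end L0

/-! ### The generator of a `C`-semigroup as a relation -/

namespace RandomNorm

open L0

variable {Ω : Type*} [MeasurableSpace Ω] {P : Measure Ω} {𝕜 : Type*} [RCLike 𝕜]
  {S : Type*} [AddCommGroup S] [Module (Ω →ₘ[P] 𝕜) S] [IsProbabilityMeasure P]
  {N : RandomNorm P 𝕜 S} {C : S →ₗ[Ω →ₘ[P] 𝕜] S} {W : ℝ≥0 → (S →ₗ[Ω →ₘ[P] 𝕜] S)}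
  {M ξ δ : Ω →ₘ[P] ℝ} {x y x' y' : S}

omit [IsProbabilityMeasure P] in
theorem diffQuot_eq (x : S) (s : ℝ≥0) :
    diffQuot C W x s = toScalar 𝕜 (AEEqFun.const Ω (s : ℝ)⁻¹ : Ω →ₘ[P] ℝ) • (W s x - C x) := by
  rw [diffQuot, toScalar_const, RCLike.ofReal_inv]

/-- The difference quotients of `W` at `x` converge to `C y`. -/
def Generates (N : RandomNorm P 𝕜 S) (C : S →ₗ[Ω →ₘ[P] 𝕜] S)
    (W : ℝ≥0 → (S →ₗ[Ω →ₘ[P] 𝕜] S)) (x y : S) : Prop :=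
  N.TendsTo (diffQuot C W x) (𝓝[>] 0) (C y)

/-- Injectivity of `C` makes `y` unique. With `isGenerator_of_graph`, this turns generation into an
equality of graphs, and later arguments can avoid the subtype of the domain. -/
theorem IsGenerator.mem_graph {A : S →ₗ.[Ω →ₘ[P] 𝕜] S} (h : N.IsGenerator C W A)
    (hC : Function.Injective C) : (x, y) ∈ A.graph ↔ N.Generates C W x y := by
  rw [LinearPMap.mem_graph_iff]
  constructor
  · rintro ⟨u, rfl, rfl⟩
    exact h.apply u
  · intro hxy
    have hx : x ∈ A.domain := (h.mem_domain x).2 ⟨y, hxy⟩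
    exact ⟨⟨x, hx⟩, rfl, hC (TendsTo.unique (h.apply ⟨x, hx⟩) hxy)⟩

theorem isGenerator_of_graph {A : S →ₗ.[Ω →ₘ[P] 𝕜] S}
    (h : ∀ x y, (x, y) ∈ A.graph ↔ N.Generates C W x y) : N.IsGenerator C W A where
  mem_domain x := by
    rw [LinearPMap.mem_domain_iff]
    exact exists_congr fun y => h x y
  apply x := (h _ _).1 (A.mem_graph x)

theorem Generates.add (h : N.Generates C W x y) (h' : N.Generates C W x' y') :
    N.Generates C W (x + x') (y + y') := by
  have := TendsTo.add h h'
  rw [← _root_.map_add] at this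
  refine this.congr fun s => ?_
  rw [diffQuot, diffQuot, diffQuot, ← smul_add, _root_.map_add, _root_.map_add]
  congr 1
  abel

theorem Generates.smul (ζ : Ω →ₘ[P] 𝕜) (h : N.Generates C W x y) :
    N.Generates C W (ζ • x) (ζ • y) := by
  have := TendsTo.scalar_smul ζ h
  rw [← LinearMap.map_smul] at this
  refine this.congr fun s => ?_
  rw [diffQuot, diffQuot, smul_comm, LinearMap.map_smul, LinearMap.map_smul, ← _root_.smul_sub]

theorem Generates.neg (h : N.Generates C W x y) : N.Generates C W (-x) (-y) := by
  simpa using h.smul (-1)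

theorem Generates.sub (h : N.Generates C W x y) (h' : N.Generates C W x' y') :
    N.Generates C W (x - x') (y - y') := by
  simpa only [sub_eq_add_neg] using h.add h'.neg

namespace IsCSemigroup

theorem apply_apply (hW : N.IsCSemigroup C W) (s t : ℝ≥0) (x : S) :
    W t (W s x) = C (W (s + t) x) := (LinearMap.congr_fun (hW.map_add s t) x).symm

theorem comm (hW : N.IsCSemigroup C W) (s : ℝ≥0) (x : S) : W s (C x) = C (W s x) := by
  have := hW.apply_apply 0 s x
  rwa [hW.map_zero, zero_add] at this

theorem bound_C (hW : N.IsCSemigroup C W) : ∃ c : Ω →ₘ[P] ℝ, 0 ≤ c ∧ ∀ z, N (C z) ≤ c * N z := by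
  obtain ⟨c, hc⟩ := hW.bounded 0
  rw [hW.map_zero] at hc
  exact ⟨c, hc⟩

theorem generates_map (hW : N.IsCSemigroup C W) (h : N.Generates C W x y) :
    N.Generates C W (C x) (C y) := by
  obtain ⟨c, _, hc⟩ := hW.bound_C
  refine (TendsTo.map hc h).congr fun s => ?_
  rw [diffQuot, diffQuot, LinearMap.map_smul, map_sub, hW.comm]

end IsCSemigroup

/-- The family `e ^ (θ s) W s`. -/
noncomputable def rescale (θ : Ω →ₘ[P] ℝ) (W : ℝ≥0 → (S →ₗ[Ω →ₘ[P] 𝕜] S)) (s : ℝ≥0) :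
    S →ₗ[Ω →ₘ[P] 𝕜] S :=
  toScalar 𝕜 (exp (θ * AEEqFun.const Ω (s : ℝ))) • W s

omit [IsProbabilityMeasure P] in
theorem rescale_apply (θ : Ω →ₘ[P] ℝ) (s : ℝ≥0) (x : S) :
    rescale θ W s x = toScalar 𝕜 (exp (θ * AEEqFun.const Ω (s : ℝ))) • W s x := rfl

omit [IsProbabilityMeasure P] in
theorem rescale_neg_rescale (θ : Ω →ₘ[P] ℝ) : rescale (-θ) (rescale θ W) = W := by
  funext s
  ext x
  rw [rescale_apply, rescale_apply, smul_smul, ← toScalar_mul, ← exp_add, neg_mul,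
    neg_add_cancel, exp_zero, toScalar_one, one_smul]

theorem IsCSemigroup.rescale (hW : N.IsCSemigroup C W) (θ : Ω →ₘ[P] ℝ) :
    N.IsCSemigroup C (rescale θ W) where
  bounded s := by
    obtain ⟨η, h0, hη⟩ := hW.bounded s
    refine ⟨exp (θ * AEEqFun.const Ω (s : ℝ)) * η, mul_nonneg (exp_nonneg _) h0, fun z => ?_⟩
    rw [rescale_apply, N.real_smul_of_nonneg (exp_nonneg _), mul_assoc]
    exact mul_le_mul_of_nonneg_left (hη z) (exp_nonneg _)
  map_add s t := by
    ext x
    have e : (AEEqFun.const Ω ((s + t : ℝ≥0) : ℝ) : Ω →ₘ[P] ℝ) =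
        AEEqFun.const Ω (s : ℝ) + AEEqFun.const Ω (t : ℝ) := by
      rw [NNReal.coe_add]
      rfl
    rw [LinearMap.comp_apply, LinearMap.comp_apply, rescale_apply, rescale_apply, rescale_apply,
      LinearMap.map_smul, LinearMap.map_smul, hW.apply_apply, smul_smul, ← toScalar_mul,
      ← exp_add, e, mul_add, add_comm]
  map_zero := by
    ext x
    have e : (AEEqFun.const Ω ((0 : ℝ≥0) : ℝ) : Ω →ₘ[P] ℝ) = 0 := rfl
    rw [rescale_apply, e, mul_zero, exp_zero, toScalar_one, one_smul, hW.map_zero]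
  continuous x := by
    rw [continuous_iff]
    intro s₀
    exact TendsTo.smul_smul (tendsto_probNorm_exp_sub θ s₀) (continuous_iff _ |>.1
      (hW.continuous x) s₀)

omit [IsProbabilityMeasure P] in
theorem rescale_le {s : ℝ≥0} (h : ∀ z, N (W s z) ≤ M * exp (ξ * AEEqFun.const Ω (s : ℝ)) * N z)
    (θ : Ω →ₘ[P] ℝ) (z : S) :
    N (rescale θ W s z) ≤ M * exp ((ξ + θ) * AEEqFun.const Ω (s : ℝ)) * N z := by
  rw [rescale_apply, N.real_smul_of_nonneg (exp_nonneg _), add_mul, exp_add]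
  calc _ ≤ exp (θ * AEEqFun.const Ω (s : ℝ)) * (M * exp (ξ * AEEqFun.const Ω (s : ℝ)) * N z) :=
        mul_le_mul_of_nonneg_left (h z) (exp_nonneg _)
    _ = _ := by ring

/-- The new difference quotient is `e ^ (θ s)` times the old one plus `((e ^ (θ s) - 1) / s) C x`,
whence the generator is shifted by `θ`. -/
theorem Generates.rescale (h : N.Generates C W x y) (θ : Ω →ₘ[P] ℝ) :
    N.Generates C (rescale θ W) x (y + toScalar 𝕜 θ • x) := by
  have h1 : Tendsto (fun s : ℝ≥0 => probNorm (exp (θ * AEEqFun.const Ω (s : ℝ)) - 1))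
      (𝓝[>] 0) (𝓝 0) := by
    have := (tendsto_probNorm_exp_sub θ 0).mono_left (nhdsWithin_le_nhds (s := Set.Ioi 0))
    have e : (AEEqFun.const Ω ((0 : ℝ≥0) : ℝ) : Ω →ₘ[P] ℝ) = 0 := rfl
    simpa only [e, mul_zero, exp_zero] using this
  have h2 := (TendsTo.smul_smul h1 h).add
    (TendsTo.smul_smul (tendsto_probNorm_expQuot θ) (N.tendsTo_const (C x)))
  rw [toScalar_one, one_smul, ← LinearMap.map_smul, ← _root_.map_add] at h2
  refine h2.congr fun s => ?_
  rw [diffQuot_eq, diffQuot_eq, rescale_apply, toScalar_mul, toScalar_sub, toScalar_one]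
  module

theorem generates_rescale_iff (θ : Ω →ₘ[P] ℝ) :
    N.Generates C (rescale θ W) x y ↔ N.Generates C W x (y - toScalar 𝕜 θ • x) := by
  constructor
  · intro h
    have := h.rescale (-θ)
    rwa [rescale_neg_rescale, toScalar_neg, neg_smul, ← sub_eq_add_neg] at this
  · intro h
    have := h.rescale θ
    rwa [sub_add_cancel] at this

/-- For a `C`-semigroup of negative exponential type, the generator is injective. -/
theorem IsCSemigroup.eq_zero_of_generates_zero (hW : N.IsCSemigroup C W)
    (hC : Function.Injective C) (hM : 0 ≤ M) (hδ : ∀ᵐ ω ∂P, 0 < δ ω)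
    (hb : ∀ (s : ℝ≥0) z, N (W s z) ≤ M * exp (-δ * AEEqFun.const Ω (s : ℝ)) * N z)
    (h : N.Generates C W x 0) : x = 0 := by
  have hbM : ∀ (s : ℝ≥0) z, N (W s z) ≤ M * N z := fun s z =>
    (hb s z).trans (mul_le_mul_of_nonneg_right
      (mul_le_of_le_one_right hM (exp_neg_mul_const_le_one hδ s.2)) (N.nonneg z))
  -- `C (W (k t) x) - C (C x)` is the sum of the `W (j t) (W t x - C x)` over `j < k`, and `W t x -
  -- C x` is `t` times a difference quotient.
  have step : ∀ (t : ℝ≥0) (k : ℕ),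
      N (C (W (k * t) x) - C (C x)) ≤
        AEEqFun.const Ω ((k : ℝ) * t) * (M * N (diffQuot C W x t)) := by
    intro t k
    rcases eq_or_ne t 0 with rfl | ht
    · rw [mul_zero, hW.map_zero, sub_self, N.map_zero]
      exact mul_nonneg (const_nonneg (by positivity)) (mul_nonneg hM (N.nonneg _))
    have ht' : (t : ℝ) ≠ 0 := NNReal.coe_ne_zero.2 ht
    have e : W t x - C x =
        toScalar 𝕜 (AEEqFun.const Ω (t : ℝ) : Ω →ₘ[P] ℝ) • diffQuot C W x t := by
      rw [diffQuot_eq, smul_smul, ← toScalar_mul, ← const_mul_const, mul_inv_cancel₀ ht',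
        const_one, toScalar_one, one_smul]
    induction k with
    | zero =>
      rw [Nat.cast_zero, zero_mul, hW.map_zero, sub_self, N.map_zero]
      exact mul_nonneg (const_nonneg (by simp)) (mul_nonneg hM (N.nonneg _))
    | succ k ih =>
      have e1 : C (W ((k + 1 : ℕ) * t) x) - C (W (k * t) x) = W (k * t) (W t x - C x) := by
        rw [map_sub, hW.apply_apply, hW.comm]
        congr 3
        push_cast
        ring_nf
      have e2 : N (C (W ((k + 1 : ℕ) * t) x) - C (W (k * t) x)) ≤
          AEEqFun.const Ω (t : ℝ) * (M * N (diffQuot C W x t)) := by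
        rw [e1, e]
        refine (hbM _ _).trans_eq ?_
        rw [N.real_smul_of_nonneg (const_nonneg t.coe_nonneg)]
        ring
      refine (N.sub_le _ (C (W (k * t) x)) _).trans ((add_le_add e2 ih).trans_eq ?_)
      rw [← add_mul]
      congr 1
      change AEEqFun.const Ω ((t : ℝ) + k * t) = _
      congr 1
      push_cast
      ring
  -- For `k t = T` fixed and `t → 0`, the bound is `T M` times a difference quotient that tends to
  -- `0`, so the orbit is constant.
  have hconst : ∀ T : ℝ≥0, W T x = C x := by
    intro T
    rcases eq_or_ne T 0 with rfl | hT
    · rw [hW.map_zero]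
    apply hC
    rw [← sub_eq_zero]
    apply N.eq_zero
    apply le_antisymm _ (N.nonneg _)
    have hlim : Tendsto (fun k : ℕ => T / ((k : ℝ≥0) + 1)) atTop (𝓝[>] 0) := by
      refine tendsto_nhdsWithin_of_tendsto_nhds_of_eventually_within _ ?_
        (Eventually.of_forall fun k => ?_)
      · have := (tendsto_one_div_add_atTop_nhds_zero_nat (𝕜 := ℝ)).const_mul (T : ℝ)
        rw [← NNReal.tendsto_coe]
        simpa [div_eq_mul_inv] using this
      · exact div_pos (pos_iff_ne_zero.2 hT) (by positivity)
    have h0 : N.TendsTo (diffQuot C W x) (𝓝[>] 0) 0 := by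
      rw [Generates, _root_.map_zero] at h
      exact h
    have h1 := tendsto_probNorm_mul (AEEqFun.const Ω (T : ℝ) * M) (tendsTo_iff.1 (h0.comp hlim))
    refine le_of_le_add_tendsto h1 (Eventually.of_forall fun k => ?_)
    have h2 := step (T / ((k : ℝ≥0) + 1)) (k + 1)
    have e3 : ((k + 1 : ℕ) : ℝ≥0) * (T / ((k : ℝ≥0) + 1)) = T := by
      push_cast
      field_simp
    have e4 : ((k + 1 : ℕ) : ℝ) * ((T / ((k : ℝ≥0) + 1) : ℝ≥0) : ℝ) = T := by
      exact_mod_cast congrArg NNReal.toReal e3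
    rw [e3, e4] at h2
    rw [zero_add, sub_zero, mul_assoc]
    exact h2
  -- A constant orbit that decays exponentially vanishes.
  have hCx : N (C x) ≤ 0 := by
    refine le_of_le_add_tendsto (tendsto_probNorm_exp_neg hδ (M * N x))
      (Eventually.of_forall fun n => ?_)
    have := hb n x
    rw [hconst] at this
    rw [zero_add]
    refine this.trans_eq ?_
    rw [NNReal.coe_natCast]
    ring
  exact hC ((N.eq_zero _ (le_antisymm hCx (N.nonneg _))).trans (_root_.map_zero C).symm)

end RandomNorm

/-! ### The Euler scheme on dyadic meshes -/

namespace RandomNorm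

open L0

variable {Ω : Type*} [MeasurableSpace Ω] {P : Measure Ω} {𝕜 : Type*} [RCLike 𝕜]
  {S : Type*} [AddCommGroup S] [Module (Ω →ₘ[P] 𝕜) S]

/-- The mesh width `2⁻ᵏ` as a random variable. -/
noncomputable def mesh (P : Measure Ω) (k : ℕ) : Ω →ₘ[P] ℝ := AEEqFun.const Ω ((1 / 2 : ℝ) ^ k)

theorem mesh_nonneg (k : ℕ) : 0 ≤ mesh P k := const_nonneg (by positivity)

theorem mesh_succ_add (k : ℕ) : mesh P k = mesh P (k + 1) + mesh P (k + 1) := by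
  change _ = (AEEqFun.const Ω ((1 / 2 : ℝ) ^ (k + 1) + (1 / 2 : ℝ) ^ (k + 1)) : Ω →ₘ[P] ℝ)
  rw [mesh]
  congr 1
  rw [pow_succ]
  ring

variable [IsProbabilityMeasure P]

theorem tendsto_probNorm_mesh_mul (X : Ω →ₘ[P] ℝ) :
    Tendsto (fun k => probNorm (mesh P k * X)) atTop (𝓝 0) :=
  tendsto_probNorm_const_mul X
    (tendsto_pow_atTop_nhds_zero_of_lt_one (by norm_num) (by norm_num))

theorem IsDense.image {N : RandomNorm P 𝕜 S} {C : S →ₗ[Ω →ₘ[P] 𝕜] S} {c : Ω →ₘ[P] ℝ}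
    {s : Set S} (hs : N.IsDense s) (hC : N.IsDense (Set.range C))
    (hc : ∀ z, N (C z) ≤ c * N z) : N.IsDense (C '' s) := by
  refine hC.of_closure ?_
  rintro _ ⟨x, rfl⟩
  obtain ⟨u, hu, hx⟩ := hs.exists_seq x
  exact ⟨fun n => C (u n), fun n => ⟨_, hu n, rfl⟩, hx.map hc⟩

theorem IsDense.ext {N : RandomNorm P 𝕜 S} {T T' : S →ₗ[Ω →ₘ[P] 𝕜] S} {c : Ω →ₘ[P] ℝ}
    {s : Set S} (hs : N.IsDense s) (hT : ∀ z, N (T z) ≤ c * N z) (hT' : ∀ z, N (T' z) ≤ c * N z)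
    (h : ∀ x ∈ s, T x = T' x) : T = T' := by
  ext x
  obtain ⟨u, hu, hx⟩ := hs.exists_seq x
  exact TendsTo.unique (hx.map hT) ((hx.map hT').congr fun n => (h _ (hu n)).symm)

/-- `E k n` is the regularised power `(1 - h a)⁻ⁿ C`, with `h = 2⁻ᵏ`, of the resolvent of the
operator with graph `a`. -/
structure IsEulerScheme (N : RandomNorm P 𝕜 S) (C : S →ₗ[Ω →ₘ[P] 𝕜] S)
    (a : Submodule (Ω →ₘ[P] 𝕜) (S × S)) (M : Ω →ₘ[P] ℝ)
    (E : ℕ → ℕ → (S →ₗ[Ω →ₘ[P] 𝕜] S)) : Prop where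
  zero : ∀ k, E k 0 = C
  succ : ∀ k n x, ∃ y, (E k (n + 1) x, y) ∈ a ∧
    E k (n + 1) x - E k n x = toScalar 𝕜 (mesh P k) • y
  bound : ∀ k n z, N (E k n z) ≤ M * N z
  inj : ∀ k x y, (x, y) ∈ a → x = toScalar 𝕜 (mesh P k) • y → x = 0
  conj : ∀ x y, (x, y) ∈ a ↔ (C x, C y) ∈ a
  dense : N.IsDense {x | ∃ y, (x, y) ∈ a}

namespace IsEulerScheme

variable {N : RandomNorm P 𝕜 S} {C : S →ₗ[Ω →ₘ[P] 𝕜] S}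
  {a : Submodule (Ω →ₘ[P] 𝕜) (S × S)} {M : Ω →ₘ[P] ℝ} {E : ℕ → ℕ → (S →ₗ[Ω →ₘ[P] 𝕜] S)}

section Algebra

variable (hE : N.IsEulerScheme C a M E)
include hE

/-- Injectivity of `1 - h a`. The identities for the scheme below are proved by showing that both
sides solve the same implicit equation. -/
theorem unique {k : ℕ} {u p u' p' : S} (h : (u, p) ∈ a) (h' : (u', p') ∈ a)
    (e : u - toScalar 𝕜 (mesh P k) • p = u' - toScalar 𝕜 (mesh P k) • p') : u = u' := by
  rw [← sub_eq_zero]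
  refine hE.inj k _ (p - p') (a.sub_mem h h') ?_
  rw [_root_.smul_sub]
  exact sub_eq_sub_iff_sub_eq_sub.1 e

theorem map_mem_and_succ (k n : ℕ) {x y : S} (h : (x, y) ∈ a) :
    (E k n x, E k n y) ∈ a ∧
      E k (n + 1) x = E k n x + toScalar 𝕜 (mesh P k) • E k (n + 1) y := by
  -- The candidate `E n x + h E (n + 1) y` is sent by `a` to `E n y + h q = E (n + 1) y`, so `1 - h
  -- a` sends it to `E n x`, which characterises `E (n + 1) x`.
  have step : ∀ n, (E k n x, E k n y) ∈ a →
      (E k n x + toScalar 𝕜 (mesh P k) • E k (n + 1) y, E k (n + 1) y) ∈ a ∧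
      E k (n + 1) x = E k n x + toScalar 𝕜 (mesh P k) • E k (n + 1) y := by
    intro n hn
    obtain ⟨p, hp, ep⟩ := hE.succ k n x
    obtain ⟨q, hq, eq⟩ := hE.succ k n y
    have h1 : (E k n x + toScalar 𝕜 (mesh P k) • E k (n + 1) y, E k (n + 1) y) ∈ a := by
      have := a.add_mem hn (a.smul_mem (toScalar 𝕜 (mesh P k)) hq)
      rwa [Prod.smul_mk, Prod.mk_add_mk, ← eq, add_sub_cancel] at this
    refine ⟨h1, hE.unique hp h1 (k := k) ?_⟩
    rw [← ep]
    abel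
  have mem : ∀ n, (E k n x, E k n y) ∈ a := by
    intro n
    induction n with
    | zero =>
      rw [hE.zero]
      exact (hE.conj x y).1 h
    | succ n ih =>
      obtain ⟨h1, h2⟩ := step n ih
      rw [h2]
      exact h1
  exact ⟨mem n, (step n (mem n)).2⟩

theorem map_mem (k n : ℕ) {x y : S} (h : (x, y) ∈ a) : (E k n x, E k n y) ∈ a :=
  (hE.map_mem_and_succ k n h).1

theorem succ_apply (k n : ℕ) {x y : S} (h : (x, y) ∈ a) :
    E k (n + 1) x = E k n x + toScalar 𝕜 (mesh P k) • E k (n + 1) y :=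
  (hE.map_mem_and_succ k n h).2

theorem apply_C (k n : ℕ) (x : S) : E k n (C x) = C (E k n x) := by
  induction n with
  | zero => rw [hE.zero]
  | succ n ih =>
    obtain ⟨p, hp, ep⟩ := hE.succ k n (C x)
    obtain ⟨q, hq, eq⟩ := hE.succ k n x
    refine hE.unique hp ((hE.conj _ _).1 hq) (k := k) ?_
    rw [← ep, ← LinearMap.map_smul, ← eq, map_sub, ih]
    abel

/-- Each factor contains one `C`, so one `C` remains in front of the combined power; this is the
discrete form of the semigroup law. -/
theorem apply_apply (k n m : ℕ) (x : S) : E k n (E k m x) = C (E k (m + n) x) := by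
  induction n with
  | zero => rw [hE.zero, add_zero]
  | succ n ih =>
    obtain ⟨p, hp, ep⟩ := hE.succ k n (E k m x)
    obtain ⟨q, hq, eq⟩ := hE.succ k (m + n) x
    refine hE.unique hp ((hE.conj _ _).1 hq) (k := k) ?_
    rw [← ep, ← LinearMap.map_smul, ← eq, map_sub, ih, ← add_assoc]
    abel

theorem bound_C (z : S) : N (C z) ≤ M * N z := by
  have := hE.bound 0 0 z
  rwa [hE.zero] at this

theorem bound_two (hM : 0 ≤ M) (k n l m : ℕ) (z : S) :
    N (E k n (E l m z)) ≤ M * M * N z := by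
  rw [mul_assoc]
  exact (hE.bound k n _).trans (mul_le_mul_of_nonneg_left (hE.bound l m z) hM)

/-- On `D(a)` every step moves the vector by `h E y`, hence by at most `h M ‖y‖`. -/
theorem add_sub_le (k n j : ℕ) {x y : S} (h : (x, y) ∈ a) :
    N (E k (n + j) x - E k n x) ≤ AEEqFun.const Ω (j : ℝ) * (mesh P k * (M * N y)) := by
  induction j with
  | zero =>
    rw [add_zero, sub_self, N.map_zero, Nat.cast_zero]
    change _ ≤ 0 * _
    rw [zero_mul]
  | succ j ih =>
    refine (N.sub_le _ (E k (n + j) x) _).trans ?_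
    have e : (AEEqFun.const Ω ((j + 1 : ℕ) : ℝ) : Ω →ₘ[P] ℝ) = 1 + AEEqFun.const Ω (j : ℝ) := by
      rw [Nat.cast_add_one, add_comm]
      rfl
    rw [e, add_mul, one_mul]
    refine add_le_add ?_ ih
    rw [← add_assoc, hE.succ_apply k _ h, add_sub_cancel_left,
      N.real_smul_of_nonneg (mesh_nonneg k)]
    exact mul_le_mul_of_nonneg_left (hE.bound _ _ _) (mesh_nonneg k)

/-- With `h` the finer width, this is `(1 - h a)² - (1 - 2 h a) = h² a²`, multiplied by one more
coarse step and two more fine ones. -/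
theorem halving_one (k i m : ℕ) {x y z : S} (h : (x, y) ∈ a) (h' : (y, z) ∈ a) :
    E k (i + 1) (E (k + 1) m x) - E k i (E (k + 1) (m + 2) x) =
      toScalar 𝕜 (mesh P (k + 1)) • toScalar 𝕜 (mesh P (k + 1)) •
        E k (i + 1) (E (k + 1) (m + 2) z) := by
  have e1 : E (k + 1) (m + 2) x = _ := hE.succ_apply (k + 1) (m + 1) h
  have e2 := hE.succ_apply (k + 1) m h
  have e3 : E (k + 1) (m + 2) y = _ := hE.succ_apply (k + 1) (m + 1) h'
  have e4 := hE.succ_apply k i (hE.map_mem (k + 1) (m + 2) h)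
  have e5 : E (k + 1) m x = E (k + 1) (m + 2) x -
      toScalar 𝕜 (mesh P (k + 1)) • E (k + 1) (m + 2) y -
      toScalar 𝕜 (mesh P (k + 1)) • (E (k + 1) (m + 2) y -
        toScalar 𝕜 (mesh P (k + 1)) • E (k + 1) (m + 2) z) := by
    rw [e1, e2, e3]
    module
  rw [mesh_succ_add, toScalar_add] at e4
  rw [e5, map_sub, map_sub, LinearMap.map_smul, LinearMap.map_smul, map_sub, LinearMap.map_smul,
    e4]
  module

/-- Coarse steps are exchanged one at a time for pairs of fine steps; each exchange costs `h² M²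
‖z‖`, where `z` is `a² x`. -/
theorem halving (hM : 0 ≤ M) (k i m j : ℕ) {x y z : S} (h : (x, y) ∈ a) (h' : (y, z) ∈ a) :
    N (E k (i + j) (E (k + 1) m x) - E k i (E (k + 1) (m + 2 * j) x)) ≤
      AEEqFun.const Ω (j : ℝ) * (mesh P (k + 1) * (mesh P (k + 1) * (M * M * N z))) := by
  induction j generalizing m with
  | zero =>
    rw [add_zero, mul_zero, add_zero, sub_self, N.map_zero, Nat.cast_zero]
    change _ ≤ 0 * _
    rw [zero_mul]
  | succ j ih =>
    refine (N.sub_le _ (E k (i + j) (E (k + 1) (m + 2) x)) _).trans ?_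
    have e : (AEEqFun.const Ω ((j + 1 : ℕ) : ℝ) : Ω →ₘ[P] ℝ) = 1 + AEEqFun.const Ω (j : ℝ) := by
      rw [Nat.cast_add_one, add_comm]
      rfl
    rw [e, add_mul, one_mul]
    refine add_le_add ?_ ?_
    · rw [← add_assoc, hE.halving_one k _ m h h', N.real_smul_of_nonneg (mesh_nonneg _),
        N.real_smul_of_nonneg (mesh_nonneg _)]
      exact mul_le_mul_of_nonneg_left (mul_le_mul_of_nonneg_left (hE.bound_two hM _ _ _ _ _)
        (mesh_nonneg _)) (mesh_nonneg _)
    · have := ih (m + 2)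
      rwa [show m + 2 + 2 * j = m + 2 * (j + 1) by ring] at this

end Algebra

end IsEulerScheme

end RandomNorm

/-! ### Step counts and convergence of the scheme -/

namespace RandomNorm

open L0

variable {Ω : Type*} [MeasurableSpace Ω] {P : Measure Ω} {𝕜 : Type*} [RCLike 𝕜]
  {S : Type*} [AddCommGroup S] [Module (Ω →ₘ[P] 𝕜) S]

/-- The number of steps of width `2⁻ᵏ` that fit into `[0, t]`. -/
noncomputable def steps (k : ℕ) (t : ℝ≥0) : ℕ := ⌊t * 2 ^ k⌋₊

theorem steps_zero (k : ℕ) : steps k 0 = 0 := by simp [steps]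

theorem steps_mono (k : ℕ) {s t : ℝ≥0} (h : s ≤ t) : steps k s ≤ steps k t :=
  Nat.floor_mono (mul_le_mul_left h _)

theorem steps_mul_le (k : ℕ) (t : ℝ≥0) : (steps k t : ℝ) * (1 / 2) ^ k ≤ t := by
  have h : (steps k t : ℝ≥0) ≤ t * 2 ^ k := Nat.floor_le zero_le
  have h' : (steps k t : ℝ) ≤ t * 2 ^ k := by exact_mod_cast h
  rw [one_div, inv_pow, mul_inv_le_iff₀ (by positivity)]
  exact h'

theorem lt_steps_add_one_mul (k : ℕ) (t : ℝ≥0) : (t : ℝ) < (steps k t + 1) * (1 / 2) ^ k := by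
  have h : t * 2 ^ k < (steps k t : ℝ≥0) + 1 := Nat.lt_floor_add_one _
  have h' : (t : ℝ) * 2 ^ k < steps k t + 1 := by exact_mod_cast h
  rw [one_div, inv_pow, lt_mul_inv_iff₀ (by positivity)]
  exact h'

/-- Rounding to the mesh loses at most one step, here and in `steps_add`; on `D(a)` one step costs
only `O(h)`. -/
theorem steps_succ (k : ℕ) (t : ℝ≥0) :
    steps (k + 1) t = 2 * steps k t ∨ steps (k + 1) t = 2 * steps k t + 1 := by
  have h1 : (steps k t : ℝ≥0) ≤ t * 2 ^ k := Nat.floor_le zero_le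
  have h2 : t * 2 ^ k < (steps k t : ℝ≥0) + 1 := Nat.lt_floor_add_one _
  have h3 : 2 * steps k t ≤ steps (k + 1) t := by
    apply Nat.le_floor
    push_cast
    rw [pow_succ, mul_comm 2, ← mul_assoc]
    exact mul_le_mul_left h1 2
  have h4 : steps (k + 1) t < 2 * steps k t + 2 := by
    rw [steps, Nat.floor_lt zero_le]
    push_cast
    calc t * 2 ^ (k + 1) = t * 2 ^ k * 2 := by ring
      _ < (steps k t + 1) * 2 := by gcongr
      _ = _ := by ring
  omega

theorem steps_add (k : ℕ) (s t : ℝ≥0) :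
    steps k (s + t) = steps k s + steps k t ∨ steps k (s + t) = steps k s + steps k t + 1 := by
  have h1 : (steps k t : ℝ≥0) ≤ t * 2 ^ k := Nat.floor_le zero_le
  have h2 : t * 2 ^ k < (steps k t : ℝ≥0) + 1 := Nat.lt_floor_add_one _
  have h1' : (steps k s : ℝ≥0) ≤ s * 2 ^ k := Nat.floor_le zero_le
  have h2' : s * 2 ^ k < (steps k s : ℝ≥0) + 1 := Nat.lt_floor_add_one _
  have h3 : steps k s + steps k t ≤ steps k (s + t) := by
    apply Nat.le_floor
    push_cast
    rw [add_mul]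
    exact add_le_add h1' h1
  have h4 : steps k (s + t) < steps k s + steps k t + 2 := by
    rw [steps, Nat.floor_lt zero_le]
    push_cast
    calc (s + t) * 2 ^ k = s * 2 ^ k + t * 2 ^ k := by ring
      _ < (steps k s + 1) + (steps k t + 1) := add_lt_add h2' h2
      _ = _ := by ring
  omega

theorem const_mul_mesh (c : ℝ) (k : ℕ) :
    AEEqFun.const Ω c * mesh P k = AEEqFun.const Ω (c * (1 / 2) ^ k) := rfl

variable [IsProbabilityMeasure P]

namespace IsEulerScheme

variable {N : RandomNorm P 𝕜 S} {C : S →ₗ[Ω →ₘ[P] 𝕜] S}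
  {a : Submodule (Ω →ₘ[P] 𝕜) (S × S)} {M : Ω →ₘ[P] ℝ} {E : ℕ → ℕ → (S →ₗ[Ω →ₘ[P] 𝕜] S)}

section Limit

variable (hE : N.IsEulerScheme C a M E)
include hE

theorem add_one_sub_le (hM : 0 ≤ M) {k m n : ℕ} (hmn : m = n ∨ m = n + 1) {x y : S}
    (h : (x, y) ∈ a) : N (E k m x - E k n x) ≤ mesh P k * (M * N y) := by
  rcases hmn with rfl | rfl
  · rw [sub_self, N.map_zero]
    exact mul_nonneg (mesh_nonneg k) (mul_nonneg hM (N.nonneg y))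
  · have := hE.add_sub_le k n 1 h
    rwa [Nat.cast_one, const_one, one_mul] at this

/-- Inserting `2 * steps k t` fine steps separates a rounding error of at most one step from the
halving error, which is at most `t` times the mesh width. The argument is `C x` because `halving`
compares products of two regularised powers. -/
theorem steps_succ_sub_le (hM : 0 ≤ M) (t : ℝ≥0) (k : ℕ) {x y z : S} (h : (x, y) ∈ a)
    (h' : (y, z) ∈ a) :
    N (E (k + 1) (steps (k + 1) t) (C x) - E k (steps k t) (C x)) ≤
      mesh P k * (M * M * (N y + AEEqFun.const Ω (t : ℝ) * N z)) := by
  refine (N.sub_le _ (E (k + 1) (2 * steps k t) (C x)) _).trans ?_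
  have hle : mesh P (k + 1) ≤ mesh P k := by
    rw [mesh_succ_add k]
    exact le_add_of_nonneg_left (mesh_nonneg _)
  rw [mul_add, mul_add]
  refine add_le_add ?_ ?_
  · rw [hE.apply_C, hE.apply_C, ← map_sub]
    refine (hE.bound_C _).trans ?_
    calc _ ≤ M * (mesh P (k + 1) * (M * N y)) :=
          mul_le_mul_of_nonneg_left (hE.add_one_sub_le hM (steps_succ k t) h) hM
      _ = mesh P (k + 1) * (M * M * N y) := by ring
      _ ≤ _ := mul_le_mul_of_nonneg_right hle (mul_nonneg (mul_nonneg hM hM) (N.nonneg y))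
  · have h1 := hE.halving hM k 0 0 (steps k t) h h'
    rw [zero_add, zero_add, hE.zero, hE.zero, N.sub_comm, ← hE.apply_C] at h1
    refine h1.trans ?_
    have hz : 0 ≤ M * M * N z := mul_nonneg (mul_nonneg hM hM) (N.nonneg z)
    have ht : AEEqFun.const Ω (steps k t : ℝ) * mesh P (k + 1) ≤ AEEqFun.const Ω (t : ℝ) :=
      (mul_le_mul_of_nonneg_left hle (const_nonneg (Nat.cast_nonneg _))).trans
        (const_mono (steps_mul_le k t))
    calc _ = (AEEqFun.const Ω (steps k t : ℝ) * mesh P (k + 1)) *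
          (mesh P (k + 1) * (M * M * N z)) := by ring
      _ ≤ AEEqFun.const Ω (t : ℝ) * (mesh P k * (M * M * N z)) :=
        mul_le_mul ht (mul_le_mul_of_nonneg_right hle hz) (mul_nonneg (mesh_nonneg _) hz)
          (const_nonneg t.coe_nonneg)
      _ = _ := by ring

/-- One Euler step maps `D(a)` into `D(a²)`, and `E k 1 x → C x` for `x ∈ D(a)`; the set `C D(a)` is
dense. -/
theorem dense_domain_sq (hC : N.IsDense (Set.range C)) :
    N.IsDense {x | ∃ y z, (x, y) ∈ a ∧ (y, z) ∈ a} := by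
  refine (hE.dense.image hC hE.bound_C).of_closure ?_
  rintro _ ⟨x, ⟨y, hy⟩, rfl⟩
  refine ⟨fun k => E k 1 x, fun k => ?_, ?_⟩
  · obtain ⟨q, hq, -⟩ := hE.succ k 0 y
    exact ⟨E k 1 y, q, hE.map_mem k 1 hy, hq⟩
  · refine tendsTo_of_le (tendsto_probNorm_mesh_mul (M * N y)) (Eventually.of_forall fun k => ?_)
    have := hE.add_sub_le k 0 1 hy
    rwa [zero_add, hE.zero, Nat.cast_one, const_one, one_mul] at this

theorem exists_tendsTo (hS : N.IsComplete) (hM : 0 ≤ M) (hC : N.IsDense (Set.range C))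
    (t : ℝ≥0) (x : S) : ∃ y, N.TendsTo (fun k => E k (steps k t) x) atTop y := by
  apply N.exists_tendsTo_of_cauchy hS
  intro r hr
  -- The argument is first replaced by some `C v` with `v ∈ D(a²)`; the uniform bound `M` makes this
  -- cost at most `r / 4` at every level `k`.
  obtain ⟨u, hu, hx⟩ := ((hE.dense_domain_sq hC).image hC hE.bound_C).exists_seq x
  obtain ⟨i, hi⟩ := ((tendsto_probNorm_mul M (tendsTo_iff.1 hx)).eventually
    (gt_mem_nhds (show 0 < r / 4 by linarith))).exists
  obtain ⟨v, ⟨y, z, hy, hz⟩, hv⟩ := hu i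
  rw [← hv, N.sub_comm] at hi
  set B := M * M * (N y + AEEqFun.const Ω (t : ℝ) * N z) with hB
  have hB0 : 0 ≤ B := mul_nonneg (mul_nonneg hM hM)
    (add_nonneg (N.nonneg y) (mul_nonneg (const_nonneg t.coe_nonneg) (N.nonneg z)))
  -- The right side is the partial geometric sum of the meshes from level `k` to level `k + j - 1`,
  -- written so that it telescopes.
  have tele : ∀ k j, N (E (k + j) (steps (k + j) t) (C v) - E k (steps k t) (C v)) ≤
      (mesh P k + mesh P k - (mesh P (k + j) + mesh P (k + j))) * B := by
    intro k j
    induction j with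
    | zero => rw [add_zero, sub_self, N.map_zero, sub_self, zero_mul]
    | succ j ih =>
      refine (N.sub_le _ (E (k + j) (steps (k + j) t) (C v)) _).trans
        ((add_le_add (hE.steps_succ_sub_le hM t (k + j) hy hz) ih).trans_eq ?_)
      rw [← hB, ← add_assoc k j 1, mesh_succ_add (k + j)]
      ring
  have tele' : ∀ k j, N (E (k + j) (steps (k + j) t) (C v) - E k (steps k t) (C v)) ≤
      mesh P k * (B + B) := by
    intro k j
    refine (tele k j).trans ?_
    have h1 : 0 ≤ (mesh P (k + j) + mesh P (k + j)) * B :=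
      mul_nonneg (add_nonneg (mesh_nonneg _) (mesh_nonneg _)) hB0
    calc _ = mesh P k * (B + B) - (mesh P (k + j) + mesh P (k + j)) * B := by ring
      _ ≤ _ := sub_le_self _ h1
  obtain ⟨K, hK⟩ := ((tendsto_probNorm_mesh_mul (B + B)).eventually
    (gt_mem_nhds (show 0 < r / 4 by linarith))).exists
  have hfar : ∀ m ≥ K, probNorm (N (E m (steps m t) x - E K (steps K t) (C v))) < r / 2 := by
    intro m hm
    obtain ⟨j, rfl⟩ := Nat.exists_eq_add_of_le hm
    have h1 := probNorm_mono (N.nonneg _) (tele' K j)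
    have h2 := N.probNorm_sub_le (E (K + j) (steps (K + j) t) x)
      (E (K + j) (steps (K + j) t) (C v)) (E K (steps K t) (C v))
    rw [← map_sub] at h2
    have h3 := probNorm_mono (N.nonneg _) (hE.bound (K + j) (steps (K + j) t) (x - C v))
    linarith
  refine ⟨K, fun m hm n hn => ?_⟩
  have h1 := N.probNorm_sub_le (E m (steps m t) x) (E K (steps K t) (C v)) (E n (steps n t) x)
  rw [N.sub_comm (E K _ _)] at h1
  linarith [hfar m hm, hfar n hn]

/-- The limit of the Euler scheme. -/
theorem exists_limit (hS : N.IsComplete) (hM : 0 ≤ M) (hC : N.IsDense (Set.range C)) :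
    ∃ W : ℝ≥0 → (S →ₗ[Ω →ₘ[P] 𝕜] S), ∀ t x,
      N.TendsTo (fun k => E k (steps k t) x) atTop (W t x) := by
  choose w hw using hE.exists_tendsTo hS hM hC
  refine ⟨fun t => ⟨⟨w t, fun x y => ?_⟩, fun ζ x => ?_⟩, fun t x => hw t x⟩
  · refine TendsTo.unique (hw t (x + y)) (((hw t x).add (hw t y)).congr fun k => ?_)
    rw [_root_.map_add]
  · refine TendsTo.unique (hw t (ζ • x)) ((TendsTo.scalar_smul ζ (hw t x)).congr fun k => ?_)
    rw [LinearMap.map_smul]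

/-- The steps between `s` and `t` have total length at most `t - s + h`; the extra `h` is the
rounding. -/
theorem steps_sub_le (hM : 0 ≤ M) {s t : ℝ≥0} (hst : s ≤ t) (k : ℕ) {x y : S}
    (h : (x, y) ∈ a) :
    N (E k (steps k t) x - E k (steps k s) x) ≤
      AEEqFun.const Ω ((t : ℝ) - s) * (M * N y) + mesh P k * (M * N y) := by
  obtain ⟨j, hj⟩ := Nat.exists_eq_add_of_le (steps_mono k hst)
  have h1 := hE.add_sub_le k (steps k s) j h
  rw [hj]
  refine h1.trans ?_
  rw [← mul_assoc, ← add_mul]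
  refine mul_le_mul_of_nonneg_right ?_ (mul_nonneg hM (N.nonneg y))
  change AEEqFun.const Ω ((j : ℝ) * (1 / 2) ^ k) ≤
    AEEqFun.const Ω ((t : ℝ) - s + (1 / 2) ^ k)
  apply const_mono
  have h2 := steps_mul_le k t
  have h3 := lt_steps_add_one_mul k s
  rw [hj] at h2
  push_cast at h2
  linarith

/-- A first-order Taylor estimate: the left side is the sum of `h (E j y - C y)`. Since `y` need not
lie in `D(a)`, it is approximated by `y'`, to which the Lipschitz estimate in time applies. -/
theorem sub_sub_smul_le (hM : 0 ≤ M) (k n : ℕ) {t : ℝ≥0} (hn : (n : ℝ) * (1 / 2) ^ k ≤ t)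
    {x y y' z' : S} (h : (x, y) ∈ a) (h' : (y', z') ∈ a) :
    N (E k n x - C x -
      toScalar 𝕜 (AEEqFun.const Ω ((n : ℝ) * (1 / 2) ^ k) : Ω →ₘ[P] ℝ) • C y) ≤
      AEEqFun.const Ω ((n : ℝ) * (1 / 2) ^ k) *
        (M * N (y - y') + M * N (y - y') + AEEqFun.const Ω (t : ℝ) * (M * N z')) := by
  induction n with
  | zero =>
    rw [hE.zero, sub_self, zero_sub, Nat.cast_zero, zero_mul]
    have h0 : toScalar 𝕜 (AEEqFun.const Ω (0 : ℝ) : Ω →ₘ[P] ℝ) • C y = 0 := by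
      refine Eq.trans ?_ (zero_smul (Ω →ₘ[P] 𝕜) (C y))
      exact congrArg (· • C y) toScalar_zero
    rw [h0, neg_zero, N.map_zero]
    exact (zero_mul _).ge
  | succ n ih =>
    have hn' : (n : ℝ) * (1 / 2) ^ k ≤ t := by
      refine le_trans (mul_le_mul_of_nonneg_right ?_ (by positivity)) hn
      push_cast
      linarith
    have e : (AEEqFun.const Ω (((n + 1 : ℕ) : ℝ) * (1 / 2) ^ k) : Ω →ₘ[P] ℝ) =
        mesh P k + AEEqFun.const Ω ((n : ℝ) * (1 / 2) ^ k) := by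
      change _ = (AEEqFun.const Ω ((1 / 2) ^ k + (n : ℝ) * (1 / 2) ^ k) : Ω →ₘ[P] ℝ)
      congr 1
      push_cast
      ring
    have e1 : E k (n + 1) x - C x -
        toScalar 𝕜 (AEEqFun.const Ω (((n + 1 : ℕ) : ℝ) * (1 / 2) ^ k) : Ω →ₘ[P] ℝ) • C y =
          toScalar 𝕜 (mesh P k) • (E k (n + 1) (y - y') + (E k (n + 1) y' - C y') +
          C (y' - y)) + (E k n x - C x -
            toScalar 𝕜 (AEEqFun.const Ω ((n : ℝ) * (1 / 2) ^ k) : Ω →ₘ[P] ℝ) • C y) := by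
      rw [e, hE.succ_apply k n h, toScalar_add, map_sub, map_sub]
      module
    rw [e1, e, add_mul]
    refine (N.add_le _ _).trans (add_le_add ?_ (ih hn'))
    rw [N.real_smul_of_nonneg (mesh_nonneg k)]
    refine mul_le_mul_of_nonneg_left ?_ (mesh_nonneg k)
    have h1 := hE.bound k (n + 1) (y - y')
    have h2 := hE.add_sub_le k 0 (n + 1) h'
    rw [zero_add, hE.zero, ← mul_assoc] at h2
    have h2' := h2.trans (mul_le_mul_of_nonneg_right
      (const_mono hn) (mul_nonneg hM (N.nonneg z')))
    have h3 := hE.bound_C (y' - y)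
    rw [N.sub_comm y' y] at h3
    calc _ ≤ N (E k (n + 1) (y - y')) + N (E k (n + 1) y' - C y') + N (C (y' - y)) :=
          (N.add_le _ _).trans (add_le_add_left (N.add_le _ _) _)
      _ ≤ M * N (y - y') + AEEqFun.const Ω (t : ℝ) * (M * N z') + M * N (y - y') :=
        add_le_add (add_le_add h1 h2') h3
      _ = _ := by ring

end Limit

end IsEulerScheme

end RandomNorm

/-! ### The limit of the scheme and its generator -/

namespace RandomNorm

open L0

variable {Ω : Type*} [MeasurableSpace Ω] {P : Measure Ω} {𝕜 : Type*} [RCLike 𝕜]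
  {S : Type*} [AddCommGroup S] [Module (Ω →ₘ[P] 𝕜) S] [IsProbabilityMeasure P]
  {N : RandomNorm P 𝕜 S} {C : S →ₗ[Ω →ₘ[P] 𝕜] S}
  {a : Submodule (Ω →ₘ[P] 𝕜) (S × S)} {M : Ω →ₘ[P] ℝ} {E : ℕ → ℕ → (S →ₗ[Ω →ₘ[P] 𝕜] S)}
  {W : ℝ≥0 → (S →ₗ[Ω →ₘ[P] 𝕜] S)}

namespace IsEulerScheme

variable (hE : N.IsEulerScheme C a M E)
  (hW : ∀ t x, N.TendsTo (fun k => E k (steps k t) x) atTop (W t x))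
include hE hW

theorem limit_bound (t : ℝ≥0) (x : S) : N (W t x) ≤ M * N x :=
  (hW t x).le_of_le (Eventually.of_forall fun k => hE.bound k _ x)

theorem limit_sub_le (hM : 0 ≤ M) {s t : ℝ≥0} (hst : s ≤ t) {x y : S} (h : (x, y) ∈ a) :
    N (W t x - W s x) ≤ AEEqFun.const Ω ((t : ℝ) - s) * (M * N y) :=
  ((hW t x).sub (hW s x)).le_of_le_add (tendsto_probNorm_mesh_mul (M * N y))
    (Eventually.of_forall fun k => hE.steps_sub_le hM hst k h)

theorem limit_continuous (hM : 0 ≤ M) (x : S) :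
    @Continuous ℝ≥0 S _ N.topology (fun s => W s x) := by
  rw [continuous_iff]
  intro s
  refine hE.dense.tendsTo_of_bound (T := W) (T' := W s) (B := M)
    (Eventually.of_forall fun t z => hE.limit_bound hW t z) (hE.limit_bound hW s) ?_ x
  rintro x ⟨y, h⟩
  have hc : Tendsto (fun t : ℝ≥0 => |(t : ℝ) - s|) (𝓝 s) (𝓝 0) := by
    have : Continuous fun t : ℝ≥0 => |(t : ℝ) - s| := by fun_prop
    simpa using this.tendsto s
  refine tendsTo_of_le (tendsto_probNorm_const_mul (M * N y) hc)
    (Eventually.of_forall fun t => ?_)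
  rcases le_total s t with hst | hst
  · rw [abs_of_nonneg (sub_nonneg.2 (NNReal.coe_le_coe.2 hst))]
    exact hE.limit_sub_le hW hM hst h
  · rw [abs_of_nonpos (sub_nonpos.2 (NNReal.coe_le_coe.2 hst)), neg_sub, N.sub_comm]
    exact hE.limit_sub_le hW hM hst h

theorem limit_add (hM : 0 ≤ M) (s t : ℝ≥0) : C ∘ₗ W (s + t) = W t ∘ₗ W s := by
  refine hE.dense.ext (c := M * M) (fun z => ?_) (fun z => ?_) ?_
  · rw [mul_assoc]
    exact (hE.bound_C _).trans (mul_le_mul_of_nonneg_left (hE.limit_bound hW _ z) hM)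
  · rw [mul_assoc]
    exact (hE.limit_bound hW _ _).trans (mul_le_mul_of_nonneg_left (hE.limit_bound hW _ z) hM)
  rintro x ⟨y, h⟩
  have h1 : N.TendsTo (fun k => C (E k (steps k (s + t)) x)) atTop (C (W (s + t) x)) :=
    (hW (s + t) x).map hE.bound_C
  -- The inner and the outer limit may be taken together because the operators have the common bound
  -- `M`.
  have h2 : N.TendsTo (fun k => E k (steps k t) (E k (steps k s) x)) atTop (W t (W s x)) := by
    have h3 : N.TendsTo (fun k => E k (steps k t) (E k (steps k s) x - W s x)) atTop 0 := by
      refine tendsTo_of_le (tendsto_probNorm_mul M (tendsTo_iff.1 (hW s x)))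
        (Eventually.of_forall fun k => ?_)
      rw [sub_zero]
      exact hE.bound _ _ _
    have h4 := h3.add (hW t (W s x))
    rw [zero_add] at h4
    refine h4.congr fun k => ?_
    rw [map_sub, sub_add_cancel]
  -- `steps k (s + t)` and `steps k s + steps k t` differ by at most one step.
  have h3 : N.TendsTo (fun k => C (E k (steps k (s + t)) x) -
      E k (steps k t) (E k (steps k s) x)) atTop 0 := by
    refine tendsTo_of_le (tendsto_probNorm_mesh_mul (M * (M * N y)))
      (Eventually.of_forall fun k => ?_)
    rw [sub_zero, hE.apply_apply, ← map_sub]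
    refine (hE.bound_C _).trans ((mul_le_mul_of_nonneg_left
      (hE.add_one_sub_le hM (steps_add k s t) h) hM).trans_eq ?_)
    ring
  have h4 := (h1.sub h2).unique h3
  exact sub_eq_zero.1 h4

theorem limit_zero : W 0 = C := by
  ext x
  refine (hW 0 x).unique ((N.tendsTo_const (C x)).congr fun k => ?_)
  rw [steps_zero, hE.zero]

theorem limit_isCSemigroup (hM : 0 ≤ M) : N.IsCSemigroup C W where
  bounded s := ⟨M, hM, hE.limit_bound hW s⟩
  map_add := hE.limit_add hW hM
  map_zero := hE.limit_zero hW
  continuous := hE.limit_continuous hW hM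

theorem limit_sub_sub_smul_le (hM : 0 ≤ M) (t : ℝ≥0) {x y y' z' : S} (h : (x, y) ∈ a)
    (h' : (y', z') ∈ a) :
    N (W t x - C x - toScalar 𝕜 (AEEqFun.const Ω (t : ℝ) : Ω →ₘ[P] ℝ) • C y) ≤
      AEEqFun.const Ω (t : ℝ) *
        (M * N (y - y') + M * N (y - y') + AEEqFun.const Ω (t : ℝ) * (M * N z')) := by
  have h1 := ((hW t x).sub (N.tendsTo_const (C x))).sub
    (N.tendsTo_const (toScalar 𝕜 (AEEqFun.const Ω (t : ℝ) : Ω →ₘ[P] ℝ) • C y))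
  refine h1.le_of_le_add (tendsto_probNorm_mesh_mul (M * N y)) (Eventually.of_forall fun k => ?_)
  have h2 := hE.sub_sub_smul_le hM k (steps k t) (steps_mul_le k t) h h'
  set c : ℝ := (steps k t : ℝ) * (1 / 2) ^ k with hc
  have e : E k (steps k t) x - C x - toScalar 𝕜 (AEEqFun.const Ω (t : ℝ) : Ω →ₘ[P] ℝ) • C y =
      (E k (steps k t) x - C x - toScalar 𝕜 (AEEqFun.const Ω c : Ω →ₘ[P] ℝ) • C y) -
        -- The discretised time `c` falls short of `t` by less than one mesh width.
        toScalar 𝕜 (AEEqFun.const Ω ((t : ℝ) - c) : Ω →ₘ[P] ℝ) • C y := by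
    have : (AEEqFun.const Ω ((t : ℝ) - c) : Ω →ₘ[P] ℝ) =
      AEEqFun.const Ω (t : ℝ) - AEEqFun.const Ω c := rfl
    rw [this, toScalar_sub]
    module
  have hct : c ≤ t := steps_mul_le k t
  have hX : 0 ≤ M * N (y - y') + M * N (y - y') + AEEqFun.const Ω (t : ℝ) * (M * N z') :=
    add_nonneg (add_nonneg (mul_nonneg hM (N.nonneg _)) (mul_nonneg hM (N.nonneg _)))
      (mul_nonneg (const_nonneg t.coe_nonneg) (mul_nonneg hM (N.nonneg _)))
  rw [e]
  refine (N.sub_le_add _ _).trans (add_le_add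
    (h2.trans (mul_le_mul_of_nonneg_right (const_mono hct) hX)) ?_)
  rw [N.real_smul_of_nonneg (const_nonneg (sub_nonneg.2 hct))]
  refine mul_le_mul (const_mono ?_) (hE.bound_C y) (N.nonneg _) (mesh_nonneg k)
  have := lt_steps_add_one_mul k t
  rw [add_mul, ← hc] at this
  linarith

theorem limit_generates (hM : 0 ≤ M) {x y : S} (h : (x, y) ∈ a) : N.Generates C W x y := by
  rw [Generates, tendsTo_iff, Metric.tendsto_nhds]
  intro r hr
  -- After division by `t`, the Taylor error is `2 M ‖y - u n‖ + t M ‖z'‖`: first `u n ∈ D(a)` is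
  -- fixed close to `y`, then `t` is made small.
  obtain ⟨u, hu, hy⟩ := hE.dense.exists_seq y
  obtain ⟨n, hn⟩ := ((tendsto_probNorm_mul M (tendsTo_iff.1 hy)).eventually
    (gt_mem_nhds (show 0 < r / 4 by linarith))).exists
  obtain ⟨z', hz'⟩ := hu n
  rw [N.sub_comm] at hn
  have hc : Tendsto (fun t : ℝ≥0 => (t : ℝ)) (𝓝[>] 0) (𝓝 0) :=
    (NNReal.continuous_coe.tendsto' 0 0 rfl).mono_left nhdsWithin_le_nhds
  filter_upwards [(tendsto_probNorm_const_mul (M * N z') hc).eventually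
    (gt_mem_nhds (show 0 < r / 4 by linarith)), self_mem_nhdsWithin] with t ht ht0
  rw [Real.dist_eq, sub_zero, abs_of_nonneg (probNorm_nonneg _)]
  have ht' : (t : ℝ) ≠ 0 := (NNReal.coe_pos.2 ht0).ne'
  have e : diffQuot C W x t - C y = toScalar 𝕜 (AEEqFun.const Ω (t : ℝ)⁻¹ : Ω →ₘ[P] ℝ) •
      (W t x - C x - toScalar 𝕜 (AEEqFun.const Ω (t : ℝ) : Ω →ₘ[P] ℝ) • C y) := by
    rw [diffQuot_eq, _root_.smul_sub _ (W t x - C x), smul_smul, ← toScalar_mul, ← const_mul_const,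
      inv_mul_cancel₀ ht', const_one, toScalar_one, one_smul]
  have h1 : N (diffQuot C W x t - C y) ≤
      M * N (y - u n) + M * N (y - u n) + AEEqFun.const Ω (t : ℝ) * (M * N z') := by
    rw [e, N.real_smul_of_nonneg (const_nonneg (inv_nonneg.2 t.coe_nonneg))]
    refine (mul_le_mul_of_nonneg_left (hE.limit_sub_sub_smul_le hW hM t h hz')
      (const_nonneg (inv_nonneg.2 t.coe_nonneg))).trans_eq ?_
    rw [← mul_assoc, ← const_mul_const, inv_mul_cancel₀ ht', const_one, one_mul]
  have h2 := probNorm_mono (N.nonneg _) h1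
  have h3 := probNorm_add_le (M * N (y - u n) + M * N (y - u n))
    (AEEqFun.const Ω (t : ℝ) * (M * N z'))
  have h4 := probNorm_add_le (M * N (y - u n)) (M * N (y - u n))
  linarith

/-- With mesh `1`, the vector `E 0 1 (x - y)` is `(1 - a)⁻¹ C (x - y)`. Its difference from `C x` is
an eigenvector of the generator for the eigenvalue `1`, which boundedness of `W` forces to be `0`.
Hence `C x ∈ D(a)` with image `C y`, and `conj` cancels `C`. -/
theorem mem_of_limit_generates (hM : 0 ≤ M) (hC : Function.Injective C) {x y : S}
    (h : N.Generates C W x y) : (x, y) ∈ a := by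
  have hsg := hE.limit_isCSemigroup hW hM
  have e0 : toScalar 𝕜 (mesh P 0) = 1 := by
    rw [mesh, pow_zero, const_one, toScalar_one]
  obtain ⟨p, hp, ep⟩ := hE.succ 0 0 (x - y)
  rw [e0, one_smul, hE.zero, map_sub C] at ep
  have h1 := (hsg.generates_map h).sub (hE.limit_generates hW hM hp)
  have e1 : C y - p = C x - E 0 (0 + 1) (x - y) := by
    rw [← ep]
    abel
  rw [e1] at h1
  -- Damping by `e ^ (-s)` turns the eigenvalue `1` into `0`.
  have h2 := h1.rescale (-1 : Ω →ₘ[P] ℝ)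
  rw [toScalar_neg, toScalar_one, neg_smul, one_smul, add_neg_cancel] at h2
  have h3 : C x - E 0 (0 + 1) (x - y) = 0 := by
    refine (hsg.rescale (-1)).eq_zero_of_generates_zero (M := M) (δ := 1) hC hM ?_ ?_ h2
    · filter_upwards [coeFn_one' (P := P) (R := ℝ)] with ω hω
      rw [hω]
      exact one_pos
    · intro s z
      have := rescale_le (N := N) (M := M) (ξ := 0) (W := W) (s := s) (fun z => by
        rw [zero_mul, exp_zero, mul_one]
        exact hE.limit_bound hW s z) (-1) z
      rwa [zero_add] at this
  rw [hE.conj, sub_eq_zero.1 h3]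
  have e2 : C y = p := by
    rw [h3] at e1
    exact sub_eq_zero.1 e1
  rw [e2]
  exact hp

omit hW in
/-- The Euler scheme converges to a `C`-semigroup generated by `a`. -/
theorem exists_semigroup (hS : N.IsComplete) (hM : 0 ≤ M) (hCinj : Function.Injective C)
    (hC : N.IsDense (Set.range C)) :
    ∃ W : ℝ≥0 → (S →ₗ[Ω →ₘ[P] 𝕜] S), N.IsCSemigroup C W ∧ (∀ s z, N (W s z) ≤ M * N z) ∧
      ∀ x y, (x, y) ∈ a ↔ N.Generates C W x y := by
  obtain ⟨W, hW⟩ := hE.exists_limit hS hM hC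
  exact ⟨W, hE.limit_isCSemigroup hW hM, hE.limit_bound hW, fun x y =>
    ⟨hE.limit_generates hW hM, hE.mem_of_limit_generates hW hM hCinj⟩⟩

end IsEulerScheme

end RandomNorm

/-! ### From resolvent estimates to the semigroup -/

namespace RandomNorm

open L0 PartialOp

variable {Ω : Type*} [MeasurableSpace Ω] {P : Measure Ω} {𝕜 : Type*} [RCLike 𝕜]
  {S : Type*} [AddCommGroup S] [Module (Ω →ₘ[P] 𝕜) S]

/-- The graph of `A - ξ`. -/
noncomputable def subGraph (A : S →ₗ.[Ω →ₘ[P] 𝕜] S) (ξ : Ω →ₘ[P] 𝕜) :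
    Submodule (Ω →ₘ[P] 𝕜) (S × S) :=
  A.graph.comap ((LinearMap.fst _ S S).prod (LinearMap.snd _ S S + ξ • LinearMap.fst _ S S))

theorem mem_subGraph {A : S →ₗ.[Ω →ₘ[P] 𝕜] S} {ξ : Ω →ₘ[P] 𝕜} {x y : S} :
    (x, y) ∈ subGraph A ξ ↔ (x, y + ξ • x) ∈ A.graph := Iff.rfl

/-- The inverse mesh width `2ᵏ` as a random variable. -/
noncomputable def rate (P : Measure Ω) (k : ℕ) : Ω →ₘ[P] ℝ := AEEqFun.const Ω ((2 : ℝ) ^ k)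

theorem rate_mul_mesh (k : ℕ) : rate P k * mesh P k = 1 := by
  rw [rate, const_mul_mesh, ← mul_pow]
  norm_num
  rfl

theorem rate_pow_mul_inv_pow (k n : ℕ) :
    (rate P k) ^ n * inv (rate P k) ^ n
      = 1 := by
  rw [← mul_pow, mul_comm, L0.inv_mul_cancel, one_pow]
  filter_upwards [coeFn_const' (P := P) ((2 : ℝ) ^ k)] with ω h
  rw [rate, h]
  positivity

theorem strictLT_add_const (ξ : Ω →ₘ[P] ℝ) {c : ℝ} (hc : 0 < c) :
    StrictLT ξ (ξ + AEEqFun.const Ω c) := by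
  rw [strictLT_iff_sub, add_sub_cancel_left]
  filter_upwards [coeFn_const' (P := P) c] with ω h
  rwa [h]

variable [IsProbabilityMeasure P]

/-- Only the values `η = ξ + 2ᵏ` are needed. The powers `2ᵏⁿ (η - A)⁻ⁿ C` are the Euler scheme of `A
- ξ` with bound `M`; its limit semigroup is rescaled by `e ^ (ξ s)` to recover `A`. -/
theorem exists_generated_semigroup (N : RandomNorm P 𝕜 S) (hS : N.IsComplete)
    {C : S →ₗ[Ω →ₘ[P] 𝕜] S} (hC : N.IsBoundedHom C) (hCinj : Function.Injective C)
    (hCdense : N.IsDense (Set.range C)) {A : S →ₗ.[Ω →ₘ[P] 𝕜] S} {M ξ : Ω →ₘ[P] ℝ} (hM : 0 ≤ M)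
    (hdense : N.IsDense (A.domain : Set S))
    (hres : ∀ η : Ω →ₘ[P] ℝ, StrictLT ξ η → toScalar 𝕜 η ∈ cResolventSet C A)
    (hpow : ∀ η : Ω →ₘ[P] ℝ, StrictLT ξ η → ∀ n : ℕ, 1 ≤ n →
      ∃ h : LinearMap.range C ≤ (invPow (shift (toScalar 𝕜 η) A) n).domain,
        N.OpNormLE (compOfRangeLE (invPow (shift (toScalar 𝕜 η) A) n) C h)
          (M * L0.inv (η - ξ) ^ n))
    (hconj : A.graph = conjGraph C A) :
    ∃ W : ℝ≥0 → (S →ₗ[Ω →ₘ[P] 𝕜] S), N.MemH C M ξ W ∧ N.IsGenerator C W A := by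
  have hlt : ∀ k : ℕ, StrictLT ξ (ξ + rate P k) := fun k =>
    strictLT_add_const ξ (by positivity)
  have hinj : ∀ k : ℕ, Function.Injective
      (shift (toScalar 𝕜 (ξ + rate P k)) A) := fun k => (hres _ (hlt k)).1
  have hT : ∀ k n : ℕ, ∃ T : S →ₗ[Ω →ₘ[P] 𝕜] S,
      (∀ x, (C x, T x) ∈
        (invPow (shift (toScalar 𝕜 (ξ + rate P k)) A) n).graph) ∧
      (1 ≤ n → ∀ z, N (T z) ≤ M * L0.inv (rate P k) ^ n * N z) := by
    intro k n
    rcases n with _ | n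
    · exact ⟨C, fun x => mem_graph_invPow_zero.2 rfl, fun h => absurd h (by norm_num)⟩
    · obtain ⟨h, hb⟩ := hpow _ (hlt k) (n + 1) (by omega)
      refine ⟨_, mem_graph_compOfRangeLE h, fun _ z => ?_⟩
      have := hb.le z
      rwa [add_sub_cancel_left] at this
  choose T hTg hTb using hT
  have hT0 : ∀ k, T k 0 = C := fun k => by
    ext x
    exact (mem_graph_invPow_zero.1 (hTg k 0 x)).symm
  have hTs : ∀ k n x, (T k (n + 1) x, toScalar 𝕜 (ξ + rate P k) •
      T k (n + 1) x - T k n x) ∈ A.graph := by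
    intro k n x
    obtain ⟨y, h1, h2⟩ := (mem_graph_invPow_succ (hinj k)).1 (hTg k (n + 1) x)
    rw [LinearPMap.mem_graph_snd_inj _ h1 (hTg k n x) rfl, mem_graph_shift] at h2
    exact h2
  let E : ℕ → ℕ → (S →ₗ[Ω →ₘ[P] 𝕜] S) := fun k n =>
    toScalar 𝕜 (rate P k ^ n) • T k n
  have hEn : ∀ k n, 1 ≤ n → ∀ z, N (E k n z) ≤ M * N z := by
    intro k n hn z
    have h0 : (0 : Ω →ₘ[P] ℝ) ≤ rate P k ^ n :=
      pow_nonneg (const_nonneg (by positivity)) n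
    change N (toScalar 𝕜 (rate P k ^ n) • T k n z) ≤ _
    rw [N.real_smul_of_nonneg h0]
    refine (mul_le_mul_of_nonneg_left (hTb k n hn z) h0).trans_eq ?_
    calc _ = M * (rate P k ^ n *
          L0.inv (rate P k) ^ n) * N z := by ring
      _ = _ := by rw [rate_pow_mul_inv_pow, mul_one]
  have hE0 : ∀ k, E k 0 = C := fun k => by
    ext x
    change toScalar 𝕜 (rate P k ^ 0) • T k 0 x = C x
    rw [pow_zero, toScalar_one, one_smul, hT0]
  -- The resolvent estimates start at `n = 1`, so the bound `M` for `E k 0 = C` is not yet known.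
  -- The scheme is used once with a larger bound `B`, to prove it, and then with `M`.
  have hscheme : ∀ B : Ω →ₘ[P] ℝ, M ≤ B → (∀ z, N (C z) ≤ B * N z) →
      N.IsEulerScheme C (subGraph A (toScalar 𝕜 ξ)) B E := by
    intro B hMB hCB
    refine ⟨hE0, fun k n x => ?_, fun k n z => ?_, fun k x y hxy e => ?_, fun x y => ?_, ?_⟩
    · refine ⟨toScalar 𝕜 (rate P k) • (E k (n + 1) x - E k n x), ?_, ?_⟩
      · rw [mem_subGraph]
        have h1 := A.graph.smul_mem (toScalar 𝕜 (rate P k ^ (n + 1)))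
          (hTs k n x)
        rw [Prod.smul_mk] at h1
        refine (congrArg (fun v => (E k (n + 1) x, v) ∈ A.graph) ?_).mpr h1
        change toScalar 𝕜 (rate P k) •
          (toScalar 𝕜 (rate P k ^ (n + 1)) • T k (n + 1) x -
            toScalar 𝕜 (rate P k ^ n) • T k n x) +
          toScalar 𝕜 ξ • toScalar 𝕜 (rate P k ^ (n + 1)) • T k (n + 1) x = _
        rw [pow_succ, toScalar_mul, toScalar_add]
        module
      · rw [smul_smul, ← toScalar_mul, mul_comm, rate_mul_mesh, toScalar_one, one_smul]
    · rcases n with _ | n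
      · rw [hE0]
        exact hCB z
      · exact (hEn k (n + 1) (by omega) z).trans (mul_le_mul_of_nonneg_right hMB (N.nonneg z))
    · refine injective_iff.1 (hinj k) x ?_
      rw [mem_graph_shift, sub_zero]
      rw [mem_subGraph] at hxy
      have e1 : y = toScalar 𝕜 (rate P k) • x := by
        rw [e, smul_smul, ← toScalar_mul, rate_mul_mesh, toScalar_one, one_smul]
      rw [toScalar_add, add_smul, add_comm, ← e1]
      exact hxy
    · rw [mem_subGraph, mem_subGraph, ← LinearMap.map_smul, ← _root_.map_add, ← mem_conjGraph,
        ← hconj]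
    · refine hdense.of_closure fun x hx => ⟨fun _ => x, fun _ => ?_, N.tendsTo_const x⟩
      refine ⟨A ⟨x, hx⟩ - toScalar 𝕜 ξ • x, ?_⟩
      rw [mem_subGraph, sub_add_cancel]
      exact A.mem_graph ⟨x, hx⟩
  obtain ⟨c, hc0, hc⟩ := hC
  -- On the domain, `C u` is the limit of `E k 1 u`, whose norm is at most `M ‖u‖`; density and
  -- boundedness of `C` give the rest.
  have hCM : ∀ z, N (C z) ≤ M * N z := by
    have hE := hscheme (M + c) (le_add_of_nonneg_right hc0) fun z => (hc z).trans
      (mul_le_mul_of_nonneg_right (le_add_of_nonneg_left hM) (N.nonneg z))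
    intro z
    obtain ⟨u, hu, hz⟩ := hE.dense.exists_seq z
    have hu' : ∀ n, N (C (u n)) ≤ M * N (u n) := by
      intro n
      obtain ⟨y, hy⟩ := hu n
      have h1 : N.TendsTo (fun k => E k 1 (u n)) atTop (C (u n)) := by
        refine tendsTo_of_le (tendsto_probNorm_mesh_mul ((M + c) * N y))
          (Eventually.of_forall fun k => ?_)
        have := hE.add_sub_le k 0 1 hy
        rwa [zero_add, hE0, Nat.cast_one, const_one, one_mul] at this
      exact h1.le_of_le (Eventually.of_forall fun k => hEn k 1 le_rfl (u n))
    refine (hz.map hc).le_of_le_add (tendsto_probNorm_mul M (tendsTo_iff.1 hz))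
      (Eventually.of_forall fun n => ?_)
    rw [← mul_add]
    exact (hu' n).trans (mul_le_mul_of_nonneg_left (N.le_add_sub _ _) hM)
  obtain ⟨W, hW, hWb, hWg⟩ := (hscheme M le_rfl hCM).exists_semigroup hS hM hCinj hCdense
  refine ⟨rescale ξ W, ⟨hW.rescale ξ, fun s => opNormLE_of_le
    (mul_nonneg hM (exp_nonneg _)) fun z => ?_⟩, isGenerator_of_graph fun x y => ?_⟩
  · have := rescale_le (N := N) (M := M) (ξ := 0) (W := W) (s := s) (fun z => by
      rw [zero_mul, exp_zero, mul_one]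
      exact hWb s z) ξ z
    rwa [zero_add] at this
  · rw [generates_rescale_iff, ← hWg, mem_subGraph, sub_add_cancel]

end RandomNorm

/-! ### The Banach space of elements with integrable norm -/

namespace L0

variable {Ω : Type*} [MeasurableSpace Ω] {P : Measure Ω} [IsProbabilityMeasure P]

theorem probNorm_le_integral {X : Ω →ₘ[P] ℝ} (h0 : 0 ≤ X) (hX : Integrable X P) :
    probNorm X ≤ ∫ ω, X ω ∂P := by
  apply integral_mono_ae (integrable_min_abs X) hX
  filter_upwards [nonneg_iff.1 h0] with ω h
  exact (min_le_left _ _).trans_eq (abs_of_nonneg h)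

omit [IsProbabilityMeasure P] in
theorem integrable_of_le {X Y : Ω →ₘ[P] ℝ} (h0 : 0 ≤ X) (h : X ≤ Y) (hY : Integrable Y P) :
    Integrable X P := by
  refine hY.mono' X.aestronglyMeasurable ?_
  filter_upwards [nonneg_iff.1 h0, le_iff.1 h] with ω h1 h2
  rwa [Real.norm_eq_abs, abs_of_nonneg h1]

omit [IsProbabilityMeasure P] in
theorem integrable_add {X Y : Ω →ₘ[P] ℝ} (hX : Integrable X P) (hY : Integrable Y P) :
    Integrable (X + Y : Ω →ₘ[P] ℝ) P :=
  (hX.add hY).congr (AEEqFun.coeFn_add X Y).symm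

omit [IsProbabilityMeasure P] in
theorem integral_le_of_le {X Y : Ω →ₘ[P] ℝ} (h0 : 0 ≤ X) (h : X ≤ Y) (hY : Integrable Y P) :
    ∫ ω, X ω ∂P ≤ ∫ ω, Y ω ∂P :=
  integral_mono_ae (integrable_of_le h0 h hY) hY (le_iff.1 h)

omit [IsProbabilityMeasure P] in
theorem integral_coeFn_add {X Y : Ω →ₘ[P] ℝ} (hX : Integrable X P) (hY : Integrable Y P) :
    ∫ ω, (X + Y : Ω →ₘ[P] ℝ) ω ∂P = ∫ ω, X ω ∂P + ∫ ω, Y ω ∂P := by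
  rw [← integral_add hX hY]
  exact integral_congr_ae (AEEqFun.coeFn_add X Y)

/-- For norms bounded by `2`, convergence in probability is convergence in mean; the `2`
accommodates the difference of two vectors of norm at most `1`. -/
theorem integral_le_two_mul_probNorm {X : Ω →ₘ[P] ℝ} (h0 : 0 ≤ X) (h : X ≤ 1 + 1) :
    ∫ ω, X ω ∂P ≤ 2 * probNorm X := by
  have h2 : ∀ᵐ ω ∂P, 0 ≤ X ω ∧ X ω ≤ 2 := by
    filter_upwards [nonneg_iff.1 h0, le_iff.1 h, coeFn_add' (P := P) (1 : Ω →ₘ[P] ℝ) 1,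
      coeFn_one' (P := P) (R := ℝ)] with ω h1 h2 h3 h4
    rw [h3, h4] at h2
    exact ⟨h1, by linarith⟩
  rw [probNorm, ← integral_const_mul]
  refine integral_mono_of_nonneg ?_ ((integrable_min_abs X).const_mul 2) ?_
  · filter_upwards [h2] with ω h using h.1
  · filter_upwards [h2] with ω h
    change X ω ≤ 2 * min |X ω| 1
    rw [abs_of_nonneg h.1]
    rcases le_total (X ω) 1 with h5 | h5
    · rw [min_eq_left h5]; linarith [h.1]
    · rw [min_eq_right h5]; linarith [h.2]

/-- Fatou's lemma for convergence in probability. -/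
theorem integrable_of_tendsto {ι : Type*} {l : Filter ι} [l.NeBot] {X : ι → Ω →ₘ[P] ℝ}
    {Y : Ω →ₘ[P] ℝ} {r : ℝ} (hY : 0 ≤ Y)
    (hX : ∀ᶠ i in l, 0 ≤ X i ∧ Integrable (X i) P ∧ ∫ ω, X i ω ∂P ≤ r)
    (h : Tendsto (fun i => probNorm (X i - Y)) l (𝓝 0)) :
    Integrable Y P ∧ ∫ ω, Y ω ∂P ≤ r := by
  have hm : ∀ K : ℕ, AEStronglyMeasurable (fun ω => min |Y ω| (K + 1)) P := fun K =>
    Y.aestronglyMeasurable.norm.inf aestronglyMeasurable_const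
  have h0 : ∀ (K : ℕ) ω, 0 ≤ min |Y ω| ((K : ℝ) + 1) := fun K ω =>
    le_min (abs_nonneg _) (by positivity)
  have hi : ∀ K : ℕ, Integrable (fun ω => min |Y ω| (K + 1)) P := fun K => by
    refine Integrable.of_bound (hm K) (K + 1) (ae_of_all _ fun ω => ?_)
    rw [Real.norm_eq_abs, abs_of_nonneg (h0 K ω)]
    exact min_le_right _ _
  -- Pointwise, `min |Y| (K + 1) ≤ X i + (K + 1) min |X i - Y| 1`. This controls the truncations
  -- directly, without extracting an almost surely convergent subsequence.
  have hK : ∀ K : ℕ, ∫ ω, min |Y ω| (K + 1) ∂P ≤ r := by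
    intro K
    have h1 : Tendsto (fun i => r + (K + 1) * probNorm (X i - Y)) l (𝓝 r) := by
      simpa using (h.const_mul ((K : ℝ) + 1)).const_add r
    refine ge_of_tendsto h1 ?_
    filter_upwards [hX] with i ⟨hi0, hii, hir⟩
    have h2 : ∫ ω, min |Y ω| (K + 1) ∂P ≤
        ∫ ω, (X i ω + (K + 1) * min |(X i - Y) ω| 1) ∂P := by
      apply integral_mono_ae (hi K) (hii.add ((integrable_min_abs _).const_mul _))
      filter_upwards [nonneg_iff.1 hi0, coeFn_sub' (X i) Y] with ω h3 h4
      change min |Y ω| (K + 1) ≤ X i ω + (K + 1) * min |(X i - Y) ω| 1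
      rw [h4]
      rcases le_total |X i ω - Y ω| 1 with h5 | h5
      · rw [min_eq_left h5]
        have h6 : |Y ω| ≤ |X i ω| + |X i ω - Y ω| := by
          have := abs_sub (X i ω) (X i ω - Y ω)
          rwa [sub_sub_cancel] at this
        rw [abs_of_nonneg h3] at h6
        have h7 : 0 ≤ (K : ℝ) * |X i ω - Y ω| := by positivity
        exact (min_le_left _ _).trans (by linarith)
      · rw [min_eq_right h5]
        exact (min_le_right _ _).trans (by linarith)
    rw [integral_add hii ((integrable_min_abs _).const_mul _), integral_const_mul] at h2
    exact h2.trans (by rw [probNorm]; linarith)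
  have hlim : Tendsto (fun K : ℕ => ∫⁻ ω, ENNReal.ofReal (min |Y ω| (K + 1)) ∂P) atTop
      (𝓝 (∫⁻ ω, ENNReal.ofReal |Y ω| ∂P)) := by
    refine lintegral_tendsto_of_tendsto_of_monotone
      (fun K => (hm K).aemeasurable.ennreal_ofReal) (ae_of_all _ fun ω m n hmn => ?_)
      (ae_of_all _ fun ω => ?_)
    · refine ENNReal.ofReal_le_ofReal (min_le_min_left _ ?_)
      exact add_le_add_left (Nat.cast_le.2 hmn) 1
    · refine tendsto_const_nhds.congr' ?_
      obtain ⟨n, hn⟩ := exists_nat_ge |Y ω|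
      filter_upwards [eventually_ge_atTop n] with K hK
      have : (n : ℝ) ≤ K := Nat.cast_le.2 hK
      rw [min_eq_left (by linarith)]
  have hle : ∫⁻ ω, ENNReal.ofReal |Y ω| ∂P ≤ ENNReal.ofReal r := by
    refine le_of_tendsto' hlim fun K => ?_
    rw [← ofReal_integral_eq_lintegral_ofReal (hi K) (ae_of_all _ (h0 K))]
    exact ENNReal.ofReal_le_ofReal (hK K)
  have hr : 0 ≤ r := (integral_nonneg (h0 0)).trans (hK 0)
  have hint : Integrable Y P := by
    refine ⟨Y.aestronglyMeasurable, ?_⟩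
    rw [hasFiniteIntegral_iff_norm]
    exact hle.trans_lt ENNReal.ofReal_lt_top
  refine ⟨hint, ?_⟩
  have h1 : ∫ ω, Y ω ∂P = ∫ ω, |Y ω| ∂P := by
    apply integral_congr_ae
    filter_upwards [nonneg_iff.1 hY] with ω h2
    rw [abs_of_nonneg h2]
  rw [h1, integral_eq_lintegral_of_nonneg_ae (ae_of_all _ fun ω => abs_nonneg _)
    Y.aestronglyMeasurable.norm]
  exact ENNReal.toReal_le_of_le_ofReal hr hle

end L0

namespace RandomNorm

open L0

variable {Ω : Type*} [MeasurableSpace Ω] {P : Measure Ω} {𝕜 : Type*} [RCLike 𝕜]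
  {S : Type*} [AddCommGroup S] [Module (Ω →ₘ[P] 𝕜) S] [IsProbabilityMeasure P]

/-- The elements with integrable norm. -/
def l1 (N : RandomNorm P 𝕜 S) : AddSubgroup S where
  carrier := {x | Integrable (N x) P}
  zero_mem' := by
    change Integrable (N 0) P
    rw [N.map_zero]
    exact (integrable_zero Ω ℝ P).congr AEEqFun.coeFn_zero.symm
  add_mem' hx hy := integrable_of_le (N.nonneg _) (N.add_le _ _) (integrable_add hx hy)
  neg_mem' {x} hx := by
    change Integrable (N (-x)) P
    rwa [N.map_neg]

variable {N : RandomNorm P 𝕜 S}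

omit [IsProbabilityMeasure P] in
theorem mem_l1_of_le {x : S} {X : Ω →ₘ[P] ℝ} (h : N x ≤ X) (hX : Integrable X P) : x ∈ N.l1 :=
  integrable_of_le (N.nonneg _) h hX

omit [IsProbabilityMeasure P] in
theorem integrable_const_mul' (c : ℝ) {X : Ω →ₘ[P] ℝ} (hX : Integrable X P) :
    Integrable (AEEqFun.const Ω c * X : Ω →ₘ[P] ℝ) P := by
  refine (hX.const_mul c).congr ?_
  filter_upwards [coeFn_mul' (AEEqFun.const Ω c) X, coeFn_const' (P := P) c] with ω h1 h2
  rw [h1, h2]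

omit [IsProbabilityMeasure P] in
theorem integral_const_mul' (c : ℝ) (X : Ω →ₘ[P] ℝ) :
    ∫ ω, (AEEqFun.const Ω c * X : Ω →ₘ[P] ℝ) ω ∂P = c * ∫ ω, X ω ∂P := by
  rw [← integral_const_mul]
  apply integral_congr_ae
  filter_upwards [coeFn_mul' (AEEqFun.const Ω c) X, coeFn_const' (P := P) c] with ω h1 h2
  rw [h1, h2]

noncomputable instance l1NormedAddCommGroup : NormedAddCommGroup N.l1 :=
  AddGroupNorm.toNormedAddCommGroup
    { toFun := fun x => ∫ ω, N (x : S) ω ∂P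
      map_zero' := by
        rw [AddSubgroup.coe_zero, N.map_zero, integral_congr_ae AEEqFun.coeFn_zero]
        exact integral_zero _ _
      add_le' := fun x y => by
        rw [← integral_coeFn_add x.2 y.2]
        exact integral_le_of_le (N.nonneg _) (N.add_le _ _) (integrable_add x.2 y.2)
      neg' := fun x => by rw [AddSubgroup.coe_neg, N.map_neg]
      eq_zero_of_map_eq_zero' := fun x h => by
        have h1 : probNorm (N (x : S)) ≤ 0 := (probNorm_le_integral (N.nonneg _) x.2).trans_eq h
        exact Subtype.ext (N.eq_zero _ (probNorm_eq_zero (le_antisymm h1 (probNorm_nonneg _)))) }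

theorem l1_norm (x : N.l1) : ‖x‖ = ∫ ω, N (x : S) ω ∂P := rfl

theorem probNorm_le_l1_norm (x : N.l1) : probNorm (N (x : S)) ≤ ‖x‖ :=
  probNorm_le_integral (N.nonneg _) x.2

omit [IsProbabilityMeasure P] in
theorem norm_const_smul (c : ℝ) (x : S) :
    N (toScalar 𝕜 (AEEqFun.const Ω c : Ω →ₘ[P] ℝ) • x) = AEEqFun.const Ω |c| * N x := by
  rw [N.real_smul]
  congr 1

noncomputable instance l1Module : Module ℝ N.l1 where
  smul c x := ⟨toScalar 𝕜 (AEEqFun.const Ω c : Ω →ₘ[P] ℝ) • (x : S), by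
    refine mem_l1_of_le (norm_const_smul c (x : S)).le (integrable_const_mul' _ x.2)⟩
  one_smul x := Subtype.ext (by
    change toScalar 𝕜 (AEEqFun.const Ω (1 : ℝ) : Ω →ₘ[P] ℝ) • (x : S) = x
    rw [const_one, toScalar_one, one_smul])
  mul_smul c d x := Subtype.ext (by
    change toScalar 𝕜 (AEEqFun.const Ω (c * d) : Ω →ₘ[P] ℝ) • (x : S) =
      toScalar 𝕜 (AEEqFun.const Ω c : Ω →ₘ[P] ℝ) •
        toScalar 𝕜 (AEEqFun.const Ω d : Ω →ₘ[P] ℝ) • (x : S)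
    rw [const_mul_const, toScalar_mul, mul_smul])
  smul_zero c := Subtype.ext (smul_zero _)
  smul_add c x y := Subtype.ext (smul_add _ _ _)
  add_smul c d x := Subtype.ext (by
    change toScalar 𝕜 (AEEqFun.const Ω c + AEEqFun.const Ω d : Ω →ₘ[P] ℝ) • (x : S) =
      toScalar 𝕜 (AEEqFun.const Ω c : Ω →ₘ[P] ℝ) • (x : S) +
        toScalar 𝕜 (AEEqFun.const Ω d : Ω →ₘ[P] ℝ) • (x : S)
    rw [toScalar_add, add_smul])
  zero_smul x := Subtype.ext (by
    change toScalar 𝕜 (0 : Ω →ₘ[P] ℝ) • (x : S) = 0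
    exact (congrArg (· • (x : S)) toScalar_zero).trans (zero_smul (Ω →ₘ[P] 𝕜) (x : S)))

omit [IsProbabilityMeasure P] in
theorem l1_coe_smul (c : ℝ) (x : N.l1) :
    ((c • x : N.l1) : S) = toScalar 𝕜 (AEEqFun.const Ω c : Ω →ₘ[P] ℝ) • (x : S) := rfl

noncomputable instance l1NormedSpace : NormedSpace ℝ N.l1 where
  norm_smul_le c x := by
    rw [l1_norm, l1_norm, l1_coe_smul, norm_const_smul, integral_const_mul', Real.norm_eq_abs]

/-- A Cauchy sequence in mean is Cauchy in probability, hence converges in `S`; Fatou's lemma places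
the limit in `l1` and upgrades the convergence. -/
theorem l1_completeSpace (hS : N.IsComplete) : CompleteSpace N.l1 := by
  refine Metric.complete_of_cauchySeq_tendsto fun u hu => ?_
  rw [Metric.cauchySeq_iff] at hu
  obtain ⟨x, hx⟩ := N.exists_tendsTo_of_cauchy hS (f := fun n => (u n : S)) fun r hr => by
    obtain ⟨K, hK⟩ := hu r hr
    refine ⟨K, fun m hm n hn => (probNorm_le_l1_norm (u m - u n)).trans_lt ?_⟩
    rw [← dist_eq_norm]
    exact hK m hm n hn
  -- Fatou's lemma is applied to `u n - u m` for fixed `n` as `m → ∞`.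
  have key : ∀ r > 0, ∃ K, ∀ n ≥ K, Integrable (N ((u n : S) - x)) P ∧
      ∫ ω, N ((u n : S) - x) ω ∂P ≤ r := by
    intro r hr
    obtain ⟨K, hK⟩ := hu r hr
    refine ⟨K, fun n hn => ?_⟩
    refine integrable_of_tendsto (l := atTop) (X := fun m => N ((u n - u m : N.l1) : S))
      (N.nonneg _) ?_ ?_
    · filter_upwards [eventually_ge_atTop K] with m hm
      refine ⟨N.nonneg _, (u n - u m).2, ?_⟩
      rw [← l1_norm, ← dist_eq_norm]
      exact (hK n hn m hm).le
    · refine squeeze_zero (fun _ => probNorm_nonneg _) (fun m => ?_) (tendsTo_iff.1 hx)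
      have h1 := N.abs_sub_le ((u n - u m : N.l1) : S) ((u n : S) - x)
      have e : ((u n - u m : N.l1) : S) - ((u n : S) - x) = -((u m : S) - x) := by
        rw [AddSubgroup.coe_sub]
        abel
      rw [e, N.map_neg] at h1
      rw [← probNorm_abs]
      exact probNorm_mono (abs_nonneg _) h1
  obtain ⟨K₀, hK₀⟩ := key 1 one_pos
  have hmem : x ∈ N.l1 := by
    have h1 : (u K₀ : S) - x ∈ N.l1 := (hK₀ K₀ le_rfl).1
    have := N.l1.sub_mem (u K₀).2 h1
    rwa [sub_sub_cancel] at this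
  refine ⟨⟨x, hmem⟩, Metric.tendsto_atTop.2 fun r hr => ?_⟩
  obtain ⟨K, hK⟩ := key (r / 2) (half_pos hr)
  refine ⟨K, fun n hn => ?_⟩
  rw [dist_eq_norm, l1_norm]
  exact (hK n hn).2.trans_lt (half_lt_self hr)

theorem tendsTo_of_l1 {ι : Type*} {l : Filter ι} {f : ι → N.l1} {x : N.l1}
    (h : Tendsto f l (𝓝 x)) : N.TendsTo (fun i => (f i : S)) l (x : S) := by
  rw [tendsTo_iff]
  refine squeeze_zero (fun _ => probNorm_nonneg _) (fun i => ?_)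
    (tendsto_iff_norm_sub_tendsto_zero.1 h)
  exact probNorm_le_l1_norm (f i - x)

/-- A module homomorphism that does not increase norms acts on the elements of integrable norm. -/
noncomputable def l1Map (T : S →ₗ[Ω →ₘ[P] 𝕜] S) (hT : ∀ z, N (T z) ≤ N z) : N.l1 →L[ℝ] N.l1 :=
  LinearMap.mkContinuous
    { toFun := fun x => ⟨T x, mem_l1_of_le (hT x) x.2⟩
      map_add' := fun x y => Subtype.ext (_root_.map_add T _ _)
      map_smul' := fun c x => Subtype.ext (LinearMap.map_smul T _ _) } 1
    (fun x => by
      rw [one_mul]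
      exact integral_le_of_le (N.nonneg _) (hT x) x.2)

theorem l1Map_apply (T : S →ₗ[Ω →ₘ[P] 𝕜] S) (hT : ∀ z, N (T z) ≤ N z) (x : N.l1) :
    (l1Map T hT x : S) = T x := rfl

theorem l1_enorm (x : N.l1) : ‖x‖ₑ = ∫⁻ ω, ENNReal.ofReal (N (x : S) ω) ∂P := by
  rw [← ofReal_norm, l1_norm]
  exact ofReal_integral_eq_lintegral_ofReal x.2 (nonneg_iff.1 (N.nonneg _))

end RandomNorm

/-! ### Integrals of exponentially decaying paths -/

namespace L0

variable {Ω : Type*} [MeasurableSpace Ω] {P : Measure Ω}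

open Classical in
/-- The indicator of a measurable set as a random variable (`0` if the set is not measurable). -/
noncomputable def indic (P : Measure Ω) (s : Set Ω) : Ω →ₘ[P] ℝ :=
  if hs : MeasurableSet s then
    AEEqFun.mk (s.indicator 1) ((stronglyMeasurable_one.indicator hs).aestronglyMeasurable)
  else 0

theorem coeFn_indic {s : Set Ω} (hs : MeasurableSet s) :
    ∀ᵐ ω ∂P, indic P s ω = s.indicator 1 ω := by
  rw [indic, dif_pos hs]
  exact AEEqFun.coeFn_mk _ _

theorem indic_nonneg {s : Set Ω} (hs : MeasurableSet s) : 0 ≤ indic P s := by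
  rw [nonneg_iff]
  filter_upwards [coeFn_indic (P := P) hs] with ω h
  rw [h]
  exact Set.indicator_nonneg (fun _ _ => zero_le_one) ω

theorem indic_le_one {s : Set Ω} (hs : MeasurableSet s) : indic P s ≤ 1 := by
  rw [le_iff]
  filter_upwards [coeFn_indic (P := P) hs, coeFn_one' (P := P) (R := ℝ)] with ω h h1
  rw [h, h1]
  exact Set.indicator_le_self' (fun _ _ => zero_le_one) ω

theorem lintegral_indic_mul {s : Set Ω} (hs : MeasurableSet s) (X : Ω →ₘ[P] ℝ) :
    ∫⁻ ω, ENNReal.ofReal ((indic P s * X) ω) ∂P = ∫⁻ ω in s, ENNReal.ofReal (X ω) ∂P := by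
  rw [← lintegral_indicator hs]
  apply lintegral_congr_ae
  filter_upwards [coeFn_indic (P := P) hs, coeFn_mul' (indic P s) X] with ω h1 h2
  rw [h2, h1]
  by_cases hω : ω ∈ s <;> simp [hω]

end L0

namespace RandomNorm

open L0

variable {Ω : Type*} [MeasurableSpace Ω] {P : Measure Ω} {𝕜 : Type*} [RCLike 𝕜]
  {S : Type*} [AddCommGroup S] [Module (Ω →ₘ[P] 𝕜) S]
  {N : RandomNorm P 𝕜 S}

theorem smul_id_le {ζ : Ω →ₘ[P] ℝ} (h0 : 0 ≤ ζ) (h1 : ζ ≤ 1) (z : S) :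
    N ((toScalar 𝕜 ζ • (LinearMap.id : S →ₗ[Ω →ₘ[P] 𝕜] S)) z) ≤ N z := by
  rw [LinearMap.smul_apply, LinearMap.id_apply, N.real_smul_of_nonneg h0]
  exact mul_le_of_le_one_left (N.nonneg z) h1

variable [IsProbabilityMeasure P]

/-- The norm of an integral is almost surely at most the integral of any pointwise majorant. -/
theorem ofReal_integral_le [CompleteSpace N.l1] {D : Set ℝ} (hD : MeasurableSet D) {F : ℝ → N.l1}
    (hF : IntegrableOn F D) {G : ℝ → Ω → ℝ} (hG : Measurable (Function.uncurry G))
    (h : ∀ s ∈ D, ∀ᵐ ω ∂P, N (F s : S) ω ≤ G s ω) :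
    ∀ᵐ ω ∂P, ENNReal.ofReal (N ((∫ s in D, F s : N.l1) : S) ω) ≤
      ∫⁻ s : ℝ in D, ENNReal.ofReal (G s ω) := by
  refine ae_le_of_forall_setLIntegral_le_of_sigmaFinite
    (AEEqFun.measurable _).ennreal_ofReal fun E hE _ => ?_
  -- Multiplication by the indicator of `E` is a contraction of `l1` and commutes with Bochner's
  -- integral, so the inequality can be tested on `E`; Tonelli's theorem then exchanges the
  -- integrals.
  let T := l1Map _ (smul_id_le (N := N) (indic_nonneg (P := P) hE) (indic_le_one hE))
  have hT : ∀ x : N.l1, ‖T x‖ₑ = ∫⁻ ω in E, ENNReal.ofReal (N (x : S) ω) ∂P := by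
    intro x
    rw [l1_enorm, ← lintegral_indic_mul hE]
    have : N ((T x : N.l1) : S) = indic P E * N (x : S) :=
      N.real_smul_of_nonneg (indic_nonneg hE) _
    rw [this]
  rw [← hT, ← ContinuousLinearMap.integral_comp_comm T hF]
  calc ‖∫ s in D, T (F s)‖ₑ ≤ ∫⁻ s : ℝ in D, ‖T (F s)‖ₑ := enorm_integral_le_lintegral_enorm _
    _ ≤ ∫⁻ s : ℝ in D, ∫⁻ ω in E, ENNReal.ofReal (G s ω) ∂P := by
      refine setLIntegral_mono' hD fun s hs => ?_
      rw [hT]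
      refine lintegral_mono_ae (ae_restrict_of_ae ?_)
      filter_upwards [h s hs] with ω hω
      exact ENNReal.ofReal_le_ofReal hω
    _ = ∫⁻ ω in E, (∫⁻ s : ℝ in D, ENNReal.ofReal (G s ω)) ∂P :=
      lintegral_lintegral_swap hG.ennreal_ofReal.aemeasurable

/-- `I` is the integral of the path `f` over `[0, ∞)`: after multiplication with a strictly
positive random variable, `f` becomes a Bochner integrable continuous path of elements with
integrable norm. -/
def HasIntegral (N : RandomNorm P 𝕜 S) (f : ℝ≥0 → S) (I : S) : Prop :=
  ∃ w : Ω →ₘ[P] ℝ, (∀ᵐ ω ∂P, 0 < w ω) ∧ ∃ F : ℝ → N.l1, Continuous F ∧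
    IntegrableOn F (Set.Ioi 0) ∧ (∀ s : ℝ≥0, (F s : S) = toScalar 𝕜 w • f s) ∧
    toScalar 𝕜 w • I = ((∫ s in Set.Ioi 0, F s : N.l1) : S)

omit [IsProbabilityMeasure P] in
theorem smul_cancel {w : Ω →ₘ[P] ℝ} (hw : ∀ᵐ ω ∂P, 0 < w ω) {x y : S}
    (h : toScalar 𝕜 w • x = toScalar 𝕜 w • y) : x = y := by
  have := congrArg (toScalar 𝕜 (L0.inv w) • ·) h
  simpa only [smul_smul, ← toScalar_mul, L0.inv_mul_cancel hw, toScalar_one, one_smul] using this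

omit [IsProbabilityMeasure P] in
theorem coeFn_inv_one_add {X : Ω →ₘ[P] ℝ} : ∀ᵐ ω ∂P, L0.inv (1 + X) ω = (1 + X ω)⁻¹ := by
  filter_upwards [L0.coeFn_inv (1 + X), coeFn_add' 1 X, coeFn_one' (P := P) (R := ℝ)]
    with ω h1 h2 h3
  rw [h1, h2, h3]

omit [IsProbabilityMeasure P] in
theorem inv_one_add_pos {X : Ω →ₘ[P] ℝ} (h : 0 ≤ X) : ∀ᵐ ω ∂P, 0 < L0.inv (1 + X) ω := by
  filter_upwards [coeFn_inv_one_add (X := X), nonneg_iff.1 h] with ω h1 h2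
  rw [h1]
  positivity

omit [IsProbabilityMeasure P] in
-- `1 / (1 + X)` serves below as the standard strictly positive weight: it reduces any quantity
-- bounded by `1 + X` to at most `1`.
theorem inv_one_add_mul_le {X Y : Ω →ₘ[P] ℝ} (h : 0 ≤ X) (hY : Y ≤ 1 + X) :
    L0.inv (1 + X) * Y ≤ 1 := by
  have h1 := pos_of_nonneg_add_one h
  have h2 := mul_le_mul_of_nonneg_left hY (L0.inv_nonneg h1)
  rwa [L0.inv_mul_cancel h1] at h2

namespace HasIntegral

variable {f f' : ℝ≥0 → S} {I I' : S}

theorem unique [CompleteSpace N.l1] (h : N.HasIntegral f I) (h' : N.HasIntegral f I') :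
    I = I' := by
  obtain ⟨w, hw, F, -, hF, hFf, hI⟩ := h
  obtain ⟨w', hw', F', -, hF', hFf', hI'⟩ := h'
  have hw0 : 0 ≤ w := nonneg_iff.2 (by filter_upwards [hw] with ω h using h.le)
  have hw0' : 0 ≤ w' := nonneg_iff.2 (by filter_upwards [hw'] with ω h using h.le)
  have hq0 : 0 ≤ L0.inv (1 + (w + w')) :=
    L0.inv_nonneg (pos_of_nonneg_add_one (add_nonneg hw0 hw0'))
  have hq1 := inv_one_add_mul_le (add_nonneg hw0 hw0')
    (Y := w) (by rw [add_left_comm]; exact le_add_of_nonneg_right (add_nonneg zero_le_one hw0'))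
  have hq1' := inv_one_add_mul_le (add_nonneg hw0 hw0')
    (Y := w') (by rw [← add_assoc]; exact le_add_of_nonneg_left (add_nonneg zero_le_one hw0))
  set q := L0.inv (1 + (w + w')) with hq
  -- The weights `w` and `w'` are brought to the common weight `q w w'`; the factor `q` makes `q w'`
  -- and `q w` at most `1`, so that they act on `l1`.
  let T := l1Map _ (smul_id_le (N := N) (mul_nonneg hq0 hw0') hq1')
  let T' := l1Map _ (smul_id_le (N := N) (mul_nonneg hq0 hw0) hq1)
  have e : ∫ s in Set.Ioi 0, T (F s) = ∫ s in Set.Ioi 0, T' (F' s) := by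
    refine setIntegral_congr_fun measurableSet_Ioi fun s hs => Subtype.ext ?_
    change toScalar 𝕜 (q * w') • (F s : S) = toScalar 𝕜 (q * w) • (F' s : S)
    have e1 : (F s : S) = _ := hFf ⟨s, le_of_lt hs⟩
    have e2 : (F' s : S) = _ := hFf' ⟨s, le_of_lt hs⟩
    rw [e1, e2, smul_smul, smul_smul, ← toScalar_mul, ← toScalar_mul, mul_right_comm]
  rw [ContinuousLinearMap.integral_comp_comm T hF,
    ContinuousLinearMap.integral_comp_comm T' hF'] at e
  have e' : toScalar 𝕜 (q * w') • ((∫ s in Set.Ioi 0, F s : N.l1) : S) =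
      toScalar 𝕜 (q * w) • ((∫ s in Set.Ioi 0, F' s : N.l1) : S) := congrArg Subtype.val e
  rw [← hI, ← hI', smul_smul, smul_smul, ← toScalar_mul, ← toScalar_mul,
    mul_right_comm q w w'] at e'
  refine smul_cancel ?_ e'
  filter_upwards [hw, hw', inv_one_add_pos (add_nonneg hw0 hw0'), coeFn_mul' (q * w') w,
    coeFn_mul' q w'] with ω h1 h2 h3 h4 h5
  rw [h4, h5]
  exact mul_pos (mul_pos h3 h2) h1

theorem map [CompleteSpace N.l1] (h : N.HasIntegral f I) {T : S →ₗ[Ω →ₘ[P] 𝕜] S}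
    {η : Ω →ₘ[P] ℝ} (h0 : 0 ≤ η) (hT : ∀ z, N (T z) ≤ η * N z) :
    N.HasIntegral (fun s => T (f s)) (T I) := by
  obtain ⟨w, hw, F, hFc, hF, hFf, hI⟩ := h
  have hq0 : 0 ≤ L0.inv (1 + η) := L0.inv_nonneg (pos_of_nonneg_add_one h0)
  have hq1 := inv_one_add_mul_le h0 (Y := η) (le_add_of_nonneg_left zero_le_one)
  -- `T` need not preserve `l1`, but `T / (1 + η)` is a contraction; the factor is absorbed into the
  -- weight.
  have hqT : ∀ z, N ((toScalar 𝕜 (L0.inv (1 + η)) • T) z) ≤ N z := by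
    intro z
    rw [LinearMap.smul_apply, N.real_smul_of_nonneg hq0]
    refine (mul_le_mul_of_nonneg_left (hT z) hq0).trans ?_
    rw [← mul_assoc]
    exact mul_le_of_le_one_left (N.nonneg z) hq1
  refine ⟨L0.inv (1 + η) * w, ?_, fun s => l1Map _ hqT (F s),
    (l1Map _ hqT).continuous.comp hFc, (l1Map _ hqT).integrable_comp hF, fun s => ?_, ?_⟩
  · filter_upwards [hw, inv_one_add_pos h0, coeFn_mul' (L0.inv (1 + η)) w] with ω h1 h2 h3
    rw [h3]
    exact mul_pos h2 h1
  · rw [l1Map_apply, hFf, LinearMap.smul_apply, LinearMap.map_smul, smul_smul, toScalar_mul]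
  · rw [ContinuousLinearMap.integral_comp_comm _ hF, l1Map_apply, ← hI, LinearMap.smul_apply,
      LinearMap.map_smul, smul_smul, toScalar_mul]

/-- The integral of a translated path. -/
theorem sub_shift [CompleteSpace N.l1] (h : N.HasIntegral f I) :
    ∃ w : Ω →ₘ[P] ℝ, (∀ᵐ ω ∂P, 0 < w ω) ∧ ∃ F : ℝ → N.l1, Continuous F ∧
      (∀ s : ℝ≥0, (F s : S) = toScalar 𝕜 w • f s) ∧
      ∀ (t : ℝ≥0) (J : S), N.HasIntegral (fun s => f (s + t)) J →
        toScalar 𝕜 w • (I - J) = ((∫ s in (0 : ℝ)..t, F s : N.l1) : S) := by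
  obtain ⟨w, hw, F, hFc, hF, hFf, hI⟩ := h
  -- Weight and path are fixed before `t`, so that the resulting formula can be differentiated in
  -- `t`.
  refine ⟨w, hw, F, hFc, hFf, fun t J hJ => ?_⟩
  have hint : IntegrableOn F (Set.Ioi (t : ℝ)) := hF.mono_set (Set.Ioi_subset_Ioi t.coe_nonneg)
  have hmp := measurePreserving_add_right (volume : Measure ℝ) (t : ℝ)
  have hme := measurableEmbedding_addRight (t : ℝ)
  have hpre : (fun s : ℝ => s + t) ⁻¹' Set.Ioi (t : ℝ) = Set.Ioi 0 := by
    rw [Set.preimage_add_const_Ioi, sub_self]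
  have e1 : ∫ s in Set.Ioi (0 : ℝ), F (s + t) = ∫ s in Set.Ioi (t : ℝ), F s := by
    rw [← hpre]
    exact hmp.setIntegral_preimage_emb hme _ _
  have e2 : toScalar 𝕜 w • J = ((∫ s in Set.Ioi (t : ℝ), F s : N.l1) : S) := by
    have hJ' : N.HasIntegral (fun s => f (s + t))
        (toScalar 𝕜 (L0.inv w) • ((∫ s in Set.Ioi (t : ℝ), F s : N.l1) : S)) := by
      refine ⟨w, hw, fun s => F (s + t), hFc.comp (continuous_add_const _), ?_, fun s => ?_, ?_⟩
      · rw [← hpre]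
        exact (hmp.integrableOn_comp_preimage hme).2 hint
      · exact hFf (s + t)
      · rw [smul_smul, mul_comm, ← toScalar_mul, L0.inv_mul_cancel hw, toScalar_one, one_smul, e1]
    rw [hJ.unique hJ', smul_smul, mul_comm, ← toScalar_mul, L0.inv_mul_cancel hw, toScalar_one,
      one_smul]
  rw [_root_.smul_sub, hI, e2, ← AddSubgroup.coe_sub,
    intervalIntegral.integral_of_le t.coe_nonneg]
  congr 1
  rw [sub_eq_iff_eq_add, ← setIntegral_union (Set.Ioc_disjoint_Ioi le_rfl) measurableSet_Ioi
    (hFc.integrableOn_Ioc) hint, Set.Ioc_union_Ioi_eq_Ioi t.coe_nonneg]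

end HasIntegral

end RandomNorm

/-! ### Existence, bounds and differentiation of the integrals -/

namespace RandomNorm

open L0

variable {Ω : Type*} [MeasurableSpace Ω] {P : Measure Ω} {𝕜 : Type*} [RCLike 𝕜]
  {S : Type*} [AddCommGroup S] [Module (Ω →ₘ[P] 𝕜) S]
  {N : RandomNorm P 𝕜 S}

theorem lintegral_mul_exp_neg {c d : ℝ} (hc : 0 ≤ c) (hd : 0 < d) :
    ∫⁻ s in Set.Ioi (0 : ℝ), ENNReal.ofReal (c * Real.exp (-d * s)) = ENNReal.ofReal (c * d⁻¹) := by
  rw [← ofReal_integral_eq_lintegral_ofReal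
    ((integrableOn_exp_mul_Ioi (neg_neg_of_pos hd) 0).const_mul c)
    (ae_of_all _ fun s => mul_nonneg hc (Real.exp_pos _).le), integral_const_mul,
    integral_exp_mul_Ioi (neg_neg_of_pos hd)]
  congr 1
  simp [neg_div_neg_eq]

theorem smul_le_mul_exp {w g δ : Ω →ₘ[P] ℝ} (hw : 0 ≤ w) {x : S} {c : ℝ}
    (hx : N x ≤ g * exp (-δ * AEEqFun.const Ω c)) :
    ∀ᵐ ω ∂P, N (toScalar 𝕜 w • x) ω ≤ (w * g) ω * Real.exp (-δ ω * c) := by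
  have h := mul_le_mul_of_nonneg_left hx hw
  rw [← N.real_smul_of_nonneg hw, ← mul_assoc] at h
  filter_upwards [le_iff.1 h, coeFn_mul' (w * g) (exp (-δ * AEEqFun.const Ω c)),
    coeFn_exp_mul_const (-δ) c, coeFn_neg' δ] with ω h1 h2 h3 h4
  rwa [h2, h3, h4] at h1

theorem measurable_mul_exp (X δ : Ω →ₘ[P] ℝ) :
    Measurable (Function.uncurry fun (s : ℝ) (ω : Ω) => X ω * Real.exp (-δ ω * s)) := by
  have h1 := X.measurable
  have h2 := δ.measurable
  unfold Function.uncurry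
  fun_prop

variable [IsProbabilityMeasure P] {f : ℝ≥0 → S} {I : S} {g δ : Ω →ₘ[P] ℝ}

/-- A continuous path of exponential decay has an integral. -/
theorem exists_hasIntegral (hf : ∀ s, N.TendsTo f (𝓝 s) (f s)) (hg : 0 ≤ g)
    (hδ : ∀ᵐ ω ∂P, 0 < δ ω)
    (hb : ∀ s : ℝ≥0, N (f s) ≤ g * exp (-δ * AEEqFun.const Ω (s : ℝ))) :
    ∃ I, N.HasIntegral f I := by
  have hδ0 := L0.inv_nonneg hδ
  have hX0 : 0 ≤ g + g * L0.inv δ := add_nonneg hg (mul_nonneg hg hδ0)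
  -- This weight satisfies `w ≤ 1`, `w g ≤ 1` and `w g / δ ≤ 1`. The last two put the weighted path
  -- into `l1` and make it integrable in time; `w ≤ 1` serves its continuity.
  set w := L0.inv (1 + (g + g * L0.inv δ)) with hwdef
  have hwpos : ∀ᵐ ω ∂P, 0 < w ω := inv_one_add_pos hX0
  have hw0 : 0 ≤ w := nonneg_iff.2 (by filter_upwards [hwpos] with ω h using h.le)
  have hwg : w * g ≤ 1 := inv_one_add_mul_le hX0 (by
    rw [← add_assoc, add_right_comm]
    exact le_add_of_nonneg_left (add_nonneg zero_le_one (mul_nonneg hg hδ0)))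
  have hwgδ : w * (g * L0.inv δ) ≤ 1 := inv_one_add_mul_le hX0 (by
    rw [← add_assoc]
    exact le_add_of_nonneg_left (add_nonneg zero_le_one hg))
  have hw1 : w ≤ 1 := by
    have := inv_one_add_mul_le hX0 (Y := 1) (le_add_of_nonneg_right hX0)
    rwa [mul_one] at this
  have hfg : ∀ s, N (f s) ≤ g := fun s =>
    (hb s).trans (mul_le_of_le_one_right hg (exp_neg_mul_const_le_one hδ s.2))
  have hNw : ∀ s, N (toScalar 𝕜 w • f s) ≤ 1 := fun s => by
    rw [N.real_smul_of_nonneg hw0]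
    exact (mul_le_mul_of_nonneg_left (hfg s) hw0).trans hwg
  have h1int : Integrable (1 : Ω →ₘ[P] ℝ) P :=
    (integrable_const (1 : ℝ)).congr AEEqFun.coeFn_one.symm
  let F : ℝ → N.l1 := fun s => ⟨toScalar 𝕜 w • f s.toNNReal, mem_l1_of_le (hNw _) h1int⟩
  have hFc : Continuous F := by
    rw [continuous_iff_continuousAt]
    intro s₀
    rw [ContinuousAt, tendsto_iff_norm_sub_tendsto_zero]
    have h1 := tendsTo_iff.1 ((hf s₀.toNNReal).comp (continuous_real_toNNReal.tendsto s₀))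
    have h2 := h1.const_mul 2
    rw [mul_zero] at h2
    refine squeeze_zero (fun _ => norm_nonneg _) (fun s => ?_) h2
    have e : ((F s - F s₀ : N.l1) : S) =
        toScalar 𝕜 w • f s.toNNReal - toScalar 𝕜 w • f s₀.toNNReal := rfl
    rw [l1_norm]
    refine (integral_le_two_mul_probNorm (N.nonneg _) ?_).trans
      (mul_le_mul_of_nonneg_left (probNorm_mono (N.nonneg _) ?_) (by norm_num))
    · rw [e]
      exact (N.sub_le_add _ _).trans (add_le_add (hNw _) (hNw _))
    · rw [e, ← _root_.smul_sub, N.real_smul_of_nonneg hw0]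
      exact mul_le_of_le_one_left (N.nonneg _) hw1
  have hFi : IntegrableOn F (Set.Ioi 0) := by
    refine ⟨hFc.aestronglyMeasurable, ?_⟩
    rw [hasFiniteIntegral_iff_enorm]
    calc ∫⁻ s in Set.Ioi (0 : ℝ), ‖F s‖ₑ
        ≤ ∫⁻ s : ℝ in Set.Ioi (0 : ℝ), ∫⁻ ω,
          ENNReal.ofReal ((w * g) ω * Real.exp (-δ ω * s)) ∂P := by
          refine setLIntegral_mono' measurableSet_Ioi fun s hs => ?_
          rw [l1_enorm]
          refine lintegral_mono_ae ?_
          have h1 := hb s.toNNReal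
          rw [Real.coe_toNNReal s (le_of_lt hs)] at h1
          filter_upwards [smul_le_mul_exp hw0 h1] with ω hω
          exact ENNReal.ofReal_le_ofReal hω
      _ = ∫⁻ ω, (∫⁻ s : ℝ in Set.Ioi (0 : ℝ),
          ENNReal.ofReal ((w * g) ω * Real.exp (-δ ω * s))) ∂P :=
        lintegral_lintegral_swap (measurable_mul_exp (w * g) δ).ennreal_ofReal.aemeasurable
      -- For almost every `ω` the time integral is `w g / δ`, at most `1` by the choice of `w`.
      _ ≤ ∫⁻ _, 1 ∂P := by
          refine lintegral_mono_ae ?_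
          filter_upwards [hδ, nonneg_iff.1 (mul_nonneg hw0 hg), le_iff.1 hwgδ, coeFn_inv δ,
            coeFn_mul' (w * g) (L0.inv δ), coeFn_one' (P := P) (R := ℝ)] with ω h1 h2 h3 h4 h5 h6
          rw [lintegral_mul_exp_neg h2 h1, ← ENNReal.ofReal_one]
          refine ENNReal.ofReal_le_ofReal ?_
          rw [← mul_assoc, h5, h4, h6] at h3
          exact h3
      _ < ⊤ := by simp
  refine ⟨toScalar 𝕜 (L0.inv w) • ((∫ s in Set.Ioi 0, F s : N.l1) : S), w, hwpos, F, hFc, hFi,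
    fun s => ?_, ?_⟩
  · change toScalar 𝕜 w • f (s : ℝ).toNNReal = _
    rw [Real.toNNReal_coe]
  · rw [smul_smul, mul_comm, ← toScalar_mul, L0.inv_mul_cancel hwpos, toScalar_one, one_smul]

namespace HasIntegral

variable [CompleteSpace N.l1]

theorem norm_le (h : N.HasIntegral f I) (hg : 0 ≤ g) (hδ : ∀ᵐ ω ∂P, 0 < δ ω)
    (hb : ∀ s : ℝ≥0, N (f s) ≤ g * exp (-δ * AEEqFun.const Ω (s : ℝ))) :
    N I ≤ g * L0.inv δ := by
  obtain ⟨w, hw, F, -, hF, hFf, hI⟩ := h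
  have hw0 : 0 ≤ w := nonneg_iff.2 (by filter_upwards [hw] with ω h using h.le)
  have h1 := ofReal_integral_le measurableSet_Ioi hF (measurable_mul_exp (w * g) δ) fun s hs => by
    have e : (F s : S) = _ := hFf ⟨s, le_of_lt hs⟩
    rw [e]
    exact smul_le_mul_exp hw0 (hb ⟨s, le_of_lt hs⟩)
  rw [← hI, N.real_smul_of_nonneg hw0] at h1
  rw [le_iff]
  filter_upwards [h1, hw, hδ, nonneg_iff.1 hg, nonneg_iff.1 (N.nonneg I), coeFn_mul' w (N I),
    coeFn_mul' w g, coeFn_mul' g (L0.inv δ), coeFn_inv δ] with ω h2 h3 h4 h5 h6 h7 h8 h9 h10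
  rw [h7, h8, lintegral_mul_exp_neg (mul_nonneg h3.le h5) h4, ENNReal.ofReal_le_ofReal_iff
    (mul_nonneg (mul_nonneg h3.le h5) (inv_nonneg.2 h4.le)), mul_assoc] at h2
  rw [h9, h10]
  exact le_of_mul_le_mul_left h2 h3

theorem sub_shift_le (h : N.HasIntegral f I) (hg : 0 ≤ g) (hb : ∀ s : ℝ≥0, N (f s) ≤ g)
    {t : ℝ≥0} {J : S} (hJ : N.HasIntegral (fun s => f (s + t)) J) :
    N (I - J) ≤ AEEqFun.const Ω (t : ℝ) * g := by
  obtain ⟨w, hw, F, hFc, hFf, hI⟩ := h.sub_shift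
  have hw0 : 0 ≤ w := nonneg_iff.2 (by filter_upwards [hw] with ω h using h.le)
  have hG : Measurable (Function.uncurry fun (_ : ℝ) (ω : Ω) => (w * g) ω) :=
    (w * g).measurable.comp measurable_snd
  have h1 := ofReal_integral_le (D := Set.Ioc (0 : ℝ) t) measurableSet_Ioc hFc.integrableOn_Ioc
    hG fun s hs => by
    have e : (F s : S) = _ := hFf ⟨s, hs.1.le⟩
    rw [e, N.real_smul_of_nonneg hw0]
    exact le_iff.1 (mul_le_mul_of_nonneg_left (hb _) hw0)
  rw [← intervalIntegral.integral_of_le t.coe_nonneg, ← hI t J hJ,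
    N.real_smul_of_nonneg hw0] at h1
  rw [le_iff]
  filter_upwards [h1, hw, nonneg_iff.1 hg, coeFn_mul' w (N (I - J)), coeFn_mul' w g,
    coeFn_mul' (AEEqFun.const Ω (t : ℝ)) g, coeFn_const' (P := P) (t : ℝ)]
    with ω h2 h3 h4 h5 h6 h7 h8
  rw [setLIntegral_const, Real.volume_Ioc, sub_zero, h5, h6,
    ← ENNReal.ofReal_mul (mul_nonneg h3.le h4), ENNReal.ofReal_le_ofReal_iff
    (mul_nonneg (mul_nonneg h3.le h4) t.coe_nonneg), mul_assoc] at h2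
  rw [h7, h8, mul_comm]
  exact le_of_mul_le_mul_left h2 h3

/-- The weighted difference is the integral of `F` over `[0, t]`; the fundamental theorem of
calculus in `l1` gives the derivative at `0`, and the weight is divided out. -/
theorem tendsTo_sub_shift (h : N.HasIntegral f I) {J : ℝ≥0 → S}
    (hJ : ∀ t, N.HasIntegral (fun s => f (s + t)) (J t)) :
    N.TendsTo (fun t : ℝ≥0 => toScalar 𝕜 (AEEqFun.const Ω (t : ℝ)⁻¹ : Ω →ₘ[P] ℝ) • (I - J t))
      (𝓝[>] 0) (f 0) := by
  obtain ⟨w, hw, F, hFc, hFf, hI⟩ := h.sub_shift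
  have h1 : HasDerivAt (fun u => ∫ s in (0 : ℝ)..u, F s) (F 0) 0 :=
    (hFc.integral_hasStrictDerivAt 0 0).hasDerivAt
  have h2 := (h1.tendsto_slope_zero_right).comp tendsto_coe_nnreal_nhdsGT
  have h3 := TendsTo.const_smul (L0.inv w) (tendsTo_of_l1 h2)
  have e0 : (F 0 : S) = toScalar 𝕜 w • f 0 := hFf 0
  rw [e0, smul_smul, ← toScalar_mul, L0.inv_mul_cancel hw, toScalar_one, one_smul] at h3
  refine h3.congr fun t => ?_
  rw [Function.comp_apply, zero_add, intervalIntegral.integral_same, sub_zero, l1_coe_smul,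
    ← hI t (J t) (hJ t), smul_comm, smul_smul (toScalar 𝕜 (L0.inv w)), ← toScalar_mul,
    L0.inv_mul_cancel hw, toScalar_one, one_smul]

end HasIntegral

end RandomNorm

/-! ### From the semigroup to resolvent estimates -/

namespace RandomNorm

open L0 PartialOp

variable {Ω : Type*} [MeasurableSpace Ω] {P : Measure Ω} {𝕜 : Type*} [RCLike 𝕜]
  {S : Type*} [AddCommGroup S] [Module (Ω →ₘ[P] 𝕜) S] [IsProbabilityMeasure P]
  {N : RandomNorm P 𝕜 S} {C : S →ₗ[Ω →ₘ[P] 𝕜] S} {V W : ℝ≥0 → (S →ₗ[Ω →ₘ[P] 𝕜] S)}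
  {M ξ δ g : Ω →ₘ[P] ℝ} {f : ℝ≥0 → S} {x y : S}

/-- `f` is a continuous path of exponential decay on which the semigroup acts by translation,
up to a factor `C`. -/
structure IsDecayingOrbit (N : RandomNorm P 𝕜 S) (C : S →ₗ[Ω →ₘ[P] 𝕜] S)
    (V : ℝ≥0 → (S →ₗ[Ω →ₘ[P] 𝕜] S)) (δ g : Ω →ₘ[P] ℝ) (f : ℝ≥0 → S) : Prop where
  continuous : ∀ s, N.TendsTo f (𝓝 s) (f s)
  le : ∀ s : ℝ≥0, N (f s) ≤ g * exp (-δ * AEEqFun.const Ω (s : ℝ))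
  apply_apply : ∀ s t, V t (f s) = C (f (s + t))

theorem IsDecayingOrbit.le_zero (h : N.IsDecayingOrbit C V δ g f) : N (f 0) ≤ g := by
  have h1 := h.le 0
  have e : (AEEqFun.const Ω ((0 : ℝ≥0) : ℝ) : Ω →ₘ[P] ℝ) = 0 := rfl
  rwa [e, mul_zero, exp_zero, mul_one] at h1

/-- The integrals `∫ f (s + t) ds` of the translates of a decaying orbit form a decaying orbit. -/
theorem IsDecayingOrbit.exists_integral [CompleteSpace N.l1] (hV : N.IsCSemigroup C V)
    (hδ : ∀ᵐ ω ∂P, 0 < δ ω) (hg : 0 ≤ g)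
    (h : N.IsDecayingOrbit C V δ g f) :
    ∃ F, N.IsDecayingOrbit C V δ (g * L0.inv δ) F ∧
      N.TendsTo (fun t : ℝ≥0 => toScalar 𝕜 (AEEqFun.const Ω (t : ℝ)⁻¹ : Ω →ₘ[P] ℝ) •
        (F 0 - F t)) (𝓝[>] 0) (f 0) := by
  -- Translation by `t` contributes the factor `e ^ (-δ t)` to the constant, so the tail integrals
  -- inherit the rate `δ`.
  have hshift : ∀ s t : ℝ≥0, N (f (s + t)) ≤
      g * exp (-δ * AEEqFun.const Ω (t : ℝ)) * exp (-δ * AEEqFun.const Ω (s : ℝ)) := by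
    intro s t
    refine (h.le (s + t)).trans_eq ?_
    have e : (AEEqFun.const Ω ((s + t : ℝ≥0) : ℝ) : Ω →ₘ[P] ℝ) =
        AEEqFun.const Ω (t : ℝ) + AEEqFun.const Ω (s : ℝ) := by
      rw [add_comm s t, NNReal.coe_add]
      rfl
    rw [e, mul_add, exp_add, mul_assoc]
  have hg' : ∀ t : ℝ≥0, 0 ≤ g * exp (-δ * AEEqFun.const Ω (t : ℝ)) := fun t =>
    mul_nonneg hg (exp_nonneg _)
  have hle : ∀ s, N (f s) ≤ g := fun s => (h.le s).trans
    (mul_le_of_le_one_right hg (exp_neg_mul_const_le_one hδ s.2))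
  have hex : ∀ t : ℝ≥0, ∃ I, N.HasIntegral (fun s => f (s + t)) I := fun t =>
    exists_hasIntegral (fun s => (h.continuous (s + t)).comp
      ((continuous_add_const t).tendsto s)) (hg' t) hδ (fun s => hshift s t)
  choose F hF using hex
  have hF0 : N.HasIntegral f (F 0) := by simpa using hF 0
  -- The two tails differ by the integral of `f` over an interval of length `t`.
  have hdist : ∀ s t : ℝ≥0, N (F (s + t) - F s) ≤ AEEqFun.const Ω (t : ℝ) * g := by
    intro s t
    rw [N.sub_comm]
    refine (hF s).sub_shift_le hg (fun _ => hle _) ?_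
    simpa only [add_assoc, add_comm t s] using hF (s + t)
  refine ⟨F, ⟨fun s => ?_, fun t => ?_, fun s t => ?_⟩, hF0.tendsTo_sub_shift hF⟩
  · have hlim : Tendsto (fun t : ℝ≥0 => probNorm (AEEqFun.const Ω |(t : ℝ) - s| * g)) (𝓝 s)
        (𝓝 0) := by
      refine tendsto_probNorm_of_ae_eq (F := fun t ω => |(t : ℝ) - s| * g ω) (fun t => ?_) ?_
      · filter_upwards [coeFn_mul' (AEEqFun.const Ω |(t : ℝ) - s|) g,
          coeFn_const' (P := P) |(t : ℝ) - s|] with ω h1 h2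
        rw [h1, h2]
      · refine ae_of_all _ fun ω => ?_
        have : Continuous fun t : ℝ≥0 => |(t : ℝ) - s| * g ω := by fun_prop
        simpa using this.tendsto s
    refine tendsTo_of_le hlim (Eventually.of_forall fun t => ?_)
    rcases le_total s t with hst | hst
    · obtain ⟨r, rfl⟩ := exists_add_of_le hst
      have := hdist s r
      simpa using this
    · obtain ⟨r, rfl⟩ := exists_add_of_le hst
      have := hdist t r
      rw [N.sub_comm] at this
      simpa [abs_sub_comm] using this
  · refine ((hF t).norm_le (hg' t) hδ (fun s => hshift s t)).trans_eq ?_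
    ring
  -- `V t` and `C` both pass under the integral, and the translation law holds for the integrands.
  · obtain ⟨η, h0, hη⟩ := hV.bounded t
    obtain ⟨c, hc0, hc⟩ := hV.bound_C
    have h1 := (hF s).map h0 hη
    have h2 := (hF (s + t)).map hc0 hc
    refine h1.unique ?_
    simpa only [h.apply_apply, add_assoc] using h2

/-- A vector whose orbit is `C F`, with `-F` having right derivative `y` at `0`. -/
theorem generates_of_tendsTo (hV : N.IsCSemigroup C V) {F : ℝ≥0 → S}
    (hF : ∀ t, V t x = C (F t)) (hx : C x = C (F 0))
    (h : N.TendsTo (fun t : ℝ≥0 => toScalar 𝕜 (AEEqFun.const Ω (t : ℝ)⁻¹ : Ω →ₘ[P] ℝ) •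
        (F 0 - F t)) (𝓝[>] 0) y) : N.Generates C V x (-y) := by
  obtain ⟨c, -, hc⟩ := hV.bound_C
  have h1 := (TendsTo.map hc h).neg
  rw [← _root_.map_neg] at h1
  refine h1.congr fun t => ?_
  rw [diffQuot_eq, hF, hx, LinearMap.map_smul, map_sub, ← _root_.smul_neg, neg_sub]

theorem IsCSemigroup.generates_apply (hV : N.IsCSemigroup C V) (t : ℝ≥0)
    (h : N.Generates C V x y) : N.Generates C V (V t x) (V t y) := by
  obtain ⟨η, -, hη⟩ := hV.bounded t
  have h1 := TendsTo.map hη h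
  rw [hV.comm] at h1
  refine h1.congr fun s => ?_
  rw [diffQuot, diffQuot, LinearMap.map_smul, map_sub, hV.comm, hV.apply_apply, hV.apply_apply,
    add_comm]

theorem IsCSemigroup.isDecayingOrbit (hV : N.IsCSemigroup C V)
    (hb : ∀ (s : ℝ≥0) z, N (V s z) ≤ M * exp (-δ * AEEqFun.const Ω (s : ℝ)) * N z) (z : S) :
    N.IsDecayingOrbit C V δ (M * N z) (fun s => V s z) where
  continuous := (N.continuous_iff).1 (hV.continuous z)
  le s := (hb s z).trans_eq (by ring)
  apply_apply s t := hV.apply_apply s t z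

section Decaying

variable [CompleteSpace N.l1] (hV : N.IsCSemigroup C V) (hC : Function.Injective C) (hM : 0 ≤ M)
  (hδ : ∀ᵐ ω ∂P, 0 < δ ω)
  (hb : ∀ (s : ℝ≥0) z, N (V s z) ≤ M * exp (-δ * AEEqFun.const Ω (s : ℝ)) * N z)

include hV hC hM hδ hb

omit hC in
-- `F 0` is the integral of `V s z` over `[0, ∞)`, that is, minus the inverse of the generator
-- applied to `C z`. The tails `F t` are kept because their derivative at `0` is used again below.
theorem exists_integral_orbit (z : S) :
    ∃ F, N.IsDecayingOrbit C V δ (M * N z * L0.inv δ) F ∧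
      N.TendsTo (fun t : ℝ≥0 => toScalar 𝕜 (AEEqFun.const Ω (t : ℝ)⁻¹ : Ω →ₘ[P] ℝ) •
        (F 0 - F t)) (𝓝[>] 0) (C z) ∧ N.Generates C V (F 0) (-(C z)) := by
  obtain ⟨F, hF, hlim⟩ := (hV.isDecayingOrbit hb z).exists_integral hV hδ
    (mul_nonneg hM (N.nonneg z))
  rw [hV.map_zero] at hlim
  exact ⟨F, hF, hlim, generates_of_tendsTo hV (fun t => by rw [hF.apply_apply, zero_add]) rfl hlim⟩

omit [CompleteSpace N.l1] in
theorem generates_inj {x x' y : S} (h : N.Generates C V x y) (h' : N.Generates C V x' y) :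
    x = x' := by
  have := h.sub h'
  rw [sub_self] at this
  exact sub_eq_zero.1 (hV.eq_zero_of_generates_zero hC hM hδ hb this)

/-- By injectivity of the generator, `x` must be the integral of the orbit of `-y`, which is bounded
by `M δ⁻¹ ‖y‖`. -/
theorem norm_le_of_generates (h : N.Generates C V x (C y)) : N x ≤ M * L0.inv δ * N y := by
  obtain ⟨F, hF, -, hgen⟩ := exists_integral_orbit hV hM hδ hb (-y)
  rw [_root_.map_neg, neg_neg] at hgen
  obtain rfl := generates_inj hV hC hM hδ hb h hgen
  refine hF.le_zero.trans_eq ?_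
  rw [N.map_neg]
  ring

/-- `C x` is the integral of the orbit of `-y`, so `V t x = F t` after cancelling `C`. The
difference quotients of `x` are then those of `F`, and converge to `C y`. This is the nontrivial
half of condition 5. -/
theorem generates_of_generates_map (h : N.Generates C V (C x) (C y)) : N.Generates C V x y := by
  obtain ⟨F, hF, hlim, hgen⟩ := exists_integral_orbit hV hM hδ hb (-y)
  rw [_root_.map_neg, neg_neg] at hgen
  have e : C x = F 0 := generates_inj hV hC hM hδ hb h hgen
  have hVF : ∀ t, V t x = F t := by
    intro t
    apply hC
    rw [← hV.comm, e, hF.apply_apply, zero_add]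
  have hlim' := hlim.neg
  rw [_root_.map_neg, neg_neg] at hlim'
  refine hlim'.congr fun t => ?_
  rw [diffQuot_eq, hVF, e, ← _root_.smul_neg, neg_sub]

theorem generates_closed {u v : ℕ → S} (hu : N.TendsTo u atTop x) (hv : N.TendsTo v atTop y)
    (h : ∀ n, N.Generates C V (u n) (v n)) : N.Generates C V x y := by
  obtain ⟨c, -, hc⟩ := hV.bound_C
  obtain ⟨F, -, -, hgen⟩ := exists_integral_orbit hV hM hδ hb (-y)
  rw [_root_.map_neg, neg_neg] at hgen
  -- `C (u n) - F 0` is sent to `C (v n - y)`, so continuity of the inverse gives the limit. It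
  -- follows that `C x = F 0` is sent to `C y`, and `C` is cancelled.
  have hlim : N.TendsTo (fun n => C (u n)) atTop (F 0) := by
    refine tendsTo_of_le (tendsto_probNorm_mul (M * L0.inv δ) (tendsTo_iff.1 hv))
      (Eventually.of_forall fun n => ?_)
    apply norm_le_of_generates hV hC hM hδ hb
    rw [map_sub]
    exact (hV.generates_map (h n)).sub hgen
  apply generates_of_generates_map hV hC hM hδ hb
  rwa [(TendsTo.map hc hu).unique hlim]

theorem exists_seq_generates (z : S) :
    ∃ u : ℕ → S, (∀ n, ∃ y, N.Generates C V (u n) y) ∧ N.TendsTo u atTop (C z) := by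
  obtain ⟨F, hF, hlim, hgen⟩ := exists_integral_orbit hV hM hδ hb z
  -- `C (F t) = V t (F 0)` lies in the domain with image `C (-(V t z))`, and `C` can be cancelled.
  -- The quotients `(F 0 - F t) / t` are therefore in the domain and approximate `C z`.
  have hFt : ∀ t, N.Generates C V (F t) (-(V t z)) := by
    intro t
    apply generates_of_generates_map hV hC hM hδ hb
    have h := hV.generates_apply t hgen
    rwa [hF.apply_apply, zero_add, _root_.map_neg, hV.comm, ← _root_.map_neg] at h
  have htn : Tendsto (fun n : ℕ => 1 / ((n : ℝ≥0) + 1)) atTop (𝓝[>] (0 : ℝ≥0)) := by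
    refine tendsto_nhdsWithin_of_tendsto_nhds_of_eventually_within _ ?_
      (Eventually.of_forall fun n => ?_)
    · rw [← NNReal.tendsto_coe]
      simpa using tendsto_one_div_add_atTop_nhds_zero_nat (𝕜 := ℝ)
    · change (0 : ℝ≥0) < 1 / ((n : ℝ≥0) + 1)
      positivity
  exact ⟨_, fun n => ⟨_, ((hFt 0).sub (hFt (1 / ((n : ℝ≥0) + 1)))).smul _⟩, hlim.comp htn⟩

omit hC in
/-- The powers of the resolvent along `C z` are the initial values of iterated integrals. -/
theorem exists_mem_graph_invPow {B : S →ₗ.[Ω →ₘ[P] 𝕜] S} (hB : Function.Injective B)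
    (hgr : ∀ {x y}, N.Generates C V x (-y) → (x, y) ∈ B.graph) (z : S) (n : ℕ) :
    ∃ f, N.IsDecayingOrbit C V δ (M * L0.inv δ ^ n * N z) f ∧
      (C z, f 0) ∈ (invPow B n).graph := by
  induction n with
  | zero =>
    refine ⟨fun s => V s z, by simpa using hV.isDecayingOrbit hb z, ?_⟩
    exact mem_graph_invPow_zero.2 (LinearMap.congr_fun hV.map_zero z).symm
  | succ n ih =>
    obtain ⟨f, hf, hgraph⟩ := ih
    obtain ⟨F, hF, hlim⟩ := hf.exists_integral hV hδ
      (mul_nonneg (mul_nonneg hM (pow_nonneg (L0.inv_nonneg hδ) n)) (N.nonneg z))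
    -- Integration solves `B (F 0) = f 0` and contributes one factor `δ⁻¹` to the bound.
    refine ⟨F, ?_, (mem_graph_invPow_succ hB).2 ⟨f 0, hgraph, hgr ?_⟩⟩
    · convert hF using 1
      ring
    · exact generates_of_tendsTo hV (fun t => by rw [hF.apply_apply, zero_add]) rfl hlim

end Decaying

/-- The necessary conditions on the generator of a `C`-semigroup in `H(M, ξ)`. -/
theorem IsGenerator.hilleYosida (hS : N.IsComplete) (hCinj : Function.Injective C)
    (hCdense : N.IsDense (Set.range C)) (hM : 0 ≤ M) {A : S →ₗ.[Ω →ₘ[P] 𝕜] S}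
    (hW : N.MemH C M ξ W) (hA : N.IsGenerator C W A) :
    (N.IsClosedOperator A ∧ N.IsDense (A.domain : Set S)) ∧
      (∀ η : Ω →ₘ[P] ℝ, L0.StrictLT ξ η → toScalar 𝕜 η ∈ cResolventSet C A) ∧
      (∀ η : Ω →ₘ[P] ℝ, L0.StrictLT ξ η → ∀ n : ℕ,
        ∃ h : LinearMap.range C ≤ (invPow (shift (toScalar 𝕜 η) A) n).domain,
          N.OpNormLE (compOfRangeLE (invPow (shift (toScalar 𝕜 η) A) n) C h)
            (M * L0.inv (η - ξ) ^ n)) ∧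
      A.graph = conjGraph C A := by
  have := l1_completeSpace hS
  -- Damping by `e ^ (-η s)` replaces the generator by `A - η` and the exponent `ξ` by `-(η - ξ)`.
  have hV := fun η : Ω →ₘ[P] ℝ => hW.1.rescale (-η)
  have hδ : ∀ η : Ω →ₘ[P] ℝ, L0.StrictLT ξ η → ∀ᵐ ω ∂P, 0 < (η - ξ) ω := fun η h =>
    strictLT_iff_sub.1 h
  have hb : ∀ (η : Ω →ₘ[P] ℝ) (s : ℝ≥0) z, N (rescale (-η) W s z) ≤
      M * exp (-(η - ξ) * AEEqFun.const Ω (s : ℝ)) * N z := by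
    intro η s z
    have h := rescale_le (hW.2 s).le (-η) z
    rwa [← sub_eq_add_neg, ← neg_sub] at h
  have hgr : ∀ (η : Ω →ₘ[P] ℝ) {x y : S}, (x, y) ∈ (shift (toScalar 𝕜 η) A).graph ↔
      N.Generates C (rescale (-η) W) x (-y) := by
    intro η x y
    rw [mem_graph_shift, hA.mem_graph hCinj, generates_rescale_iff, toScalar_neg, neg_smul,
      sub_neg_eq_add, neg_add_eq_sub]
  have hgrA : ∀ (η : Ω →ₘ[P] ℝ) {x y : S}, (x, y) ∈ A.graph ↔
      N.Generates C (rescale (-η) W) x (y - toScalar 𝕜 η • x) := by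
    intro η x y
    rw [hA.mem_graph hCinj, generates_rescale_iff, toScalar_neg, neg_smul, sub_neg_eq_add,
      sub_add_cancel]
  have hinj : ∀ η : Ω →ₘ[P] ℝ, L0.StrictLT ξ η →
      Function.Injective (shift (toScalar 𝕜 η) A) := by
    intro η hη
    rw [injective_iff]
    intro x hx
    rw [hgr, neg_zero] at hx
    exact (hV η).eq_zero_of_generates_zero hCinj hM (hδ η hη) (hb η) hx
  -- Closedness, density and condition 5 require a single admissible `η`; `ξ + 1` is taken.
  have h1 := strictLT_add_const ξ one_pos
  set η₁ : Ω →ₘ[P] ℝ := ξ + AEEqFun.const Ω (1 : ℝ)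
  refine ⟨⟨?_, ?_⟩, fun η hη => ⟨hinj η hη, ?_⟩, fun η hη n => ?_, ?_⟩
  · let := N.normedGroup
    change IsClosed (A.graph : Set (S × S))
    refine IsSeqClosed.isClosed fun u p hu hp => ?_
    have hx : N.TendsTo (fun n => (u n).1) atTop p.1 := (continuous_fst.tendsto p).comp hp
    have hy : N.TendsTo (fun n => (u n).2) atTop p.2 := (continuous_snd.tendsto p).comp hp
    exact (hgrA η₁).2 (generates_closed (hV η₁) hCinj hM (hδ η₁ h1) (hb η₁) hx
      (hy.sub (hx.const_smul η₁)) fun n => (hgrA η₁).1 (hu n))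
  · refine hCdense.of_closure ?_
    rintro _ ⟨z, rfl⟩
    obtain ⟨u, hu, hlim⟩ := exists_seq_generates (hV η₁) hCinj hM (hδ η₁ h1) (hb η₁) z
    refine ⟨u, fun n => ?_, hlim⟩
    obtain ⟨y, hy⟩ := hu n
    refine A.mem_domain_of_mem_graph (y := y + toScalar 𝕜 η₁ • u n) ((hgrA η₁).2 ?_)
    rwa [add_sub_cancel_right]
  · rintro _ ⟨z, rfl⟩
    obtain ⟨F, -, -, hF⟩ := exists_integral_orbit (hV η) hM (hδ η hη) (hb η) z
    obtain ⟨u, -, hu⟩ := (LinearPMap.mem_graph_iff _).1 ((hgr η).2 hF)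
    exact ⟨u, hu⟩
  · have hmem := exists_mem_graph_invPow (hV η) hM (hδ η hη) (hb η) (hinj η hη)
      (fun {x y} => (hgr η (x := x) (y := y)).2)
    have hr : LinearMap.range C ≤ (invPow (shift (toScalar 𝕜 η) A) n).domain := by
      rintro _ ⟨z, rfl⟩
      obtain ⟨f, -, hf⟩ := hmem z n
      exact LinearPMap.mem_domain_of_mem_graph hf
    refine ⟨hr, opNormLE_of_le (mul_nonneg hM (pow_nonneg (L0.inv_nonneg (hδ η hη)) n))
      fun z => ?_⟩
    obtain ⟨f, hf, hf0⟩ := hmem z n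
    rw [LinearPMap.mem_graph_snd_inj _ (mem_graph_compOfRangeLE hr z) hf0 rfl]
    exact hf.le_zero
  · ext ⟨x, y⟩
    rw [mem_conjGraph, hA.mem_graph hCinj]
    constructor
    · intro h
      exact (hA.mem_graph hCinj).2 (hW.1.generates_map h)
    · intro h
      -- Since `C` commutes with scalars, the shift by `η₁` keeps the second component in the form
      -- `C (y - η₁ x)`, as `generates_of_generates_map` requires.
      rw [hgrA η₁, ← LinearMap.map_smul, ← map_sub] at h
      rw [← hA.mem_graph hCinj, hgrA η₁]
      exact generates_of_generates_map (hV η₁) hCinj hM (hδ η₁ h1) (hb η₁) h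

end RandomNorm

/-! ### The equivalence -/

theorem theorem4p11 {Ω : Type*} [MeasurableSpace Ω] {P : Measure Ω} [IsProbabilityMeasure P]
    {𝕜 : Type*} [RCLike 𝕜] {S : Type*} [AddCommGroup S] [Module (Ω →ₘ[P] 𝕜) S]
    (N : RandomNorm P 𝕜 S) (hS : N.IsComplete)
    (C : S →ₗ[Ω →ₘ[P] 𝕜] S) (hC : N.IsBoundedHom C) (hCinj : Function.Injective C)
    (hCdense : N.IsDense (Set.range C))
    (A : S →ₗ.[Ω →ₘ[P] 𝕜] S) (M ξ : Ω →ₘ[P] ℝ) (hM : 0 ≤ M) :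
    (∃ W : ℝ≥0 → (S →ₗ[Ω →ₘ[P] 𝕜] S), N.MemH C M ξ W ∧ N.IsGenerator C W A) ↔
      ((N.IsClosedOperator A ∧ N.IsDense (A.domain : Set S)) ∧
        (∀ η : Ω →ₘ[P] ℝ, L0.StrictLT ξ η →
          L0.toScalar 𝕜 η ∈ PartialOp.cResolventSet C A) ∧
        (∀ η : Ω →ₘ[P] ℝ, L0.StrictLT ξ η → ∀ n : ℕ, 1 ≤ n →
          LinearMap.range C ≤
            (PartialOp.invPow (PartialOp.shift (L0.toScalar 𝕜 η) A) n).domain) ∧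
        (∀ η : Ω →ₘ[P] ℝ, L0.StrictLT ξ η → ∀ n : ℕ, 1 ≤ n →
          ∃ h : LinearMap.range C ≤
              (PartialOp.invPow (PartialOp.shift (L0.toScalar 𝕜 η) A) n).domain,
            N.OpNormLE
              (PartialOp.compOfRangeLE
                (PartialOp.invPow (PartialOp.shift (L0.toScalar 𝕜 η) A) n) C h)
              (M * L0.inv (η - ξ) ^ n)) ∧
        A.graph = PartialOp.conjGraph C A) := by
  constructor
  · rintro ⟨W, hW, hA⟩
    obtain ⟨h1, h2, h3, h4⟩ := hA.hilleYosida hS hCinj hCdense hM hW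
    exact ⟨h1, h2, fun η hη n _ => (h3 η hη n).1, fun η hη n _ => h3 η hη n, h4⟩
  · rintro ⟨⟨-, hdense⟩, hres, -, hpow, hconj⟩
    exact RandomNorm.exists_generated_semigroup N hS hC hCinj hCdense hM hdense hres hpow hconj
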